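/- For a set $S\subset L^2(\mathbb R)$ (complex-valued functions) let $V(S)$ be the closed linear span in $L^2(\mathbb R)$ of $\{f(\cdot-n): f\in S,\ n\in\mathbb Z\}$. For a finite family $F=\{f_k\}_{k=1}^K\subset L^2(\mathbb R)$ write $V(F)$ for the space so generated, and let $\mathcal T(F)=\{f_k(\cdot-n): 1\le k\le K,\ n\in\mathbb Z\}$. Let $J$ be the minimal cardinality of a set $S\subset L^2(\mathbb R)$ with $V(S)=V(F)$. The space $V(F)$ has *non-trivial extra invariance* if there is $\gamma\in\mathbb R\setminus\mathbb Z$ with $J\gamma\notin\mathbb Z$ such that $h(\cdot-\gamma)\in V(F)$ for every $h\in V(F)$. A system $\{g_n\}$ in a Hilbert space $H$ is *exact* if its closed linear span is $H$ and no $g_n$ lies in the closed linear span of the remaining elements; it is a *$(C_q)$-system* if there is $C>0$ such that every $f\in H$ can be approximated arbitrarily well by finite linear combinations $\sum a_n g_n$ with $\|(a_n)\|_{\ell^q}\le C\|f\|_H$; it is an *exact $(C_q)$-system* if it is both. **Theorem.** Let $2\le q\le\infty$ and let $q'$ be the conjugate exponent, $1/q+1/q'=1$. (a) Let $F=\{f_k\}_{k=1}^K\subset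 L^2(\mathbb R)$. If $V(F)$ has non-trivial extra invariance and $\mathcal T(F)$ is an exact $(C_q)$-system for $V(F)$, then there is $k\in\{1,\dots,K\}$ such that $$\int_{\mathbb R}|x|^t|f_k(x)|^2\,dx=\infty\qquad\text{for every } t\ge 2/q'.$$ (b) The condition $t\ge 2/q'$ is sharp: for every $0\le t<2/q'$ there is $f\in L^2(\mathbb R)$ such that, with $F=\{f\}$, $V(F)$ has non-trivial extra invariance, $\mathcal T(F)$ is an exact $(C_q)$-system for $V(F)$, and $\int_{\mathbb R}|x|^t|f(x)|^2\,dx<\infty$. -/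

import Mathlib

open MeasureTheory
open scoped ENNReal

noncomputable section

/-! ### Exact `(C_q)`-systems in a Hilbert space -/

section Systems

variable {ι H : Type*} [NormedAddCommGroup H] [InnerProductSpace ℂ H]

/-- The `ℓ^q` norm of a finitely supported sequence (the norm of Mathlib's space `lp`;
for `q = ∞` it is the supremum norm). -/
def lqNorm (q : ℝ≥0∞) (a : ι →₀ ℂ) : ℝ :=
  ‖(⟨fun i => a i, (memℓp_zero a.hasFiniteSupport).of_exponent_ge zero_le⟩ :
    lp (fun _ : ι => ℂ) q)‖

/-- `g` is a `(C_q)`-system in `H`: there is `C > 0` such that every `f ∈ H` can be approximated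
arbitrarily well by finite linear combinations `∑ aₙ gₙ` with `‖a‖_{ℓ^q} ≤ C ‖f‖`. -/
def IsCqSystem (q : ℝ≥0∞) (g : ι → H) : Prop :=
  ∃ C : ℝ, 0 < C ∧ ∀ f : H, ∀ ε : ℝ, 0 < ε → ∃ a : ι →₀ ℂ,
    lqNorm q a ≤ C * ‖f‖ ∧ ‖f - Finsupp.linearCombination ℂ g a‖ < ε

/-- `g` is complete in `H`: its closed linear span is all of `H`. -/
def IsCompleteSystem (g : ι → H) : Prop :=
  (Submodule.span ℂ (Set.range g)).topologicalClosure = ⊤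

/-- `g` is minimal: each element lies outside the closed linear span of the remaining ones. -/
def IsMinimalSystem (g : ι → H) : Prop :=
  ∀ i : ι, g i ∉ (Submodule.span ℂ (g '' {i}ᶜ)).topologicalClosure

/-- An exact system: complete and minimal. -/
def IsExactSystem (g : ι → H) : Prop :=
  IsCompleteSystem g ∧ IsMinimalSystem g

/-- An exact `(C_q)`-system in `H`. -/
def IsExactCqSystem (q : ℝ≥0∞) (g : ι → H) : Prop :=
  IsExactSystem g ∧ IsCqSystem q g

end Systems

/-! ### Shift-invariant spaces in `L²(ℝ)` -/

/-- The space `L²(ℝ)` of complex-valued functions. -/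
abbrev L2R : Type := Lp ℂ 2 (volume : Measure ℝ)

/-- The translate `x ↦ f (x - a)`. -/
def l2Translate (a : ℝ) (f : L2R) : L2R :=
  Lp.compMeasurePreserving (fun x : ℝ => x - a) (measurePreserving_sub_right volume a) f

/-- The shift-invariant space `V(S)` generated by a set `S ⊆ L²(ℝ)`: the closed linear span of
all integer translates of the elements of `S`. -/
def shiftInvariantSpace (S : Set L2R) : Submodule ℂ L2R :=
  (Submodule.span ℂ {h : L2R | ∃ f ∈ S, ∃ n : ℤ, h = l2Translate (n : ℝ) f}).topologicalClosure

/-- The system `𝒯(F) = {f_k(x - n) : n ∈ ℤ, k = 1, …, K}`, as a system in the Hilbert space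
`V(F)`. -/
def integerTranslates {K : ℕ} (F : Fin K → L2R) :
    Fin K × ℤ → shiftInvariantSpace (Set.range F) := fun p =>
  ⟨l2Translate (p.2 : ℝ) (F p.1), Submodule.le_topologicalClosure _
    (Submodule.subset_span ⟨F p.1, Set.mem_range_self p.1, p.2, rfl⟩)⟩

/-- The minimal cardinality `J` of a set `S ⊆ L²(ℝ)` with `V(S) = V`. Only used for spaces `V`
that have a finite generating set, for which the set of numbers below is non-empty. -/
def minGenerators (V : Submodule ℂ L2R) : ℕ :=
  sInf {n : ℕ | ∃ S : Finset L2R, S.card = n ∧ shiftInvariantSpace (S : Set L2R) = V}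

/-- `V` has non-trivial extra invariance: for some `γ ∈ ℝ \ ℤ`, `V` is invariant under translation
by `γ` and `J γ ∉ ℤ`, where `J` is the minimal number of generators of `V`. -/
def HasNontrivialExtraInvariance (V : Submodule ℂ L2R) : Prop :=
  ∃ γ : ℝ, γ ∉ Set.range ((↑) : ℤ → ℝ) ∧ (∀ h ∈ V, l2Translate γ h ∈ V) ∧
    (minGenerators V : ℝ) * γ ∉ Set.range ((↑) : ℤ → ℝ)

/-- The moment `∫ |x|^t |f(x)|² dx ∈ [0, ∞]`. -/
def moment (t : ℝ) (f : L2R) : ℝ≥0∞ :=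
  ∫⁻ x : ℝ, ENNReal.ofReal (|x| ^ t * ‖f x‖ ^ 2)

end

/-! Part (a) is an uncertainty principle on the Fourier side. Exactness gives dual functions `h_k ∈
V(F)` with translates biorthogonal to those of `F`. After periodization, for a.e. `ξ` the fibers
`(f̂_j(ξ + m))_m` and `(ĥ_k(ξ + m))_m` are biorthogonal (`TranslatesBiorthogonal.ae_fiber`). Fibers
of `F` are thus linearly independent and `J = K`. The translations preserving `V(F)` form a closed
subgroup of `ℝ` containing `ℤ`, so extra invariance yields some `1/N` in it with `N ∤ K`
(`exists_one_div_mem_translationGroup`).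

Invariance under `1/N` means that restricting sequences to `Nℤ` maps the `K`-dimensional fiber space
at `ξ` to itself. This restriction is a projection of some rank `D(ξ)`, and `D(ξ) + ... + D(ξ + N -
1) = K` because the residue classes mod `N` share out the fiber space. Since `K/N` is not an
integer, `D` cannot be nearly constant: for every `δ` some interval of length `δ` has both `D > r`
and `D ≤ r` on a fixed proportion of it (`exists_interval_oscillation`). When the ranks at `x` and
`y` differ, the fibers at `x` and `y` cannot be close relative to the dual fibers
(`FiberRegular.one_le_sum`). Integrating over such pairs gives `δ ≲ Ω(δ) W(δ)`, with `Ω` the `L²`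
modulus of continuity of the `f̂_j` and `W` the largest `L²` norm of an `ĥ_k` over a `ℤ`-periodic
set of intervals of length `δ`.

The `(C_q)` property, dualized, gives `W(δ) = O(δ^{1/q})` (`setLIntegral_periodicInterval_dual_le`).
If all moments of order `2/q'` were finite, then `Ω(δ) = o(δ^{1/q'})` for `q < ∞`, and the product
is `o(δ)`. For `q = ∞` only `Ω(δ) = O(δ)` is available, but `W(δ) → 0` by absolute continuity of the
integral. Either way this is a contradiction (`false_of_smooth`).

For (b), take `f̂ = d^α` on `(0, 1)`, with `d` the distance to the boundary and `0 ≤ α < 1/2`. The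
dual has transform `d^{-α} ∈ L²`, every translation preserves `V(f)`, and `J = 1`. Splitting into
dyadic layers of `d` proves the `(C_q)` property for `α < 1/2 - 1/q` (`isCqSystem_of_pieces`), while
Hölder regularity of `d^α` in `L²` gives all moments of order below `2α + 1`
(`moment_edgeGenerator_lt_top`). As `α` approaches `1/2 - 1/q` these orders approach `2/q'`. -/

/-! ### The character `t ↦ exp (2πit)` -/

open Real Filter Topology FourierTransform ComplexConjugate

/-- The character `t ↦ exp (2πit)` of `ℝ`. -/
noncomputable def phase (t : ℝ) : ℂ := (Real.fourierChar t : ℂ)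

lemma phase_eq (t : ℝ) : phase t = Complex.exp (2 * π * t * Complex.I) := by
  simp [phase, Real.fourierChar_apply]

lemma phase_zero : phase 0 = 1 := by simp [phase_eq]

lemma phase_add (s t : ℝ) : phase (s + t) = phase s * phase t := by
  simp only [phase_eq, ← Complex.exp_add]; push_cast; ring_nf

lemma norm_phase (t : ℝ) : ‖phase t‖ = 1 := Circle.norm_coe _

lemma enorm_phase (t : ℝ) : ‖phase t‖ₑ = 1 := by
  rw [← ofReal_norm, norm_phase, ENNReal.ofReal_one]

lemma phase_int (n : ℤ) : phase n = 1 := by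
  rw [phase_eq, Complex.exp_eq_one_iff]; exact ⟨n, by push_cast; ring⟩

lemma phase_nsmul (n : ℕ) (t : ℝ) : phase (n * t) = phase t ^ n := by
  simp only [phase_eq, ← Complex.exp_nat_mul]; push_cast; ring_nf

lemma continuous_phase : Continuous phase := by
  have : phase = fun t : ℝ => Complex.exp (2 * π * t * Complex.I) := funext phase_eq
  rw [this]; fun_prop

lemma re_phase (t : ℝ) : (phase t).re = Real.cos (2 * π * t) := by
  rw [phase_eq, Complex.exp_re]; simp

lemma norm_phase_sub_one_sq (t : ℝ) : ‖phase t - 1‖ ^ 2 = 4 * Real.sin (π * t) ^ 2 := by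
  have h := Complex.normSq_apply (phase t)
  rw [← Complex.sq_norm, norm_phase] at h
  rw [Complex.sq_norm, Complex.normSq_apply]
  simp only [Complex.sub_re, Complex.sub_im, Complex.one_re, Complex.one_im, sub_zero]
  have h2 : (phase t).re = 1 - 2 * Real.sin (π * t) ^ 2 := by
    rw [re_phase, mul_assoc, Real.cos_two_mul, Real.cos_sq']; ring
  nlinarith

lemma norm_phase_sub_one_le_two (t : ℝ) : ‖phase t - 1‖ ≤ 2 := by
  refine (norm_sub_le _ _).trans ?_
  rw [norm_phase, norm_one]; norm_num

lemma norm_phase_sub_one_le (t : ℝ) : ‖phase t - 1‖ ≤ 2 * π * |t| := by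
  refine abs_le_of_sq_le_sq' ?_ (by positivity) |>.2
  rw [norm_phase_sub_one_sq]
  have : Real.sin (π * t) ^ 2 ≤ (π * |t|) ^ 2 := by
    rw [← sq_abs]
    gcongr
    refine Real.abs_sin_le_abs.trans ?_
    rw [abs_mul, abs_of_pos pi_pos]
  nlinarith

/-! ### Translations of `L²(ℝ)` -/

/-- Translation as a linear isometry. -/
noncomputable def l2TranslateIso (a : ℝ) : L2R →ₗᵢ[ℂ] L2R :=
  Lp.compMeasurePreservingₗᵢ ℂ (fun x : ℝ => x - a) (measurePreserving_sub_right volume a)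

lemma l2TranslateIso_apply (a : ℝ) (f : L2R) : l2TranslateIso a f = l2Translate a f := rfl

lemma l2Translate_coeFn (a : ℝ) (f : L2R) : l2Translate a f =ᵐ[volume] fun x => f (x - a) :=
  Lp.coeFn_compMeasurePreserving f (measurePreserving_sub_right volume a)

lemma ae_comp_add {p : ℝ → Prop} (h : ∀ᵐ x, p x) (a : ℝ) : ∀ᵐ x, p (x + a) :=
  (measurePreserving_add_right volume a).quasiMeasurePreserving.ae h

lemma ae_comp_sub {p : ℝ → Prop} (h : ∀ᵐ x, p x) (a : ℝ) : ∀ᵐ x, p (x - a) :=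
  (measurePreserving_sub_right volume a).quasiMeasurePreserving.ae h

lemma ae_forall_comp_add_int {p : ℝ → Prop} (h : ∀ᵐ x, p x) : ∀ᵐ x : ℝ, ∀ n : ℤ, p (x + n) :=
  ae_all_iff.2 fun n => ae_comp_add h n

lemma l2Translate_l2Translate (a b : ℝ) (f : L2R) :
    l2Translate a (l2Translate b f) = l2Translate (a + b) f := by
  ext1
  filter_upwards [l2Translate_coeFn a (l2Translate b f), l2Translate_coeFn (a + b) f,
    ae_comp_sub (l2Translate_coeFn b f) a] with x h1 h2 h3
  rw [h1, h2, h3]; ring_nf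

lemma l2Translate_zero (f : L2R) : l2Translate 0 f = f := by
  ext1
  filter_upwards [l2Translate_coeFn 0 f] with x h1
  simp [h1]

lemma continuous_l2Translate_left (f : L2R) : Continuous fun a => l2Translate a f := by
  have hg : Continuous fun a : ℝ => (⟨fun x : ℝ => x - a, by fun_prop⟩ : C(ℝ, ℝ)) := by
    refine ContinuousMap.continuous_of_continuous_uncurry _ ?_
    simp only [Function.uncurry_def, ContinuousMap.coe_mk]
    fun_prop
  refine continuous_iff_continuousAt.2 fun a => ?_
  exact (tendsto_const_nhds (x := f)).compMeasurePreservingLp (hg.tendsto a)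
    (fun a => measurePreserving_sub_right volume a) (measurePreserving_sub_right volume a) (by simp)

/-! ### Almost everywhere convergence along subsequences -/

lemma exists_subseq_ae_tendsto {u : ℕ → L2R} {v : L2R} (h : Tendsto u atTop (𝓝 v)) :
    ∃ φ : ℕ → ℕ, StrictMono φ ∧
      ∀ᵐ x, Tendsto (fun i => (u (φ i) : ℝ → ℂ) x) atTop (𝓝 ((v : ℝ → ℂ) x)) :=
  (tendstoInMeasure_of_tendsto_Lp h).exists_seq_tendsto_ae

/-- Both `L²` limits are pointwise a.e. along a common subsequence, so an identity with a fixed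
multiplier survives. This extends translation formulas from Schwartz functions to `L²`. -/
lemma ae_eq_mul_of_tendsto {u w : ℕ → L2R} {v z : L2R} (hu : Tendsto u atTop (𝓝 v))
    (hw : Tendsto w atTop (𝓝 z)) (e : ℝ → ℂ) (h : ∀ n, w n =ᵐ[volume] fun x => e x * u n x) :
    z =ᵐ[volume] fun x => e x * v x := by
  obtain ⟨φ, hφ, h1⟩ := exists_subseq_ae_tendsto hu
  obtain ⟨ψ, hψ, h2⟩ := exists_subseq_ae_tendsto (hw.comp hφ.tendsto_atTop)
  filter_upwards [h1, h2, ae_all_iff.2 h] with x h1 h2 h3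
  refine tendsto_nhds_unique h2 ?_
  simp only [Function.comp_apply, h3]
  exact (h1.comp hψ.tendsto_atTop).const_mul _

/-! ### The Fourier transform on `L²(ℝ)` -/

/-- The Fourier transform on `L²(ℝ)`. -/
noncomputable def fourierL2 : L2R ≃ₗᵢ[ℂ] L2R := Lp.fourierTransformₗᵢ ℝ ℂ

lemma fourierL2_toLp (f : SchwartzMap ℝ ℂ) : fourierL2 (f.toLp 2) = (𝓕 f).toLp 2 :=
  SchwartzMap.toLp_fourier_eq f

lemma fourierL2_symm_toLp (f : SchwartzMap ℝ ℂ) : fourierL2.symm (f.toLp 2) = (𝓕⁻ f).toLp 2 :=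
  SchwartzMap.toLp_fourierInv_eq f

lemma exists_seq_schwartz_tendsto (f : L2R) :
    ∃ u : ℕ → SchwartzMap ℝ ℂ, Tendsto (fun n => (u n).toLp 2 (volume : Measure ℝ)) atTop (𝓝 f) := by
  have h : DenseRange fun u : SchwartzMap ℝ ℂ => u.toLp 2 (volume : Measure ℝ) :=
    SchwartzMap.denseRange_toLpCLM (by simp)
  obtain ⟨x, hx, hxt⟩ := mem_closure_iff_seq_limit.1 (h f)
  choose u hu using hx
  exact ⟨u, by simpa only [hu] using hxt⟩

/-- Translation of a Schwartz function. -/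
noncomputable def schwartzTranslate (a : ℝ) : SchwartzMap ℝ ℂ →L[ℂ] SchwartzMap ℝ ℂ :=
  SchwartzMap.compCLMOfAntilipschitz (K := 1) ℂ (g := fun x : ℝ => x - a)
    (Function.HasTemperateGrowth.id'.sub (.const a))
    (AntilipschitzWith.of_le_mul_dist fun x y => by simp)

lemma schwartzTranslate_apply (a : ℝ) (f : SchwartzMap ℝ ℂ) (x : ℝ) :
    schwartzTranslate a f x = f (x - a) := rfl

lemma l2Translate_toLp (a : ℝ) (f : SchwartzMap ℝ ℂ) :
    l2Translate a (f.toLp 2) = (schwartzTranslate a f).toLp 2 := by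
  ext1
  filter_upwards [l2Translate_coeFn a (f.toLp 2), ae_comp_sub (f.coeFn_toLp 2 volume) a,
    (schwartzTranslate a f).coeFn_toLp 2 volume] with x h1 h2 h3
  rw [h1, h2, h3, schwartzTranslate_apply]

lemma fourier_comp_sub (a : ℝ) (f : ℝ → ℂ) (ξ : ℝ) :
    𝓕 (fun x => f (x - a)) ξ = phase (-(a * ξ)) * 𝓕 f ξ := by
  have h := congrFun (VectorFourier.fourierIntegral_comp_add_right Real.fourierChar
    (volume : Measure ℝ) (innerₗ ℝ) f (-a)) ξ
  have h2 : (f ∘ fun v => v + -a) = fun x => f (x - a) := by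
    ext x; simp [sub_eq_add_neg]
  rw [h2] at h
  change VectorFourier.fourierIntegral Real.fourierChar (volume : Measure ℝ) (innerₗ ℝ) _ ξ = _
  rw [h, Circle.smul_def]
  simp only [innerₗ_apply_apply, RCLike.inner_apply, conj_trivial, smul_eq_mul, phase]
  congr 2
  have : ξ * -a = -(a * ξ) := by ring
  rw [this]

lemma fourierInv_comp_sub (a : ℝ) (f : ℝ → ℂ) (ξ : ℝ) :
    𝓕⁻ (fun x => f (x - a)) ξ = phase (a * ξ) * 𝓕⁻ f ξ := by
  rw [Real.fourierInv_eq_fourier_neg, fourier_comp_sub, Real.fourierInv_eq_fourier_neg]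
  simp

lemma fourierL2_l2Translate (a : ℝ) (f : L2R) :
    fourierL2 (l2Translate a f) =ᵐ[volume] fun ξ => phase (-(a * ξ)) * fourierL2 f ξ := by
  obtain ⟨u, hu⟩ := exists_seq_schwartz_tendsto f
  refine ae_eq_mul_of_tendsto (fourierL2.continuous.tendsto _ |>.comp hu)
    (fourierL2.continuous.tendsto _ |>.comp
      ((l2TranslateIso a).continuous.tendsto _ |>.comp hu)) _ fun n => ?_
  simp only [Function.comp_apply, l2TranslateIso_apply, l2Translate_toLp, fourierL2_toLp]
  filter_upwards [(𝓕 (u n)).coeFn_toLp 2 volume,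
    (𝓕 (schwartzTranslate a (u n))).coeFn_toLp 2 volume] with ξ h1 h2
  rw [h1, h2, SchwartzMap.fourier_coe, SchwartzMap.fourier_coe, ← fourier_comp_sub]
  rfl

lemma fourierL2_symm_l2Translate (a : ℝ) (f : L2R) :
    fourierL2.symm (l2Translate a f) =ᵐ[volume] fun ξ => phase (a * ξ) * fourierL2.symm f ξ := by
  obtain ⟨u, hu⟩ := exists_seq_schwartz_tendsto f
  refine ae_eq_mul_of_tendsto (fourierL2.symm.continuous.tendsto _ |>.comp hu)
    (fourierL2.symm.continuous.tendsto _ |>.comp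
      ((l2TranslateIso a).continuous.tendsto _ |>.comp hu)) _ fun n => ?_
  simp only [Function.comp_apply, l2TranslateIso_apply, l2Translate_toLp, fourierL2_symm_toLp]
  filter_upwards [(𝓕⁻ (u n)).coeFn_toLp 2 volume,
    (𝓕⁻ (schwartzTranslate a (u n))).coeFn_toLp 2 volume] with ξ h1 h2
  rw [h1, h2, SchwartzMap.fourierInv_coe, SchwartzMap.fourierInv_coe, ← fourierInv_comp_sub]
  rfl

lemma enorm_sq_eq_lintegral {X : Type*} [MeasurableSpace X] {μ : Measure X} (f : Lp ℂ 2 μ) :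
    ‖f‖ₑ ^ 2 = ∫⁻ x, ‖f x‖ₑ ^ 2 ∂μ := by
  rw [Lp.enorm_def, eLpNorm_eq_lintegral_rpow_enorm_toReal (by simp) (by simp)]
  rw [← ENNReal.rpow_natCast, ← ENNReal.rpow_mul]
  simp

/-- The modulus of continuity of the Fourier transform in `L²`. -/
lemma enorm_sq_l2Translate_fourierL2_sub (h : ℝ) (f : L2R) :
    ‖l2Translate h (fourierL2 f) - fourierL2 f‖ₑ ^ 2
      = ∫⁻ x, ‖phase (h * x) - 1‖ₑ ^ 2 * ‖f x‖ₑ ^ 2 := by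
  have e : ‖l2Translate h (fourierL2 f) - fourierL2 f‖ₑ
      = ‖fourierL2.symm (l2Translate h (fourierL2 f)) - f‖ₑ := by
    have := fourierL2.symm.norm_map (l2Translate h (fourierL2 f) - fourierL2 f)
    rw [map_sub, LinearIsometryEquiv.symm_apply_apply] at this
    rw [← ofReal_norm, ← ofReal_norm, this]
  rw [e, enorm_sq_eq_lintegral]
  refine lintegral_congr_ae ?_
  filter_upwards [fourierL2_symm_l2Translate h (fourierL2 f),
    Lp.coeFn_sub (fourierL2.symm (l2Translate h (fourierL2 f))) f] with x h1 h2
  rw [h2, Pi.sub_apply, h1, LinearIsometryEquiv.symm_apply_apply, ← sub_one_mul, enorm_mul, mul_pow]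

/-- The endpoint `q = ∞` fits the same formula because `∞.toReal = 0` and `1 / 0 = 0`. -/
lemma one_div_toReal_of_holderConjugate {q q' : ℝ≥0∞} (hq : 2 ≤ q)
    (h : ENNReal.HolderConjugate q q') : 1 / q'.toReal = 1 - 1 / q.toReal := by
  rcases eq_or_ne q ∞ with rfl | hqt
  · have : q' = 1 := by simpa using ENNReal.HolderConjugate.inv_add_inv_eq_one ∞ q'
    simp [this]
  · have h1 : (1 : ℝ) < q.toReal := by
      have : (2 : ℝ) ≤ q.toReal := by simpa using ENNReal.toReal_mono hqt hq
      linarith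
    have := (ENNReal.HolderConjugate.toReal (q := q') h1).inv_add_inv_eq_one
    rw [one_div, one_div]; linarith

/-! ### Minimality and the `(C_q)` property in a general Hilbert space -/

section AbstractSystems

variable {ι H : Type*} [NormedAddCommGroup H] [InnerProductSpace ℂ H]

lemma lqNorm_nonneg (q : ℝ≥0∞) (a : ι →₀ ℂ) : 0 ≤ lqNorm q a :=
  lp.norm_nonneg' _

lemma norm_le_lqNorm {q : ℝ≥0∞} (hq : q ≠ 0) (a : ι →₀ ℂ) (i : ι) : ‖a i‖ ≤ lqNorm q a :=
  lp.norm_apply_le_norm hq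
    (⟨fun i => a i, (memℓp_zero a.hasFiniteSupport).of_exponent_ge zero_le⟩ :
      lp (fun _ : ι => ℂ) q) i

lemma sum_rpow_le_lqNorm {q : ℝ≥0∞} (hq : 0 < q.toReal) (a : ι →₀ ℂ) (s : Finset ι) :
    ∑ i ∈ s, ‖a i‖ ^ q.toReal ≤ lqNorm q a ^ q.toReal :=
  lp.sum_rpow_le_norm_rpow hq
    (⟨fun i => a i, (memℓp_zero a.hasFiniteSupport).of_exponent_ge zero_le⟩ :
      lp (fun _ : ι => ℂ) q) s

/-- Hölder's inequality for a finite sum, against the constant `1`. -/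
lemma sum_norm_le_card_rpow_mul_lqNorm {q q' : ℝ≥0∞} (hq : 2 ≤ q)
    (h : ENNReal.HolderConjugate q q') (a : ι →₀ ℂ) (s : Finset ι) :
    ∑ i ∈ s, ‖a i‖ ≤ (s.card : ℝ) ^ (1 / q'.toReal) * lqNorm q a := by
  have hq0 : q ≠ 0 := (zero_lt_two.trans_le hq).ne'
  rcases eq_or_ne q ∞ with rfl | hqt
  · have : q' = 1 := by simpa using ENNReal.HolderConjugate.inv_add_inv_eq_one ∞ q'
    subst this
    simpa using Finset.sum_le_card_nsmul s _ _ fun i _ => norm_le_lqNorm hq0 a i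
  · have h1 : (1 : ℝ) < q.toReal := by
      have : (2 : ℝ) ≤ q.toReal := by simpa using ENNReal.toReal_mono hqt hq
      linarith
    have hr : q.toReal.HolderConjugate q'.toReal :=
      ENNReal.HolderConjugate.toReal h1
    have := Real.inner_le_Lp_mul_Lq s (fun i => ‖a i‖) (fun _ => (1 : ℝ)) hr
    simp only [mul_one, abs_norm, abs_one, Real.one_rpow, Finset.sum_const, nsmul_eq_mul] at this
    refine this.trans ?_
    rw [mul_comm]
    gcongr
    have h3 := Real.rpow_le_rpow (by positivity) (sum_rpow_le_lqNorm (by linarith) a s)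
      (z := 1 / q.toReal) (by positivity)
    rwa [← Real.rpow_mul (lqNorm_nonneg q a), mul_one_div_cancel (by linarith), Real.rpow_one] at h3

/-- The elements of a minimal system admit biorthogonal functionals. -/
lemma IsMinimalSystem.exists_dual [CompleteSpace H] [DecidableEq ι] {g : ι → H} (hg : IsMinimalSystem g)
    (i : ι) : ∃ h : H, ∀ j, inner ℂ (g j) h = if j = i then 1 else 0 := by
  set W := (Submodule.span ℂ (g '' {i}ᶜ)).topologicalClosure with hW
  have : CompleteSpace W := (Submodule.isClosed_topologicalClosure _).completeSpace_coe
  -- The component of `g i` orthogonal to the other elements; minimality makes it non-zero, and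
  -- rescaling it gives the dual vector.
  set u := g i - W.starProjection (g i) with hu
  have hu0 : u ≠ 0 := by
    intro h0
    apply hg i
    rw [sub_eq_zero.1 h0]
    exact Submodule.starProjection_apply_mem _ _
  have huW : ∀ w ∈ W, inner ℂ w u = 0 := fun w hw =>
    (W.mem_orthogonal u).1 (Submodule.sub_starProjection_mem_orthogonal (K := W) (g i)) w hw
  have hgu : inner ℂ (g i) u = inner ℂ u u := by
    conv_lhs => rw [← sub_add_cancel (g i) (W.starProjection (g i)), inner_add_left,
      huW _ (Submodule.starProjection_apply_mem _ _), add_zero]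
  refine ⟨(inner ℂ u u)⁻¹ • u, fun j => ?_⟩
  rw [inner_smul_right]
  split_ifs with hj
  · rw [hj, hgu, inv_mul_cancel₀ (inner_self_ne_zero.2 hu0)]
  · rw [huW _ (Submodule.le_topologicalClosure _ (Submodule.subset_span ⟨j, hj, rfl⟩)), mul_zero]

/-- Duality: a `(C_q)`-system controls the norm by the `ℓ^{q'}`-norm of the coefficients; here for
vectors with finitely many non-zero coefficients, all bounded by `b`. -/
lemma norm_le_of_approx {q q' : ℝ≥0∞} (hq : 2 ≤ q) (hqq' : ENNReal.HolderConjugate q q')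
    {g : ι → H} {C : ℝ} (hC : 0 < C)
    (hg : ∀ f : H, ∀ ε : ℝ, 0 < ε → ∃ a : ι →₀ ℂ,
      lqNorm q a ≤ C * ‖f‖ ∧ ‖f - Finsupp.linearCombination ℂ g a‖ < ε)
    (h : H) (s : Finset ι) (b : ℝ) (hb : 0 ≤ b) (hs : ∀ i ∉ s, inner ℂ (g i) h = 0)
    (hsb : ∀ i ∈ s, ‖inner ℂ (g i) h‖ ≤ b) :
    ‖h‖ ≤ C * (s.card : ℝ) ^ (1 / q'.toReal) * b := by
  rcases eq_or_ne h 0 with rfl | h0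
  · rw [norm_zero]; positivity
  have hpos : 0 < ‖h‖ := norm_pos_iff.2 h0
  refine le_of_forall_pos_le_add fun ε hε => ?_
  -- The vector `h` is tested against its own approximant: `‖h‖²` is within `ε ‖h‖` of a pairing in
  -- which only the indices in `s` survive, and Hölder bounds that pairing.
  obtain ⟨a, ha, hae⟩ := hg h ε hε
  have h1 : ‖inner ℂ (Finsupp.linearCombination ℂ g a) h‖
      ≤ C * (s.card : ℝ) ^ (1 / q'.toReal) * b * ‖h‖ := by
    classical
    have e : inner ℂ (Finsupp.linearCombination ℂ g a) h
        = ∑ i ∈ s, conj (a i) * inner ℂ (g i) h := by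
      rw [Finsupp.linearCombination_apply, Finsupp.sum, sum_inner]
      simp only [inner_smul_left]
      refine (Finset.sum_subset (Finset.subset_union_left (s₂ := s)) ?_).trans
        (Finset.sum_subset (Finset.subset_union_right (s₁ := a.support)) ?_).symm
      · intro i _ hi; rw [Finsupp.notMem_support_iff.1 hi]; simp
      · intro i _ hi; rw [hs i hi, mul_zero]
    rw [e]
    calc _ ≤ ∑ i ∈ s, ‖a i‖ * b := (norm_sum_le _ _).trans (Finset.sum_le_sum fun i hi => by
          rw [norm_mul, RCLike.norm_conj]; gcongr; exact hsb i hi)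
      _ = (∑ i ∈ s, ‖a i‖) * b := (Finset.sum_mul _ _ _).symm
      _ ≤ ((s.card : ℝ) ^ (1 / q'.toReal) * (C * ‖h‖)) * b := by
          gcongr
          refine (sum_norm_le_card_rpow_mul_lqNorm hq hqq' a s).trans ?_
          gcongr
      _ = _ := by ring
  have h2 : ‖h‖ * ‖h‖ ≤ ε * ‖h‖ + C * (s.card : ℝ) ^ (1 / q'.toReal) * b * ‖h‖ := by
    calc ‖h‖ * ‖h‖ = ‖inner ℂ h h‖ := by
          rw [inner_self_eq_norm_sq_to_K, ← sq]; simp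
      _ = ‖inner ℂ (h - Finsupp.linearCombination ℂ g a) h
            + inner ℂ (Finsupp.linearCombination ℂ g a) h‖ := by
          rw [← inner_add_left, sub_add_cancel]
      _ ≤ _ := (norm_add_le _ _).trans (add_le_add ((norm_inner_le_norm _ _).trans
          (by gcongr)) h1)
  rw [← add_mul] at h2
  linarith [le_of_mul_le_mul_right h2 hpos]

end AbstractSystems

/-! ### Fourier coefficients determine an integrable function -/

/-- As `p` is merely integrable, the `L²` Fourier basis does not apply. Instead `g ↦ ∫ g p` is
continuous on `C(AddCircle 1, ℂ)` and vanishes on the dense span of the characters. Indicators of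
closed sets are limits of thickened indicators, so `p` has zero integral over every closed set. -/
lemma ae_eq_zero_of_fourierCoeff_eq_zero {p : AddCircle (1 : ℝ) → ℂ} (hp : Integrable p)
    (h : ∀ n : ℤ, ∫ x, fourier n x * p x = 0) : p =ᵐ[volume] 0 := by
  have hint : ∀ g : C(AddCircle (1 : ℝ), ℂ), Integrable (fun x => g x * p x) := fun g =>
    hp.bdd_mul (c := ‖g‖) g.continuous.aestronglyMeasurable
      (Eventually.of_forall fun x => g.norm_coe_le_norm x)
  let T : C(AddCircle (1 : ℝ), ℂ) →ₗ[ℂ] ℂ :=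
    { toFun := fun g => ∫ x, g x * p x
      map_add' := fun g k => by
        rw [← integral_add (hint g) (hint k)]; simp only [ContinuousMap.add_apply, add_mul]
      map_smul' := fun c g => by
        simp only [ContinuousMap.smul_apply, smul_eq_mul, mul_assoc, RingHom.id_apply]
        exact integral_const_mul _ _ }
  have hTc : Continuous T := by
    refine (T.mkContinuous (∫ x, ‖p x‖) fun g => ?_).continuous
    refine (norm_integral_le_integral_norm _).trans ?_
    rw [mul_comm, ← integral_const_mul]
    refine integral_mono (hint g).norm (hp.norm.const_mul _) fun x => ?_
    simp only [norm_mul]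
    gcongr
    exact g.norm_coe_le_norm x
  have hker : ∀ g, T g = 0 := by
    have hcl : IsClosed {g | T g = 0} := isClosed_eq hTc continuous_const
    have hle : (Submodule.span ℂ (Set.range (@fourier 1))).topologicalClosure ≤ LinearMap.ker T := by
      refine Submodule.topologicalClosure_minimal _ (Submodule.span_le.2 ?_) hcl
      rintro _ ⟨n, rfl⟩
      exact h n
    rw [span_fourier_closure_eq_top] at hle
    exact fun g => hle trivial
  refine ae_eq_zero_of_forall_setIntegral_isClosed_eq_zero hp fun K hK => ?_
  have hpos : ∀ n : ℕ, (0 : ℝ) < 1 / (n + 1) := fun n => by positivity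
  have hlim := thickenedIndicator_tendsto_indicator_closure hpos
    tendsto_one_div_add_atTop_nhds_zero_nat K
  rw [hK.closure_eq, tendsto_pi_nhds] at hlim
  have h1 : Tendsto (fun n => ∫ x, ((thickenedIndicator (hpos n) K x : NNReal) : ℂ) * p x) atTop
      (𝓝 (∫ x, K.indicator p x)) := by
    refine tendsto_integral_of_dominated_convergence (fun x => ‖p x‖) (fun n => ?_) hp.norm
      (fun n => ?_) ?_
    · refine AEStronglyMeasurable.mul (Continuous.aestronglyMeasurable ?_) hp.1
      have := (thickenedIndicator (hpos n) K).continuous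
      fun_prop
    · refine Eventually.of_forall fun x => ?_
      rw [norm_mul]
      refine mul_le_of_le_one_left (norm_nonneg _) ?_
      have := thickenedIndicator_le_one (hpos n) K x
      simpa using this
    · refine Eventually.of_forall fun x => ?_
      have h2 : Tendsto (fun n => ((thickenedIndicator (hpos n) K x : NNReal) : ℂ)) atTop
          (𝓝 ((K.indicator (fun _ => (1 : NNReal)) x : NNReal) : ℂ)) := by
        have : Continuous fun r : NNReal => (r : ℂ) := by fun_prop
        exact (this.tendsto _).comp (hlim x)
      have h3 := h2.mul_const (p x)
      by_cases hx : x ∈ K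
      · simpa [hx] using h3
      · simpa [hx] using h3
  have h0 : ∀ n, ∫ x, ((thickenedIndicator (hpos n) K x : NNReal) : ℂ) * p x = 0 := fun n => by
    have hc : Continuous fun x => ((thickenedIndicator (hpos n) K x : NNReal) : ℂ) := by
      have := (thickenedIndicator (hpos n) K).continuous
      fun_prop
    exact hker ⟨_, hc⟩
  rw [← integral_indicator hK.measurableSet]
  refine tendsto_nhds_unique h1 ?_
  simp only [h0]
  exact tendsto_const_nhds

lemma fourier_coe_eq_phase (n : ℤ) (x : ℝ) :
    fourier n (x : AddCircle (1 : ℝ)) = phase (n * x) := by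
  rw [fourier_coe_apply, phase_eq]
  congr 1
  push_cast
  ring

lemma ae_eq_zero_of_setIntegral_phase_mul_eq_zero {p : ℝ → ℂ} (hp : IntegrableOn p (Set.Ioc 0 1))
    (h : ∀ n : ℤ, ∫ x in Set.Ioc (0 : ℝ) 1, phase (n * x) * p x = 0) :
    ∀ᵐ x ∂volume.restrict (Set.Ioc (0 : ℝ) 1), p x = 0 := by
  have hL : MemLp (AddCircle.liftIoc 1 0 p) 1 := by
    refine MemLp.memLp_liftIoc ?_
    rw [zero_add]
    exact memLp_one_iff_integrable.2 hp
  have h0 := ae_eq_zero_of_fourierCoeff_eq_zero (memLp_one_iff_integrable.1 hL) fun n => by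
    rw [← AddCircle.integral_preimage 1 0, zero_add, ← h n]
    refine setIntegral_congr_fun measurableSet_Ioc fun x hx => ?_
    simp only [fourier_coe_eq_phase]
    rw [AddCircle.liftIoc_coe_apply (by simpa using hx)]
  have h1 := (AddCircle.measurePreserving_mk 1 0).quasiMeasurePreserving.ae h0
  rw [zero_add] at h1
  filter_upwards [h1, ae_restrict_mem measurableSet_Ioc] with x hx hx2
  rwa [AddCircle.liftIoc_coe_apply (by simpa using hx2)] at hx

/-! ### Periodization -/

lemma ae_of_ae_restrict_Ioc {p : ℝ → Prop} (hp : ∀ x, ∀ n : ℤ, p (x - n) → p x)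
    (h : ∀ᵐ x ∂volume.restrict (Set.Ioc (0 : ℝ) 1), p x) : ∀ᵐ x, p x := by
  rw [ae_restrict_iff' measurableSet_Ioc] at h
  filter_upwards [ae_all_iff.2 fun n : ℤ => ae_comp_sub h n] with x hx
  -- The fundamental domain `(0, 1]` is closed on the right, hence the ceiling minus one in place of
  -- the floor.
  refine hp x (⌈x⌉ - 1) (hx _ ⟨?_, ?_⟩)
  · push_cast; linarith [Int.ceil_lt_add_one x]
  · push_cast; linarith [Int.le_ceil x]

lemma pairwise_disjoint_Ioc_int : Pairwise fun m n : ℤ =>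
    Disjoint (Set.Ioc (m : ℝ) (m + 1)) (Set.Ioc (n : ℝ) (n + 1)) :=
  Set.pairwise_disjoint_Ioc_intCast ℝ

lemma lintegral_eq_tsum_int (f : ℝ → ℝ≥0∞) :
    ∫⁻ x, f x = ∑' n : ℤ, ∫⁻ x in Set.Ioc (0 : ℝ) 1, f (x + n) := by
  rw [← setLIntegral_univ, ← iUnion_Ioc_intCast ℝ,
    lintegral_iUnion (fun _ => measurableSet_Ioc) pairwise_disjoint_Ioc_int]
  refine tsum_congr fun n => ?_
  rw [← (measurePreserving_add_right volume (n : ℝ)).setLIntegral_comp_preimage_emb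
    (measurableEmbedding_addRight _)]
  congr 2
  simp

lemma integral_eq_tsum_int {f : ℝ → ℂ} (hf : Integrable f) :
    ∫ x, f x = ∑' n : ℤ, ∫ x in Set.Ioc (0 : ℝ) 1, f (x + n) := by
  rw [← setIntegral_univ, ← iUnion_Ioc_intCast ℝ,
    integral_iUnion (fun _ => measurableSet_Ioc) pairwise_disjoint_Ioc_int hf.integrableOn]
  refine tsum_congr fun n => ?_
  rw [← (measurePreserving_add_right volume (n : ℝ)).setIntegral_preimage_emb
    (measurableEmbedding_addRight _)]
  congr 2
  simp

/-- By Tonelli, the integral over one period of the sum of the norms is the `L¹` norm of `f`, so the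
sum is finite a.e. -/
lemma ae_summable_norm_comp_add_int {f : ℝ → ℂ} (hf : Integrable f) :
    ∀ᵐ x : ℝ, Summable fun n : ℤ => ‖f (x + n)‖ := by
  refine ae_of_ae_restrict_Ioc (fun x m h => ?_) ?_
  · rw [← (Equiv.subRight m).summable_iff]
    refine h.congr fun n => ?_
    simp only [Function.comp_apply, Equiv.subRight_apply, Int.cast_sub]
    ring_nf
  · have hm : ∀ n : ℤ, AEMeasurable (fun x => ‖f (x + n)‖ₑ) (volume.restrict (Set.Ioc (0 : ℝ) 1)) :=
      fun n => ((hf.comp_add_right (n : ℝ)).1.enorm).restrict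
    have h1 : ∫⁻ x in Set.Ioc (0 : ℝ) 1, ∑' n : ℤ, ‖f (x + n)‖ₑ ≠ ∞ := by
      rw [lintegral_tsum hm, ← lintegral_eq_tsum_int fun x => ‖f x‖ₑ]
      exact hf.2.ne
    filter_upwards [ae_lt_top' (AEMeasurable.tsum hm) h1] with x hx
    exact (tsum_enorm_ne_top_iff_summable_norm).1 hx.ne

lemma aemeasurable_tsum_of_summable {μ : Measure ℝ} {F : ℤ → ℝ → ℂ} (hF : ∀ n, AEMeasurable (F n) μ)
    (h : ∀ᵐ x ∂μ, Summable fun n => F n x) : AEMeasurable (fun x => ∑' n, F n x) μ := by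
  refine aemeasurable_of_tendsto_metrizable_ae atTop
    (f := fun (s : Finset ℤ) x => ∑ n ∈ s, F n x) (fun s => ?_) ?_
  · exact Finset.aemeasurable_fun_sum _ fun n _ => hF n
  · filter_upwards [h] with x hx using hx.hasSum

lemma setIntegral_phase_int_mul (n : ℤ) :
    ∫ x in Set.Ioc (0 : ℝ) 1, phase (n * x) = if n = 0 then 1 else 0 := by
  split_ifs with hn
  · simp [hn, phase_zero]
  · rw [← intervalIntegral.integral_of_le zero_le_one]
    have h2 : ∀ x : ℝ, phase (n * x) = Complex.exp ((2 * π * n * Complex.I) * x) := fun x => by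
      rw [phase_eq]; congr 1; push_cast; ring
    simp only [h2]
    have hn' : (2 * π * n * Complex.I : ℂ) ≠ 0 := by
      have : (n : ℂ) ≠ 0 := by exact_mod_cast hn
      simp [pi_ne_zero, this]
    rw [integral_exp_mul_complex hn']
    have : Complex.exp (2 * π * n * Complex.I * (1 : ℝ)) = 1 := by
      rw [Complex.exp_eq_one_iff]; exact ⟨n, by push_cast; ring⟩
    rw [this]; simp

/-- The periodization of `f` is integrable over a period, and its Fourier coefficients are the
integrals of `f` against integer characters. Here they agree with those of the constant `c`, so
uniqueness applies to the difference. -/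
lemma ae_tsum_eq_const_of_integral_phase_mul {f : ℝ → ℂ} (hf : Integrable f) (c : ℂ)
    (h : ∀ n : ℤ, ∫ x, phase (n * x) * f x = if n = 0 then c else 0) :
    ∀ᵐ x : ℝ, ∑' n : ℤ, f (x + n) = c := by
  refine ae_of_ae_restrict_Ioc (fun x m h => ?_) ?_
  · rw [← h, ← (Equiv.subRight m).tsum_eq]
    refine tsum_congr fun n => ?_
    simp only [Equiv.subRight_apply, Int.cast_sub]
    ring_nf
  set μ := volume.restrict (Set.Ioc (0 : ℝ) 1)
  have hm : ∀ n : ℤ, Integrable (fun x => f (x + n)) μ :=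
    fun n => (hf.comp_add_right (n : ℝ)).restrict
  have hs : ∀ᵐ x ∂μ, Summable fun n : ℤ => ‖f (x + n)‖ :=
    ae_restrict_of_ae (ae_summable_norm_comp_add_int hf)
  have hlint : ∫⁻ x, ∑' n : ℤ, ‖f (x + n)‖ₑ ∂μ ≠ ∞ := by
    rw [lintegral_tsum fun n => (hm n).1.enorm, ← lintegral_eq_tsum_int fun x => ‖f x‖ₑ]
    exact hf.2.ne
  have hpm : AEMeasurable (fun x => ∑' n : ℤ, f (x + n)) μ :=
    aemeasurable_tsum_of_summable (fun n => (hm n).1.aemeasurable)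
      (hs.mono fun x hx => hx.of_norm)
  have hpi : Integrable (fun x => ∑' n : ℤ, f (x + n)) μ := by
    refine ⟨hpm.aestronglyMeasurable, lt_of_le_of_lt (lintegral_mono_ae ?_) hlint.lt_top⟩
    filter_upwards [hs] with x hx
    exact enorm_tsum_le_tsum_enorm
  have key : ∀ n : ℤ, ∫ x, phase (n * x) * (∑' m : ℤ, f (x + m)) ∂μ = if n = 0 then c else 0 := by
    intro n
    have hb : Integrable fun x => phase (n * x) * f x := by
      refine hf.bdd_mul (c := 1) ?_ (Eventually.of_forall fun x => (norm_phase _).le)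
      exact (continuous_phase.comp (by fun_prop)).aestronglyMeasurable
    rw [← h n, integral_eq_tsum_int hb]
    have e : ∀ x : ℝ, ∀ m : ℤ, phase (n * (x + m)) = phase (n * x) := fun x m => by
      rw [mul_add, phase_add, ← Int.cast_mul, phase_int, mul_one]
    simp only [e]
    rw [← integral_tsum]
    · simp only [tsum_mul_left]; rfl
    · exact fun m => ((continuous_phase.comp (by fun_prop)).aestronglyMeasurable).mul (hm m).1
    · simp only [enorm_mul, enorm_phase, one_mul]
      rw [← lintegral_tsum fun n => (hm n).1.enorm]
      exact hlint
  have h0 := ae_eq_zero_of_setIntegral_phase_mul_eq_zero (p := fun x => ∑' n : ℤ, f (x + n) - c)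
    (hpi.sub (integrable_const c)) fun n => by
      simp only [mul_sub]
      rw [integral_sub, key n, integral_mul_const, setIntegral_phase_int_mul n]
      · split_ifs <;> simp
      · refine hpi.bdd_mul (c := 1) ?_ (Eventually.of_forall fun x => (norm_phase _).le)
        exact (continuous_phase.comp (by fun_prop)).aestronglyMeasurable
      · refine (integrable_const c).bdd_mul (c := 1) ?_
          (Eventually.of_forall fun x => (norm_phase _).le)
        exact (continuous_phase.comp (by fun_prop)).aestronglyMeasurable
  filter_upwards [h0] with x hx
  exact sub_eq_zero.1 hx

/-! ### Shift-invariant spaces -/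

lemma l2Translate_comm (a b : ℝ) (f : L2R) :
    l2Translate a (l2Translate b f) = l2Translate b (l2Translate a f) := by
  rw [l2Translate_l2Translate, l2Translate_l2Translate, add_comm]

lemma isClosed_shiftInvariantSpace (S : Set L2R) : IsClosed (shiftInvariantSpace S : Set L2R) :=
  Submodule.isClosed_topologicalClosure _

lemma l2Translate_int_mem_of_mem {S : Set L2R} {f : L2R} (hf : f ∈ S) (n : ℤ) :
    l2Translate n f ∈ shiftInvariantSpace S :=
  Submodule.le_topologicalClosure _ (Submodule.subset_span ⟨f, hf, n, rfl⟩)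

lemma mem_shiftInvariantSpace_of_mem {S : Set L2R} {f : L2R} (hf : f ∈ S) :
    f ∈ shiftInvariantSpace S := by
  simpa [l2Translate_zero] using l2Translate_int_mem_of_mem hf 0

lemma shiftInvariantSpace_le {S : Set L2R} {W : Submodule ℂ L2R} (hW : IsClosed (W : Set L2R))
    (h : ∀ f ∈ S, ∀ n : ℤ, l2Translate n f ∈ W) : shiftInvariantSpace S ≤ W := by
  refine Submodule.topologicalClosure_minimal _ (Submodule.span_le.2 ?_) hW
  rintro _ ⟨f, hf, n, rfl⟩
  exact h f hf n

lemma l2Translate_mem_of_forall {S : Set L2R} {a : ℝ}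
    (h : ∀ f ∈ S, ∀ n : ℤ, l2Translate a (l2Translate n f) ∈ shiftInvariantSpace S) {g : L2R}
    (hg : g ∈ shiftInvariantSpace S) : l2Translate a g ∈ shiftInvariantSpace S := by
  have hle : shiftInvariantSpace S ≤
      (shiftInvariantSpace S).comap (l2TranslateIso a).toLinearMap := by
    refine shiftInvariantSpace_le ?_ h
    exact (isClosed_shiftInvariantSpace S).preimage (l2TranslateIso a).continuous
  exact hle hg

lemma l2Translate_int_mem {S : Set L2R} {g : L2R} (hg : g ∈ shiftInvariantSpace S) (n : ℤ) :
    l2Translate n g ∈ shiftInvariantSpace S := by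
  refine l2Translate_mem_of_forall (fun f hf m => ?_) hg
  rw [l2Translate_l2Translate, ← Int.cast_add]
  exact l2Translate_int_mem_of_mem hf _

/-! ### Fibers -/

/-- The fiber `(u (ξ + m))_{m ∈ ℤ}` of a function. -/
noncomputable def fiber (u : L2R) (ξ : ℝ) : ℤ → ℂ := fun m => (u : ℝ → ℂ) (ξ + m)

lemma ae_fiber_eq {u : L2R} {v : ℝ → ℂ} (h : u =ᵐ[volume] v) :
    ∀ᵐ ξ : ℝ, ∀ m : ℤ, fiber u ξ m = v (ξ + m) := ae_forall_comp_add_int h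

lemma ae_fiber_fourierL2_l2Translate (a : ℝ) (f : L2R) : ∀ᵐ ξ : ℝ, ∀ m : ℤ,
    fiber (fourierL2 (l2Translate a f)) ξ m
      = phase (-(a * (ξ + m))) * fiber (fourierL2 f) ξ m :=
  ae_fiber_eq (fourierL2_l2Translate a f)

lemma phase_neg_int_mul_add (n m : ℤ) (ξ : ℝ) : phase (-(n * (ξ + m))) = phase (-(n * ξ)) := by
  have : -(n * (ξ + m)) = -(n * ξ) + ((-(n * m) : ℤ) : ℝ) := by push_cast; ring
  rw [this, phase_add, phase_int, mul_one]

/-- The fibers of the elements of `V(G)` lie in the span of the fibers of the generators. -/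
lemma ae_fiber_mem_span {ι : Type*} [Finite ι] (G : ι → L2R) {h : L2R}
    (hh : h ∈ shiftInvariantSpace (Set.range G)) : ∀ᵐ ξ : ℝ,
      fiber (fourierL2 h) ξ ∈ Submodule.span ℂ (Set.range fun i => fiber (fourierL2 (G i)) ξ) := by
  have hspan : ∀ x ∈ Submodule.span ℂ
      {h : L2R | ∃ f ∈ Set.range G, ∃ n : ℤ, h = l2Translate (n : ℝ) f}, ∀ᵐ ξ : ℝ,
      fiber (fourierL2 x) ξ ∈ Submodule.span ℂ (Set.range fun i => fiber (fourierL2 (G i)) ξ) := by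
    intro x hx
    induction hx using Submodule.span_induction with
    | mem x hx =>
      obtain ⟨_, ⟨i, rfl⟩, n, rfl⟩ := hx
      filter_upwards [ae_fiber_fourierL2_l2Translate n (G i)] with ξ hξ
      have : fiber (fourierL2 (l2Translate n (G i))) ξ
          = phase (-(n * ξ)) • fiber (fourierL2 (G i)) ξ := by
        ext m
        rw [hξ, phase_neg_int_mul_add]; rfl
      rw [this]
      exact Submodule.smul_mem _ _ (Submodule.subset_span ⟨i, rfl⟩)
    | zero =>
      filter_upwards [ae_fiber_eq (Lp.coeFn_zero ℂ 2 (volume : Measure ℝ))] with ξ hξ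
      rw [map_zero]
      convert Submodule.zero_mem _
      ext m; exact hξ m
    | add x y _ _ hx hy =>
      filter_upwards [hx, hy, ae_fiber_eq (Lp.coeFn_add (fourierL2 x) (fourierL2 y))] with ξ h1 h2 h3
      rw [map_add]
      convert Submodule.add_mem _ h1 h2
      ext m; exact h3 m
    | smul c x _ hx =>
      filter_upwards [hx, ae_fiber_eq (Lp.coeFn_smul c (fourierL2 x))] with ξ h1 h3
      rw [map_smul]
      convert Submodule.smul_mem _ c h1
      ext m; exact h3 m
  obtain ⟨x, hx, hxt⟩ := mem_closure_iff_seq_limit.1 hh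
  obtain ⟨φ, -, h1⟩ := exists_subseq_ae_tendsto ((fourierL2.continuous.tendsto _).comp hxt)
  filter_upwards [ae_forall_comp_add_int h1, ae_all_iff.2 fun n => hspan (x n) (hx n)] with ξ h2 h3
  -- Along the subsequence the fibers converge coordinatewise, and a finite-dimensional subspace is
  -- closed for that topology. This is where finiteness of the set of generators enters.
  have hfin : FiniteDimensional ℂ
      (Submodule.span ℂ (Set.range fun i => fiber (fourierL2 (G i)) ξ)) :=
    FiniteDimensional.span_of_finite ℂ (Set.finite_range _)
  have hcl := Submodule.closed_of_finiteDimensional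
    (Submodule.span ℂ (Set.range fun i => fiber (fourierL2 (G i)) ξ))
  refine hcl.mem_of_tendsto (tendsto_pi_nhds.2 h2) (Eventually.of_forall fun n => ?_)
  exact h3 _

/-! ### Biorthogonal systems -/

/-- Plancherel: inner products with integer translates are the Fourier integrals at integers of `f̂`
times the conjugate of `ĥ`, the input for the periodization argument. -/
lemma inner_eq_integral_fourierL2 (f h : L2R) (n : ℤ) :
    ∫ ξ, phase (n * ξ) * (fourierL2 f ξ * conj (fourierL2 h ξ))
      = inner ℂ h (l2Translate (-n : ℤ) f) := by
  rw [← fourierL2.inner_map_map, L2.inner_def]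
  refine integral_congr_ae ?_
  filter_upwards [fourierL2_l2Translate (-n : ℤ) f] with ξ hξ
  rw [hξ, RCLike.inner_apply]
  push_cast
  rw [neg_mul, neg_neg, mul_assoc]

lemma integrable_fourierL2_mul_conj (f h : L2R) :
    Integrable fun ξ => fourierL2 f ξ * conj (fourierL2 h ξ) := by
  have := L2.integrable_inner (𝕜 := ℂ) (fourierL2 h) (fourierL2 f)
  simpa only [RCLike.inner_apply] using this

/-- The fibers of `f` and `h` at `ξ` are biorthogonal. -/
def FiberBiorthogonal {K : ℕ} (f h : Fin K → L2R) (ξ : ℝ) : Prop :=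
  ∀ j k, (Summable fun m : ℤ =>
      ‖fiber (fourierL2 (f j)) ξ m * conj (fiber (fourierL2 (h k)) ξ m)‖) ∧
    ∑' m : ℤ, fiber (fourierL2 (f j)) ξ m * conj (fiber (fourierL2 (h k)) ξ m)
      = if j = k then 1 else 0

/-- The integer translates of `f` and `h` are biorthogonal. -/
def TranslatesBiorthogonal {K : ℕ} (f h : Fin K → L2R) : Prop :=
  ∀ j k, ∀ n : ℤ, inner ℂ (h k) (l2Translate n (f j)) = if j = k ∧ n = 0 then 1 else 0

lemma TranslatesBiorthogonal.ae_fiber {K : ℕ} {f h : Fin K → L2R}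
    (hfh : TranslatesBiorthogonal f h) : ∀ᵐ ξ : ℝ, FiberBiorthogonal f h ξ := by
  refine ae_all_iff.2 fun j => ae_all_iff.2 fun k => ?_
  have hint := integrable_fourierL2_mul_conj (f j) (h k)
  filter_upwards [ae_summable_norm_comp_add_int hint,
    ae_tsum_eq_const_of_integral_phase_mul hint (if j = k then 1 else 0) fun n => by
      rw [inner_eq_integral_fourierL2, hfh j k]
      by_cases h1 : j = k <;> by_cases h2 : n = 0 <;> simp [h1, h2]] with ξ h1 h2
  exact ⟨h1, h2⟩

/-- Pairing with the dual fibers reads off coordinates; linear independence, the matrix of the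
restriction and the final inequality all use this. -/
lemma FiberBiorthogonal.tsum_sum {K : ℕ} {f h : Fin K → L2R} {ξ : ℝ}
    (hξ : FiberBiorthogonal f h ξ) (c : Fin K → ℂ) (k : Fin K) :
    ∑' m : ℤ, (∑ j, c j * fiber (fourierL2 (f j)) ξ m) * conj (fiber (fourierL2 (h k)) ξ m)
      = c k := by
  simp only [Finset.sum_mul, mul_assoc]
  rw [Summable.tsum_finsetSum fun j _ => ((hξ j k).1.of_norm).mul_left (c j)]
  simp only [tsum_mul_left, (hξ _ k).2]
  simp

lemma FiberBiorthogonal.linearIndependent {K : ℕ} {f h : Fin K → L2R} {ξ : ℝ}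
    (hξ : FiberBiorthogonal f h ξ) :
    LinearIndependent ℂ fun j => fiber (fourierL2 (f j)) ξ := by
  refine Fintype.linearIndependent_iff.2 fun c hc k => ?_
  rw [← hξ.tsum_sum c k]
  have : ∀ m : ℤ, ∑ j, c j * fiber (fourierL2 (f j)) ξ m = 0 := fun m => by
    simpa using congrFun hc m
  simp [this]

/-- The dual vectors at the indices `(k, 0)` suffice, since their translates are dual to the other
elements. They lie in `V(F)`, which is needed to apply the `(C_q)` bound to them. -/
lemma exists_translatesBiorthogonal {K : ℕ} {F : Fin K → L2R}
    (hF : IsMinimalSystem (integerTranslates F)) :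
    ∃ h : Fin K → shiftInvariantSpace (Set.range F),
      TranslatesBiorthogonal F fun k => (h k : L2R) := by
  have : CompleteSpace (shiftInvariantSpace (Set.range F)) :=
    (isClosed_shiftInvariantSpace _).completeSpace_coe
  choose h hh using fun k : Fin K => hF.exists_dual (k, (0 : ℤ))
  refine ⟨h, fun j k n => ?_⟩
  have := hh k (j, n)
  rw [Submodule.coe_inner] at this
  rw [← inner_conj_symm, show l2Translate n (F j) = (integerTranslates F (j, n) : L2R) from rfl,
    this]
  simp only [Prod.mk.injEq]
  split_ifs <;> simp

/-! ### The number of generators -/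

/-- A dimension count at a single good `ξ`: the `K` independent fibers of `f` lie in the span of the
fibers of `S`. -/
lemma TranslatesBiorthogonal.card_le {K : ℕ} {f h : Fin K → L2R}
    (hfh : TranslatesBiorthogonal f h) {S : Finset L2R}
    (hS : shiftInvariantSpace (Set.range f) ≤ shiftInvariantSpace (S : Set L2R)) :
    K ≤ S.card := by
  have hr : (S : Set L2R) = Set.range fun s : S => (s : L2R) := by simp
  have h1 : ∀ᵐ ξ : ℝ, ∀ k, fiber (fourierL2 (f k)) ξ ∈
      Submodule.span ℂ (Set.range fun s : S => fiber (fourierL2 (s : L2R)) ξ) := by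
    refine ae_all_iff.2 fun k => ae_fiber_mem_span _ ?_
    rw [← hr]
    exact hS (mem_shiftInvariantSpace_of_mem ⟨k, rfl⟩)
  obtain ⟨ξ, h2, h3⟩ := (h1.and hfh.ae_fiber).exists
  have h4 := finrank_span_eq_card h3.linearIndependent
  have h5 : Submodule.span ℂ (Set.range fun k => fiber (fourierL2 (f k)) ξ) ≤
      Submodule.span ℂ (Set.range fun s : S => fiber (fourierL2 (s : L2R)) ξ) :=
    Submodule.span_le.2 (by rintro _ ⟨k, rfl⟩; exact h2 k)
  have hfin : FiniteDimensional ℂ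
      (Submodule.span ℂ (Set.range fun s : S => fiber (fourierL2 (s : L2R)) ξ)) :=
    FiniteDimensional.span_of_finite ℂ (Set.finite_range _)
  have h6 := Submodule.finrank_mono h5
  have h7 := finrank_range_le_card (R := ℂ) fun s : S => fiber (fourierL2 (s : L2R)) ξ
  rw [h4, Fintype.card_fin] at h6
  simpa using h6.trans h7

lemma TranslatesBiorthogonal.minGenerators_eq {K : ℕ} {f h : Fin K → L2R}
    (hfh : TranslatesBiorthogonal f h) :
    minGenerators (shiftInvariantSpace (Set.range f)) = K := by
  classical
  have hmem : (Finset.univ.image f).card ∈ {n : ℕ | ∃ S : Finset L2R, S.card = n ∧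
      shiftInvariantSpace (S : Set L2R) = shiftInvariantSpace (Set.range f)} :=
    ⟨_, rfl, by simp⟩
  refine le_antisymm ((Nat.sInf_le hmem).trans ?_) ?_
  · simpa using Finset.card_image_le (s := Finset.univ) (f := f)
  · obtain ⟨S, hS, hS2⟩ := Nat.sInf_mem ⟨_, hmem⟩
    exact (hfh.card_le hS2.ge).trans hS.le

/-! ### The group of translations preserving a shift-invariant space -/

lemma l2Translate_nsmul_mem {V : Submodule ℂ L2R} {a : ℝ} (h : ∀ g ∈ V, l2Translate a g ∈ V)
    (n : ℕ) : ∀ g ∈ V, l2Translate (n * a) g ∈ V := by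
  induction n with
  | zero => intro g hg; simpa [l2Translate_zero] using hg
  | succ n ih =>
    intro g hg
    have := h _ (ih g hg)
    rw [l2Translate_l2Translate] at this
    convert this using 2
    push_cast; ring

/-- Dirichlet approximation gives `k ≥ 1` with `k a` arbitrarily close to an integer `m`. Then `(k -
1) a - m` is a translation already known to preserve the space, and it tends to `-a`; closedness
does the rest. -/
lemma l2Translate_neg_mem {S : Set L2R} {a : ℝ}
    (h : ∀ g ∈ shiftInvariantSpace S, l2Translate a g ∈ shiftInvariantSpace S) :
    ∀ g ∈ shiftInvariantSpace S, l2Translate (-a) g ∈ shiftInvariantSpace S := by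
  intro g hg
  choose k hk0 _ hk using fun n : ℕ => Real.exists_nat_abs_mul_sub_round_le a (Nat.succ_pos n)
  have hlim : Tendsto (fun n => (k n * a - round (k n * a)) - a) atTop (𝓝 (-a)) := by
    have : Tendsto (fun n => k n * a - round (k n * a)) atTop (𝓝 0) := by
      refine squeeze_zero_norm (a := fun n : ℕ => 1 / ((n : ℝ) + 1)) (fun n => ?_)
        tendsto_one_div_add_atTop_nhds_zero_nat
      refine (hk n).trans ?_
      push_cast
      gcongr
      linarith
    simpa using this.sub_const a
  refine (isClosed_shiftInvariantSpace S).mem_of_tendsto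
    ((continuous_l2Translate_left g).tendsto _ |>.comp hlim) (Eventually.of_forall fun n => ?_)
  have h1 := l2Translate_int_mem (l2Translate_nsmul_mem h (k n - 1) g hg) (-round (k n * a))
  rw [l2Translate_l2Translate] at h1
  rw [Nat.cast_sub (hk0 n)] at h1
  have e : (k n * a - round (k n * a)) - a
      = ((-round (k n * a) : ℤ) : ℝ) + ((k n : ℝ) - (1 : ℕ)) * a := by push_cast; ring
  change l2Translate ((k n * a - round (k n * a)) - a) g ∈ _
  rwa [e]

/-- The translations preserving a shift-invariant space. -/
def translationGroup (S : Set L2R) : AddSubgroup ℝ where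
  carrier := {a | ∀ g ∈ shiftInvariantSpace S, l2Translate a g ∈ shiftInvariantSpace S}
  zero_mem' := fun g hg => by rwa [l2Translate_zero]
  add_mem' := fun {a b} ha hb g hg => by
    rw [← l2Translate_l2Translate]; exact ha _ (hb g hg)
  neg_mem' := l2Translate_neg_mem

lemma isClosed_translationGroup (S : Set L2R) : IsClosed (translationGroup S : Set ℝ) := by
  have : (translationGroup S : Set ℝ) =
      ⋂ g ∈ shiftInvariantSpace S, (fun a => l2Translate a g) ⁻¹' (shiftInvariantSpace S) := by
    ext a; simp [translationGroup]
  rw [this]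
  exact isClosed_biInter fun g _ =>
    (isClosed_shiftInvariantSpace S).preimage (continuous_l2Translate_left g)

lemma one_mem_translationGroup (S : Set L2R) : (1 : ℝ) ∈ translationGroup S := fun g hg => by
  simpa using l2Translate_int_mem hg 1

/-- For irrational `γ` the closed subgroup is all of `ℝ`, and `N = K + 1` works, as `K = 0` is
excluded by `hK`. For rational `γ`, Bézout puts the reciprocal of the denominator in the group, and
the denominator cannot divide `K` because `K γ` is not an integer. -/
lemma exists_one_div_mem_translationGroup {S : Set L2R} {γ : ℝ} (hγ : γ ∈ translationGroup S)
    {K : ℕ} (hK : (K : ℝ) * γ ∉ Set.range ((↑) : ℤ → ℝ)) :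
    ∃ N : ℕ, 0 < N ∧ ¬ N ∣ K ∧ (1 / N : ℝ) ∈ translationGroup S := by
  by_cases hirr : Irrational γ
  · refine ⟨K + 1, Nat.succ_pos K, fun hd => ?_, ?_⟩
    · have : K = 0 := by
        by_contra h0
        have := Nat.le_of_dvd (Nat.pos_of_ne_zero h0) hd
        omega
      exact hK ⟨0, by simp [this]⟩
    · have hd : Dense (AddSubgroup.closure {γ, 1} : Set ℝ) :=
        dense_addSubgroupClosure_pair_iff.2 (by simpa using hirr)
      have hle : AddSubgroup.closure {γ, 1} ≤ translationGroup S := by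
        rw [AddSubgroup.closure_le]
        rintro x (rfl | rfl)
        exacts [hγ, one_mem_translationGroup S]
      have := (hd.mono hle).closure_eq
      rw [(isClosed_translationGroup S).closure_eq] at this
      have h2 : (1 / ((K + 1 : ℕ) : ℝ)) ∈ (translationGroup S : Set ℝ) := this ▸ Set.mem_univ _
      exact h2
  · obtain ⟨r, rfl⟩ : γ ∈ Set.range ((↑) : ℚ → ℝ) := not_not.1 hirr
    have hden : (r.den : ℝ) ≠ 0 := by exact_mod_cast r.den_nz
    have hr : (r : ℝ) = r.num / r.den := by exact_mod_cast (Rat.num_div_den r).symm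
    refine ⟨r.den, r.pos, ?_, ?_⟩
    · rintro ⟨m, hm⟩
      refine hK ⟨m * r.num, ?_⟩
      rw [hm, hr]
      push_cast
      field_simp
    · have hb := Int.gcd_eq_gcd_ab r.num r.den
      have hg : Int.gcd r.num r.den = 1 := by simpa [Int.gcd] using r.reduced
      rw [hg] at hb
      have : (1 / r.den : ℝ) = (Int.gcdA r.num r.den) • (r : ℝ) + (Int.gcdB r.num r.den) • (1 : ℝ) := by
        rw [hr, zsmul_eq_mul, zsmul_eq_mul]
        field_simp
        rw [mul_comm ((Int.gcdA _ _ : ℤ) : ℝ)]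
        exact_mod_cast hb
      rw [this]
      exact add_mem (zsmul_mem hγ _) (zsmul_mem (one_mem_translationGroup S) _)

/-! ### Restriction of the fibers to the multiples of `N` -/

lemma sum_phase_div (N : ℕ) (hN : 0 < N) (m : ℤ) :
    ∑ p ∈ Finset.range N, phase (-(p * (1 / N) * m)) = if (N : ℤ) ∣ m then (N : ℂ) else 0 := by
  have hN' : (N : ℝ) ≠ 0 := by exact_mod_cast hN.ne'
  have e : ∀ p : ℕ, phase (-(p * (1 / N) * m)) = phase (-(m / N)) ^ p := fun p => by
    rw [← phase_nsmul]; congr 1; ring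
  simp only [e]
  split_ifs with h
  · obtain ⟨k, rfl⟩ := h
    have : phase (-(((N : ℤ) * k : ℤ) / N)) = 1 := by
      rw [show (-((((N : ℤ) * k : ℤ) : ℝ) / N)) = ((-k : ℤ) : ℝ) by push_cast; field_simp, phase_int]
    simp only [this]
    simp
  · have h1 : phase (-(m / N)) ≠ 1 := by
      intro h1
      rw [phase_eq, Complex.exp_eq_one_iff] at h1
      obtain ⟨k, hk⟩ := h1
      apply h
      refine ⟨-k, ?_⟩
      have hpi : (2 * π * Complex.I : ℂ) ≠ 0 := by simp [pi_ne_zero]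
      have h2 : ((-(m / N) : ℝ) : ℂ) = k := by
        apply mul_left_cancel₀ hpi
        rw [mul_comm _ (k : ℂ), ← hk]; ring
      have h3 : (-(m / N) : ℝ) = k := by exact_mod_cast h2
      have h4 : (m : ℝ) = N * -k := by
        rw [← h3]; field_simp
      exact_mod_cast h4
    have h2 : phase (-(m / N)) ^ N = 1 := by
      rw [← phase_nsmul, show (N : ℝ) * -(m / N) = ((-m : ℤ) : ℝ) by push_cast; field_simp, phase_int]
    rw [geom_sum_eq h1, h2, sub_self, zero_div]

/-- If `V(F)` is invariant under translation by `1/N`, then its fibers are closed under restriction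
to the multiples of `N`. -/
lemma ae_restrict_fiber_mem_span {K : ℕ} {F : Fin K → L2R} {N : ℕ} (hN : 0 < N)
    (hinv : (1 / N : ℝ) ∈ translationGroup (Set.range F)) : ∀ᵐ ξ : ℝ, ∀ j,
      (fun m : ℤ => if (N : ℤ) ∣ m then fiber (fourierL2 (F j)) ξ m else 0) ∈
        Submodule.span ℂ (Set.range fun i => fiber (fourierL2 (F i)) ξ) := by
  refine ae_all_iff.2 fun j => ?_
  have h1 : ∀ p : ℕ, ∀ᵐ ξ : ℝ, fiber (fourierL2 (l2Translate (p * (1 / N)) (F j))) ξ ∈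
      Submodule.span ℂ (Set.range fun i => fiber (fourierL2 (F i)) ξ) := fun p => by
    refine ae_fiber_mem_span F ?_
    exact l2Translate_nsmul_mem hinv p _ (mem_shiftInvariantSpace_of_mem ⟨j, rfl⟩)
  filter_upwards [ae_all_iff.2 h1,
    ae_all_iff.2 fun p : ℕ => ae_fiber_fourierL2_l2Translate (p * (1 / N)) (F j)] with ξ h2 h3
  have hN' : (N : ℂ) ≠ 0 := by exact_mod_cast hN.ne'
  -- Averaging the characters of `ℤ/N` over the translates by `p/N` selects the multiples of `N`;
  -- the factor `phase (p * (1 / N) * ξ)` removes the part of the modulation that does not depend on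
  -- `m`.
  have : (fun m : ℤ => if (N : ℤ) ∣ m then fiber (fourierL2 (F j)) ξ m else 0) =
      (N : ℂ)⁻¹ • ∑ p ∈ Finset.range N, phase (p * (1 / N) * ξ) •
        fiber (fourierL2 (l2Translate (p * (1 / N)) (F j))) ξ := by
    ext m
    simp only [Pi.smul_apply, Finset.sum_apply, smul_eq_mul, h3, ← mul_assoc, ← phase_add]
    rw [← Finset.sum_mul]
    have e : ∀ p : ℕ, (p : ℝ) * (1 / N) * ξ + -(p * (1 / N) * (ξ + m)) = -(p * (1 / N) * m) :=
      fun p => by ring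
    simp only [e, sum_phase_div N hN]
    split_ifs
    · field_simp
    · simp
  rw [this]
  exact Submodule.smul_mem _ _ (Submodule.sum_mem _ fun p _ => Submodule.smul_mem _ _ (h2 p))

/-! ### The projection matrices of the fibers -/

/-- The matrix, in the basis of the fibers of `f`, of the restriction to the multiples of `N`. -/
noncomputable def fiberProj {K : ℕ} (N : ℕ) (f h : Fin K → L2R) (ξ : ℝ) :
    Matrix (Fin K) (Fin K) ℂ := fun k j =>
  ∑' m : ℤ, (if (N : ℤ) ∣ m then fiber (fourierL2 (f j)) ξ m else 0) *
    conj (fiber (fourierL2 (h k)) ξ m)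

/-- The fibers at `ξ` are biorthogonal and closed under restriction to the multiples of `N`. -/
def FiberRegular {K : ℕ} (N : ℕ) (f h : Fin K → L2R) (ξ : ℝ) : Prop :=
  FiberBiorthogonal f h ξ ∧ ∀ j,
    (fun m : ℤ => if (N : ℤ) ∣ m then fiber (fourierL2 (f j)) ξ m else 0) ∈
      Submodule.span ℂ (Set.range fun i => fiber (fourierL2 (f i)) ξ)

section FiberRegular

variable {K N : ℕ} {f h : Fin K → L2R} {ξ : ℝ}

lemma FiberRegular.restrict_eq (hξ : FiberRegular N f h ξ) (j : Fin K) (m : ℤ) :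
    (if (N : ℤ) ∣ m then fiber (fourierL2 (f j)) ξ m else 0) =
      ∑ i, fiberProj N f h ξ i j * fiber (fourierL2 (f i)) ξ m := by
  obtain ⟨c, hc⟩ := (Submodule.mem_span_range_iff_exists_fun ℂ).1 (hξ.2 j)
  have hc' : ∀ m : ℤ, (if (N : ℤ) ∣ m then fiber (fourierL2 (f j)) ξ m else 0) =
      ∑ i, c i * fiber (fourierL2 (f i)) ξ m := fun m => by
    simpa using (congrFun hc m).symm
  have hM : ∀ i, fiberProj N f h ξ i j = c i := fun i => by
    rw [fiberProj, ← hξ.1.tsum_sum c i]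
    simp only [hc']
  simp only [hM, hc']

lemma FiberRegular.restrict_sum_eq (hξ : FiberRegular N f h ξ) (v : Fin K → ℂ) (m : ℤ) :
    (if (N : ℤ) ∣ m then ∑ j, v j * fiber (fourierL2 (f j)) ξ m else 0) =
      ∑ i, (fiberProj N f h ξ).mulVec v i * fiber (fourierL2 (f i)) ξ m := by
  have h1 : (if (N : ℤ) ∣ m then ∑ j, v j * fiber (fourierL2 (f j)) ξ m else 0) =
      ∑ j, v j * (if (N : ℤ) ∣ m then fiber (fourierL2 (f j)) ξ m else 0) := by
    split_ifs <;> simp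
  rw [h1]
  simp only [hξ.restrict_eq, Matrix.mulVec, dotProduct, Finset.mul_sum, Finset.sum_mul]
  rw [Finset.sum_comm]
  refine Finset.sum_congr rfl fun i _ => Finset.sum_congr rfl fun j _ => by ring

lemma FiberRegular.mulVec_mulVec (hξ : FiberRegular N f h ξ) (v : Fin K → ℂ) :
    (fiberProj N f h ξ).mulVec ((fiberProj N f h ξ).mulVec v) = (fiberProj N f h ξ).mulVec v := by
  have hli := Fintype.linearIndependent_iff.1 hξ.1.linearIndependent
    (fun i => (fiberProj N f h ξ).mulVec ((fiberProj N f h ξ).mulVec v) i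
      - (fiberProj N f h ξ).mulVec v i) (by
    ext m
    simp only [Finset.sum_apply, Pi.smul_apply, smul_eq_mul, sub_mul, Finset.sum_sub_distrib,
      ← hξ.restrict_sum_eq]
    split_ifs <;> simp)
  ext i
  exact sub_eq_zero.1 (hli i)

/-- The rank of the projection matrix. -/
noncomputable def fiberRank {K : ℕ} (N : ℕ) (f h : Fin K → L2R) (ξ : ℝ) : ℕ :=
  Module.finrank ℂ (LinearMap.range (fiberProj N f h ξ).mulVecLin)

lemma fiberRank_le : fiberRank N f h ξ ≤ K := by
  simpa [fiberRank] using
    Submodule.finrank_le (LinearMap.range (fiberProj N f h ξ).mulVecLin)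

/-- Idempotents have trace equal to rank. The trace is an explicit series, which makes the rank both
measurable and summable over residue classes. -/
lemma FiberRegular.trace_eq (hξ : FiberRegular N f h ξ) :
    (fiberProj N f h ξ).trace = fiberRank N f h ξ := by
  have hid : IsIdempotentElem (fiberProj N f h ξ).mulVecLin := by
    refine LinearMap.ext fun v => ?_
    exact hξ.mulVec_mulVec v
  have := (LinearMap.IsIdempotentElem.isProj_range _ hid).trace
  rw [fiberRank, ← this, ← Matrix.toLin'_apply', Matrix.trace_toLin'_eq]

/-- The range of `A` and the kernel of `B` have dimensions adding up to more than `K`, so they meet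
outside zero; idempotence makes `A` the identity on its range. -/
lemma exists_mulVec_of_rank_lt {A B : Matrix (Fin K) (Fin K) ℂ}
    (hA : ∀ v, A.mulVec (A.mulVec v) = A.mulVec v)
    (hr : Module.finrank ℂ (LinearMap.range B.mulVecLin)
      < Module.finrank ℂ (LinearMap.range A.mulVecLin)) :
    ∃ v, v ≠ 0 ∧ A.mulVec v = v ∧ B.mulVec v = 0 := by
  by_contra hcon
  push Not at hcon
  have hdis : Disjoint (LinearMap.range A.mulVecLin) (LinearMap.ker B.mulVecLin) := by
    rw [Submodule.disjoint_def]
    rintro _ ⟨w, rfl⟩ hw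
    by_contra h0
    exact hcon _ h0 (hA w) hw
  have h1 := Submodule.finrank_add_finrank_le_of_disjoint hdis
  have h2 := LinearMap.finrank_range_add_finrank_ker B.mulVecLin
  omega

/-- The basic inequality: the rank of the projections cannot jump between points at which the
fibers are close. -/
lemma FiberRegular.one_le_sum {x y : ℝ} (hx : FiberRegular N f h x) (hy : FiberRegular N f h y)
    (hr : fiberRank N f h y < fiberRank N f h x) :
    1 ≤ ∑ j, ∑ k, ∑' m : ℤ, ‖fiber (fourierL2 (f j)) x m - fiber (fourierL2 (f j)) y m‖ₑ *
      ‖fiber (fourierL2 (h k)) x m‖ₑ := by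
  obtain ⟨v, hv0, hvx, hvy⟩ := exists_mulVec_of_rank_lt hx.mulVec_mulVec hr
  obtain ⟨i, hi⟩ : ∃ i, v i ≠ 0 := Function.ne_iff.1 hv0
  -- Taking the largest coordinate allows every `‖v j‖ₑ` to be bounded by `‖v k‖ₑ`, which then
  -- cancels.
  obtain ⟨k, -, hk⟩ := Finset.exists_max_image Finset.univ (fun k => ‖v k‖ₑ) ⟨i, Finset.mem_univ i⟩
  have hk0 : ‖v k‖ₑ ≠ 0 := fun h0 => by
    have := hk i (Finset.mem_univ i)
    rw [h0, nonpos_iff_eq_zero, enorm_eq_zero] at this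
    exact hi this
  have hterm : ∀ m : ℤ, ‖∑ j, v j * fiber (fourierL2 (f j)) x m‖ₑ ≤
      ‖v k‖ₑ * ∑ j, ‖fiber (fourierL2 (f j)) x m - fiber (fourierL2 (f j)) y m‖ₑ := by
    intro m
    have hxm := hx.restrict_sum_eq v m
    have hym := hy.restrict_sum_eq v m
    rw [hvx] at hxm
    rw [hvy] at hym
    -- The combination with coefficients `v` is supported on the multiples of `N` at `x` and
    -- vanishes on them at `y`. So on multiples of `N` its value at `x` is a difference of values at
    -- `x` and `y`, and elsewhere it is zero.
    by_cases hm : (N : ℤ) ∣ m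
    · simp only [if_pos hm, Pi.zero_apply, zero_mul, Finset.sum_const_zero] at hym
      have : ∑ j, v j * fiber (fourierL2 (f j)) x m
          = ∑ j, v j * (fiber (fourierL2 (f j)) x m - fiber (fourierL2 (f j)) y m) := by
        simp only [mul_sub, Finset.sum_sub_distrib, hym, sub_zero]
      rw [this, Finset.mul_sum]
      refine (enorm_sum_le _ _).trans (Finset.sum_le_sum fun j hj => ?_)
      rw [enorm_mul]
      gcongr
      exact hk j hj
    · rw [if_neg hm] at hxm
      rw [← hxm, enorm_zero]
      exact zero_le
  have h1 : ‖v k‖ₑ ≤ ‖v k‖ₑ * ∑' m : ℤ,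
      (∑ j, ‖fiber (fourierL2 (f j)) x m - fiber (fourierL2 (f j)) y m‖ₑ) *
        ‖fiber (fourierL2 (h k)) x m‖ₑ := by
    conv_lhs => rw [← hx.1.tsum_sum v k]
    refine enorm_tsum_le_tsum_enorm.trans ?_
    rw [← ENNReal.tsum_mul_left]
    refine ENNReal.tsum_le_tsum fun m => ?_
    rw [enorm_mul, ← mul_assoc, RCLike.enorm_conj]
    gcongr
    exact hterm m
  have h2 : 1 ≤ ∑' m : ℤ,
      (∑ j, ‖fiber (fourierL2 (f j)) x m - fiber (fourierL2 (f j)) y m‖ₑ) *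
        ‖fiber (fourierL2 (h k)) x m‖ₑ := by
    rw [← ENNReal.mul_le_mul_iff_right hk0 enorm_ne_top, mul_one]
    exact h1
  refine h2.trans ?_
  simp only [Finset.sum_mul]
  rw [Summable.tsum_finsetSum fun _ _ => ENNReal.summable]
  refine Finset.sum_le_sum fun j _ => ?_
  exact Finset.single_le_sum (f := fun k => ∑' m : ℤ,
    ‖fiber (fourierL2 (f j)) x m - fiber (fourierL2 (f j)) y m‖ₑ *
      ‖fiber (fourierL2 (h k)) x m‖ₑ) (fun _ _ => zero_le) (Finset.mem_univ k)

end FiberRegular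

/-! ### The rank function -/

lemma sum_range_ite_dvd_sub (N : ℕ) (hN : 0 < N) (m : ℤ) (c : ℂ) :
    ∑ l ∈ Finset.range N, (if (N : ℤ) ∣ m - l then c else 0) = c := by
  have hN' : (0 : ℤ) < N := by exact_mod_cast hN
  have h0 := Int.emod_nonneg m hN'.ne'
  have h1 := Int.emod_lt_of_pos m hN'
  rw [Finset.sum_eq_single_of_mem (m % N).toNat]
  · rw [if_pos]
    rw [Int.toNat_of_nonneg h0]
    exact Int.dvd_self_sub_emod
  · rw [Finset.mem_range]; omega
  · intro l hl hne
    rw [if_neg]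
    intro hd
    apply hne
    have h3 : (l : ℤ) % N = m % N := Int.modEq_iff_dvd.2 hd
    rw [Finset.mem_range] at hl
    rw [Int.emod_eq_of_lt (Int.natCast_nonneg l) (by exact_mod_cast hl)] at h3
    omega

lemma trace_fiberProj {K : ℕ} (N : ℕ) (f h : Fin K → L2R) (ξ : ℝ) :
    (fiberProj N f h ξ).trace = ∑ k, ∑' m : ℤ, (if (N : ℤ) ∣ m then
      fiber (fourierL2 (f k)) ξ m * conj (fiber (fourierL2 (h k)) ξ m) else 0) := by
  simp only [Matrix.trace, Matrix.diag, fiberProj, ite_mul, zero_mul]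

/-- Moving `ξ` by `l` replaces the multiples of `N` by the residue class of `l`. Over all `l` the
classes exhaust `ℤ`, and each `k` contributes the full pairing, which is `1`. -/
lemma FiberBiorthogonal.sum_trace {K N : ℕ} (hN : 0 < N) {f h : Fin K → L2R} {ξ : ℝ}
    (hξ : FiberBiorthogonal f h ξ) :
    ∑ l ∈ Finset.range N, (fiberProj N f h (ξ + l)).trace = K := by
  simp only [trace_fiberProj]
  rw [Finset.sum_comm]
  have : ∀ k : Fin K, ∑ l ∈ Finset.range N, ∑' m : ℤ, (if (N : ℤ) ∣ m then
      fiber (fourierL2 (f k)) (ξ + l) m * conj (fiber (fourierL2 (h k)) (ξ + l) m) else 0) = 1 := by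
    intro k
    have e : ∀ l : ℕ, ∑' m : ℤ, (if (N : ℤ) ∣ m then
        fiber (fourierL2 (f k)) (ξ + l) m * conj (fiber (fourierL2 (h k)) (ξ + l) m) else 0)
        = ∑' m : ℤ, (if (N : ℤ) ∣ m - l then
          fiber (fourierL2 (f k)) ξ m * conj (fiber (fourierL2 (h k)) ξ m) else 0) := fun l => by
      rw [← (Equiv.subRight (l : ℤ)).tsum_eq]
      refine tsum_congr fun m => ?_
      simp only [Equiv.subRight_apply, fiber, Int.cast_sub, Int.cast_natCast]
      ring_nf
    simp only [e]
    rw [← Summable.tsum_finsetSum]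
    · simp only [sum_range_ite_dvd_sub N hN]
      rw [(hξ k k).2, if_pos rfl]
    · intro l _
      refine Summable.of_norm ((hξ k k).1.of_nonneg_of_le (fun m => norm_nonneg _) fun m => ?_)
      split_ifs
      · exact le_rfl
      · rw [norm_zero]; exact norm_nonneg _
  simp [this]

lemma aemeasurable_trace_fiberProj {K : ℕ} (N : ℕ) (f h : Fin K → L2R) :
    AEMeasurable fun ξ => (fiberProj N f h ξ).trace := by
  simp only [trace_fiberProj]
  refine Finset.aemeasurable_fun_sum _ fun k _ => aemeasurable_tsum_of_summable (fun m => ?_) ?_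
  · have hint := (integrable_fourierL2_mul_conj (f k) (h k)).comp_add_right (m : ℝ)
    split_ifs
    · exact hint.1.aemeasurable
    · exact aemeasurable_const
  · filter_upwards [ae_summable_norm_comp_add_int (integrable_fourierL2_mul_conj (f k) (h k))]
      with ξ hξ
    refine Summable.of_norm (hξ.of_nonneg_of_le (fun m => norm_nonneg _) fun m => ?_)
    split_ifs
    · exact le_rfl
    · rw [norm_zero]; exact norm_nonneg _

/-! ### Intervals on which an integer-valued function oscillates -/

/-- If the translates of an integer-valued `D` add up to a number which is not a multiple of `N`,
then `D` is far from constant on some interval of any given length. -/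
lemma exists_interval_oscillation {D : ℝ → ℕ} (hD : Measurable D) {K N : ℕ} (hN : 0 < N)
    (hNK : ¬ N ∣ K) (hDK : ∀ᵐ x, D x ≤ K)
    (hsum : ∀ᵐ x, ∑ l ∈ Finset.range N, D (x + l) = K) {δ : ℝ} (hδ : 0 < δ) :
    ∃ (a : ℝ) (r : ℕ),
      1 / (N * (K + 1)) * δ ≤ volume.real (Set.Ioc a (a + δ) ∩ {x | r < D x}) ∧
      1 / (N * (K + 1)) * δ ≤ volume.real (Set.Ioc a (a + δ) ∩ {x | D x ≤ r}) := by
  have hmeas : Measurable fun x => (D x : ℝ) := measurable_from_top.comp hD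
  have hloc : LocallyIntegrable fun x => (D x : ℝ) := by
    refine (locallyIntegrable_const (K : ℝ)).mono hmeas.aestronglyMeasurable ?_
    filter_upwards [hDK] with x hx
    simpa using hx
  have hii : ∀ a b : ℝ, IntervalIntegrable (fun x => (D x : ℝ)) volume a b := fun a b =>
    (hloc.integrableOn_isCompact isCompact_uIcc).intervalIntegrable
  -- The moving integral is continuous, and its values at `0, ..., N - 1` add up to `K δ`. By the
  -- intermediate value theorem some window of length `δ` has mean exactly `K / N`.
  set m : ℝ → ℝ := fun t => ∫ x in t..t + δ, (D x : ℝ) with hm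
  have hmc : Continuous m := by
    have h1 : Continuous fun t => ∫ x in (0 : ℝ)..t, (D x : ℝ) :=
      intervalIntegral.continuous_primitive hii 0
    have : m = fun t => (∫ x in (0 : ℝ)..(t + δ), (D x : ℝ)) - ∫ x in (0 : ℝ)..t, (D x : ℝ) := by
      ext t
      rw [intervalIntegral.integral_interval_sub_left (hii _ _) (hii _ _)]
    rw [this]
    exact (h1.comp (by fun_prop)).sub h1
  have hms : ∑ l ∈ Finset.range N, m l = K * δ := by
    have e : ∀ l : ℕ, m l = ∫ x in (0 : ℝ)..δ, (D (x + l) : ℝ) := fun l => by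
      rw [intervalIntegral.integral_comp_add_right fun x => (D x : ℝ)]
      simp [hm, add_comm]
    simp only [e]
    rw [← intervalIntegral.integral_finsetSum]
    · have : ∫ x in (0 : ℝ)..δ, ∑ l ∈ Finset.range N, (D (x + l) : ℝ) = ∫ x in (0 : ℝ)..δ, (K : ℝ) := by
        refine intervalIntegral.integral_congr_ae ?_
        filter_upwards [hsum] with x hx _
        exact_mod_cast hx
      rw [this]
      simp [mul_comm]
    · intro l _
      simpa using (hii (0 + l) (δ + l)).comp_add_right (l : ℝ)
  have hne : (Finset.range N).Nonempty := ⟨0, Finset.mem_range.2 hN⟩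
  have hN' : (0 : ℝ) < N := by exact_mod_cast hN
  have hconst : ∑ l ∈ Finset.range N, (K * δ / N : ℝ) = K * δ := by
    simp; field_simp
  obtain ⟨l1, -, hl1⟩ := Finset.exists_le_of_sum_le hne (hms.trans hconst.symm).le
  obtain ⟨l2, -, hl2⟩ := Finset.exists_le_of_sum_le hne (hms.trans hconst.symm).ge
  obtain ⟨a, ha⟩ := mem_range_of_exists_le_of_exists_ge hmc ⟨_, hl1⟩ ⟨_, hl2⟩
  have hmod : 0 < K % N := Nat.pos_of_ne_zero fun h0 => hNK (Nat.dvd_of_mod_eq_zero h0)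
  have hmod2 : K % N < N := Nat.mod_lt _ hN
  have hdm : N * (K / N) + K % N = K := Nat.div_add_mod K N
  -- The mean `K / N` lies strictly between `r` and `r + 1`, at distance at least `1 / N` from both.
  -- So `D` must exceed `r`, and also stay at most `r`, on a definite part of the window.
  set r := K / N with hr
  have hrK : r ≤ K := Nat.div_le_self _ _
  have hdm' : (N : ℝ) * r + (K % N : ℕ) = K := by exact_mod_cast hdm
  have hmod' : (1 : ℝ) ≤ (K % N : ℕ) := by exact_mod_cast hmod
  have hmod2' : ((K % N : ℕ) : ℝ) + 1 ≤ N := by exact_mod_cast hmod2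
  set I := Set.Ioc a (a + δ) with hI
  have hIi : IntegrableOn (fun x => (D x : ℝ)) I :=
    (hloc.integrableOn_isCompact isCompact_Icc).mono_set Set.Ioc_subset_Icc_self
  have hIc : ∀ c : ℝ, IntegrableOn (fun _ => c) I := fun c => integrableOn_const (by simp [I])
  have hID : ∫ x in I, (D x : ℝ) = K * δ / N := by
    rw [← ha, hm]
    exact (intervalIntegral.integral_of_le (by linarith)).symm
  have hIv : ∀ c : ℝ, ∫ x in I, c = c * δ := fun c => by simp [I, hδ.le, mul_comm]
  refine ⟨a, r, ?_, ?_⟩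
  · set E := I ∩ {x | r < D x} with hE
    have hEm : MeasurableSet {x | r < D x} := hD (measurableSet_Ioi (a := r))
    have h1 : ∫ x in I, ((D x : ℝ) - r) ≤ ∫ x in I, {x | r < D x}.indicator (fun _ => (K : ℝ)) x := by
      refine setIntegral_mono_ae ?_ ?_ ?_
      · exact hIi.sub (hIc _)
      · exact (hIc _).indicator hEm
      · filter_upwards [hDK] with x hx
        by_cases hxr : r < D x
        · have : (D x : ℝ) ≤ K := by exact_mod_cast hx
          simp only [Set.indicator, Set.mem_ofPred_eq, hxr, if_true]
          linarith [Nat.cast_nonneg (α := ℝ) r]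
        · have : (D x : ℝ) ≤ r := by exact_mod_cast not_lt.1 hxr
          simp only [Set.indicator, Set.mem_ofPred_eq, hxr, if_false]
          linarith
    have h2 : ∫ x in I, ((D x : ℝ) - r) = K * δ / N - r * δ := by
      rw [integral_sub hIi (hIc _), hID, hIv]
    have h3 : ∫ x in I, {x | r < D x}.indicator (fun _ => (K : ℝ)) x = volume.real E * K := by
      rw [integral_indicator_const _ hEm, measureReal_restrict_apply hEm, smul_eq_mul,
        Set.inter_comm]
    rw [h2, h3] at h1
    have h4 : 1 / N * δ ≤ K * δ / N - r * δ := by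
      rw [div_mul_eq_mul_div, one_mul, div_le_iff₀ hN']
      have : (K * δ / N - r * δ) * N = (K % N : ℕ) * δ := by
        field_simp
        linarith
      rw [this]
      nlinarith
    rw [one_div_mul_eq_div, div_le_iff₀ (by positivity)]
    have h5 := h4.trans h1
    rw [div_mul_eq_mul_div, one_mul, div_le_iff₀ hN'] at h5
    nlinarith [mul_nonneg (measureReal_nonneg (μ := volume) (s := E)) hN'.le]
  · set E := I ∩ {x | D x ≤ r} with hE
    have hEm : MeasurableSet {x | D x ≤ r} := hD (measurableSet_Iic (a := r))
    -- The integrand is non-positive where `D > r`, and elsewhere at most `r + 1 ≤ K + 1`; hence `K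
    -- + 1` in the common constant.
    have h1 : ∫ x in I, (((r : ℝ) + 1) - D x) ≤
        ∫ x in I, {x | D x ≤ r}.indicator (fun _ => (K + 1 : ℝ)) x := by
      refine setIntegral_mono_ae ?_ ?_ ?_
      · exact (hIc _).sub hIi
      · exact (hIc _).indicator hEm
      · filter_upwards [hDK] with x hx
        by_cases hxr : D x ≤ r
        · have : (r : ℝ) ≤ K := by exact_mod_cast hrK
          simp only [Set.indicator, Set.mem_ofPred_eq, hxr, if_true]
          linarith [Nat.cast_nonneg (α := ℝ) (D x)]
        · have : (r : ℝ) + 1 ≤ D x := by exact_mod_cast not_le.1 hxr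
          simp only [Set.indicator, Set.mem_ofPred_eq, hxr, if_false]
          linarith
    have h2 : ∫ x in I, (((r : ℝ) + 1) - D x) = (r + 1) * δ - K * δ / N := by
      rw [integral_sub (hIc _) hIi, hID, hIv]
    have h3 : ∫ x in I, {x | D x ≤ r}.indicator (fun _ => (K + 1 : ℝ)) x
        = volume.real E * (K + 1) := by
      rw [integral_indicator_const _ hEm, measureReal_restrict_apply hEm, smul_eq_mul,
        Set.inter_comm]
    rw [h2, h3] at h1
    have h4 : 1 / N * δ ≤ (r + 1) * δ - K * δ / N := by
      rw [div_mul_eq_mul_div, one_mul, div_le_iff₀ hN']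
      have : ((r + 1) * δ - K * δ / N) * N = (N - (K % N : ℕ)) * δ := by
        field_simp
        linarith
      rw [this]
      nlinarith
    rw [one_div_mul_eq_div, div_le_iff₀ (by positivity)]
    have h5 := h4.trans h1
    rw [div_mul_eq_mul_div, one_mul, div_le_iff₀ hN'] at h5
    linarith

/-! ### Double integrals of differences -/

/-- The union of the integer translates of the interval `(a, a + δ]`. -/
def periodicInterval (a δ : ℝ) : Set ℝ := ⋃ n : ℤ, Set.Ioc (a + n) (a + n + δ)

lemma measurableSet_periodicInterval (a δ : ℝ) : MeasurableSet (periodicInterval a δ) :=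
  MeasurableSet.iUnion fun _ => measurableSet_Ioc

/-- Since `δ ≤ 1`, the integer translates of the interval are disjoint. -/
lemma tsum_setLIntegral_Ioc {a δ : ℝ} (hδ : δ ≤ 1) (G : ℝ → ℝ≥0∞) :
    ∑' n : ℤ, ∫⁻ x in Set.Ioc a (a + δ), G (x + n) = ∫⁻ x in periodicInterval a δ, G x := by
  rw [periodicInterval, lintegral_iUnion (fun _ => measurableSet_Ioc)]
  · refine tsum_congr fun n => ?_
    rw [← (measurePreserving_add_right volume (n : ℝ)).setLIntegral_comp_preimage_emb
      (measurableEmbedding_addRight _) _ (Set.Ioc (a + n) (a + n + δ))]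
    congr 2
    simp [add_sub_right_comm]
  · refine (Set.pairwise_disjoint_Ioc_add_intCast a).mono fun m n h => h.mono ?_ ?_ <;>
    · refine Set.Ioc_subset_Ioc_right ?_
      linarith

lemma enorm_l2Translate_sub_eq (t : ℝ) (u : L2R) :
    (∫⁻ x, ‖u x - u (x + t)‖ₑ ^ (2 : ℝ)) ^ (1 / (2 : ℝ)) = ‖l2Translate (-t) u - u‖ₑ := by
  have h := enorm_sq_eq_lintegral (l2Translate (-t) u - u)
  have : ∫⁻ x, ‖u x - u (x + t)‖ₑ ^ (2 : ℝ) = ‖l2Translate (-t) u - u‖ₑ ^ 2 := by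
    rw [h]
    refine lintegral_congr_ae ?_
    filter_upwards [Lp.coeFn_sub (l2Translate (-t) u) u, l2Translate_coeFn (-t) u] with x h1 h2
    rw [h1, Pi.sub_apply, h2, sub_neg_eq_add, enorm_sub_rev]
    norm_cast
  rw [this, ← ENNReal.rpow_natCast, ← ENNReal.rpow_mul]
  simp

/-- Substitute `y = x + t` and enlarge the range of `t` to `[-δ, δ]`, which accounts for the factor
`2 δ`. For fixed `t`, the sum over `m` unfolds the `x`-integral to the periodic interval, where
Cauchy–Schwarz applies. -/
lemma lintegral_lintegral_sub_mul_le {a δ : ℝ} (hδ1 : δ ≤ 1) (u w : L2R) {Ω W : ℝ≥0∞}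
    (hΩ : ∀ t, |t| ≤ δ → ‖l2Translate t u - u‖ₑ ≤ Ω)
    (hW : ∫⁻ x in periodicInterval a δ, ‖w x‖ₑ ^ 2 ≤ W ^ 2) :
    ∫⁻ x in Set.Ioc a (a + δ), ∫⁻ y in Set.Ioc a (a + δ),
      ∑' m : ℤ, ‖u (x + m) - u (y + m)‖ₑ * ‖w (x + m)‖ₑ ≤ ENNReal.ofReal (2 * δ) * (Ω * W) := by
  have hu : Measurable (u : ℝ → ℂ) := (Lp.stronglyMeasurable u).measurable
  have hw : Measurable (w : ℝ → ℂ) := (Lp.stronglyMeasurable w).measurable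
  set I := Set.Ioc a (a + δ) with hI
  set J := Set.Icc (-δ) δ with hJ
  have h1 : ∀ x ∈ I, ∫⁻ y in I, ∑' m : ℤ, ‖u (x + m) - u (y + m)‖ₑ * ‖w (x + m)‖ₑ ≤
      ∫⁻ t in J, ∑' m : ℤ, ‖u (x + m) - u (x + m + t)‖ₑ * ‖w (x + m)‖ₑ := by
    intro x hx
    rw [← (measurePreserving_add_left volume x).setLIntegral_comp_preimage_emb
      (measurableEmbedding_addLeft _) _ I]
    have hsub : (fun t => x + t) ⁻¹' I ⊆ J := fun t ht => by
      simp only [hI, Set.mem_preimage, Set.mem_Ioc] at ht hx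
      constructor <;> linarith [ht.1, ht.2, hx.1, hx.2]
    refine (lintegral_mono_set hsub).trans (le_of_eq ?_)
    refine lintegral_congr fun t => tsum_congr fun m => ?_
    rw [add_right_comm x t]
  have hmeas : Measurable fun p : ℝ × ℝ =>
      ∑' m : ℤ, ‖u (p.1 + m) - u (p.1 + m + p.2)‖ₑ * ‖w (p.1 + m)‖ₑ := by
    refine Measurable.tsum fun m => 
      Measurable.mul (Measurable.enorm (Measurable.sub ?_ ?_)) (Measurable.enorm ?_)
    · exact hu.comp (by fun_prop)
    · exact hu.comp (by fun_prop)
    · exact hw.comp (by fun_prop)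
  have h2 : ∀ t ∈ J, ∫⁻ x in I, ∑' m : ℤ, ‖u (x + m) - u (x + m + t)‖ₑ * ‖w (x + m)‖ₑ ≤ Ω * W := by
    intro t ht
    rw [lintegral_tsum, tsum_setLIntegral_Ioc hδ1 fun x => ‖u x - u (x + t)‖ₑ * ‖w x‖ₑ]
    · refine (ENNReal.lintegral_mul_le_Lp_mul_Lq _ Real.HolderConjugate.two_two ?_ ?_).trans ?_
      · exact (hu.sub (hu.comp (by fun_prop))).enorm.aemeasurable
      · exact hw.enorm.aemeasurable
      · gcongr
        · refine le_trans ?_ (hΩ (-t) (by rw [abs_neg]; exact abs_le.2 ht))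
          rw [← enorm_l2Translate_sub_eq]
          exact ENNReal.rpow_le_rpow (setLIntegral_le_lintegral _ _) (by norm_num)
        · refine (ENNReal.rpow_le_rpow (z := 1 / (2 : ℝ)) ?_ (by norm_num)).trans_eq
            (b := (W ^ 2) ^ (1 / (2 : ℝ))) ?_
          · simpa only [ENNReal.rpow_two] using hW
          · rw [← ENNReal.rpow_natCast, ← ENNReal.rpow_mul]
            simp
    · intro m
      refine Measurable.aemeasurable (
      Measurable.mul (Measurable.enorm (Measurable.sub ?_ ?_)) (Measurable.enorm ?_))
      · exact hu.comp (by fun_prop)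
      · exact hu.comp (by fun_prop)
      · exact hw.comp (by fun_prop)
  calc _ ≤ ∫⁻ x in I, ∫⁻ t in J, ∑' m : ℤ, ‖u (x + m) - u (x + m + t)‖ₑ * ‖w (x + m)‖ₑ :=
        setLIntegral_mono' measurableSet_Ioc h1
    _ = ∫⁻ t in J, ∫⁻ x in I, ∑' m : ℤ, ‖u (x + m) - u (x + m + t)‖ₑ * ‖w (x + m)‖ₑ :=
        lintegral_lintegral_swap hmeas.aemeasurable
    _ ≤ ∫⁻ t in J, Ω * W := setLIntegral_mono' measurableSet_Icc h2
    _ = ENNReal.ofReal (2 * δ) * (Ω * W) := by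
        rw [setLIntegral_const, Real.volume_Icc, mul_comm]
        congr 2; ring

/-! ### Oscillation of the rank versus smoothness -/

lemma ae_sum_fiberRank {K N : ℕ} (hN : 0 < N) {f h : Fin K → L2R}
    (hreg : ∀ᵐ ξ : ℝ, FiberRegular N f h ξ) :
    ∀ᵐ ξ : ℝ, ∑ l ∈ Finset.range N, fiberRank N f h (ξ + l) = K := by
  filter_upwards [hreg, ae_all_iff.2 fun l : ℕ => ae_comp_add hreg l] with ξ h1 h2
  have := h1.1.sum_trace hN
  simp only [fun l : ℕ => (h2 l).trace_eq] at this
  exact_mod_cast this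

/-- The rank agrees a.e. with the floor of the real part of the trace, which is a.e. measurable as a
convergent series. -/
lemma aemeasurable_fiberRank {K N : ℕ} {f h : Fin K → L2R}
    (hreg : ∀ᵐ ξ : ℝ, FiberRegular N f h ξ) : AEMeasurable (fiberRank N f h) := by
  have h1 : AEMeasurable fun ξ => ⌊((fiberProj N f h ξ).trace).re⌋₊ :=
    Nat.measurable_floor.comp_aemeasurable
      (Complex.measurable_re.comp_aemeasurable (aemeasurable_trace_fiberProj N f h))
  refine h1.congr ?_
  filter_upwards [hreg] with ξ hξ
  rw [hξ.trace_eq]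
  simp

lemma lintegral_lintegral_sum_sum {ι : Type*} [Fintype ι] (I : Set ℝ) {Φ : ι → ι → ℝ → ℝ → ℝ≥0∞}
    (hΦ : ∀ j k, Measurable fun p : ℝ × ℝ => Φ j k p.1 p.2) :
    ∫⁻ x in I, ∫⁻ y in I, ∑ j, ∑ k, Φ j k x y = ∑ j, ∑ k, ∫⁻ x in I, ∫⁻ y in I, Φ j k x y := by
  have h0 : ∀ x j k, Measurable fun y => Φ j k x y := fun x j k =>
    (hΦ j k).comp measurable_prodMk_left
  have h2 : ∀ j k, Measurable fun x => ∫⁻ y in I, Φ j k x y := fun j k =>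
    (hΦ j k).lintegral_prod_right'
  have h1 : ∀ x, ∫⁻ y in I, ∑ j, ∑ k, Φ j k x y = ∑ j, ∑ k, ∫⁻ y in I, Φ j k x y := by
    intro x
    rw [lintegral_finsetSum _ fun j _ => Finset.measurable_fun_sum _ fun k _ => h0 x j k]
    exact Finset.sum_congr rfl fun j _ => lintegral_finsetSum _ fun k _ => h0 x j k
  simp only [h1]
  rw [lintegral_finsetSum _ fun j _ => Finset.measurable_fun_sum _ fun k _ => h2 j k]
  exact Finset.sum_congr rfl fun j _ => lintegral_finsetSum _ fun k _ => h2 j k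

/-- By `FiberRegular.one_le_sum` the integrand is at least `1` a.e. on the rectangle where `x` has
rank above `r` and `y` has rank at most `r`; oscillation bounds both sides of this rectangle from
below. -/
lemma exists_lower_bound_double_lintegral {K N : ℕ} (hN : 0 < N) (hNK : ¬ N ∣ K)
    {f h : Fin K → L2R} (hreg : ∀ᵐ ξ : ℝ, FiberRegular N f h ξ) {δ : ℝ} (hδ : 0 < δ) :
    ∃ a : ℝ, ENNReal.ofReal (1 / (N * (K + 1)) * δ) ^ 2 ≤
      ∑ j, ∑ k, ∫⁻ x in Set.Ioc a (a + δ), ∫⁻ y in Set.Ioc a (a + δ),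
        ∑' m : ℤ, ‖fourierL2 (f j) (x + m) - fourierL2 (f j) (y + m)‖ₑ *
          ‖fourierL2 (h k) (x + m)‖ₑ := by
  have hDm := aemeasurable_fiberRank hreg
  set D := hDm.mk with hD
  have hDe : ∀ᵐ ξ, fiberRank N f h ξ = D ξ := hDm.ae_eq_mk
  have hDK : ∀ᵐ ξ, D ξ ≤ K := by
    filter_upwards [hDe] with ξ hξ
    rw [← hξ]; exact fiberRank_le
  have hsum : ∀ᵐ ξ, ∑ l ∈ Finset.range N, D (ξ + l) = K := by
    filter_upwards [ae_sum_fiberRank hN hreg, ae_all_iff.2 fun l : ℕ => ae_comp_add hDe l]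
      with ξ h1 h2
    rw [← h1]
    exact Finset.sum_congr rfl fun l _ => (h2 l).symm
  obtain ⟨a, r, hp, hm⟩ := exists_interval_oscillation hDm.measurable_mk hN hNK hDK hsum hδ
  refine ⟨a, ?_⟩
  set I := Set.Ioc a (a + δ) with hI
  set Φ : Fin K → Fin K → ℝ → ℝ → ℝ≥0∞ := fun j k x y =>
    ∑' m : ℤ, ‖fourierL2 (f j) (x + m) - fourierL2 (f j) (y + m)‖ₑ * ‖fourierL2 (h k) (x + m)‖ₑ
  have hmeas : ∀ j k, Measurable fun p : ℝ × ℝ => Φ j k p.1 p.2 := fun j k => by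
    have hu := (Lp.stronglyMeasurable (fourierL2 (f j))).measurable
    have hw := (Lp.stronglyMeasurable (fourierL2 (h k))).measurable
    refine Measurable.tsum fun m =>
      Measurable.mul (Measurable.enorm (Measurable.sub ?_ ?_)) (Measurable.enorm ?_)
    · exact hu.comp (by fun_prop)
    · exact hu.comp (by fun_prop)
    · exact hw.comp (by fun_prop)
  have hEp : MeasurableSet (I ∩ {x | r < D x}) :=
    measurableSet_Ioc.inter (hDm.measurable_mk (measurableSet_Ioi (a := r)))
  have hEm : MeasurableSet (I ∩ {x | D x ≤ r}) :=
    measurableSet_Ioc.inter (hDm.measurable_mk (measurableSet_Iic (a := r)))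
  have hfin : ∀ s : Set ℝ, volume (I ∩ s) ≠ ∞ := fun s =>
    (lt_of_le_of_lt (measure_mono Set.inter_subset_left) (by simp [I])).ne
  have hpos : 0 ≤ 1 / (N * (K + 1)) * δ := by positivity
  calc ENNReal.ofReal (1 / (N * (K + 1)) * δ) ^ 2
      ≤ volume (I ∩ {x | D x ≤ r}) * volume (I ∩ {x | r < D x}) := by
        rw [sq]
        gcongr
        · rw [← ENNReal.ofReal_toReal (hfin _)]
          exact ENNReal.ofReal_le_ofReal hm
        · rw [← ENNReal.ofReal_toReal (hfin _)]
          exact ENNReal.ofReal_le_ofReal hp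
    _ = ∫⁻ x in I ∩ {x | r < D x}, ∫⁻ y in I ∩ {x | D x ≤ r}, 1 := by simp
    _ ≤ ∫⁻ x in I ∩ {x | r < D x}, ∫⁻ y in I ∩ {x | D x ≤ r}, ∑ j, ∑ k, Φ j k x y := by
        refine setLIntegral_mono_ae' hEp ?_
        filter_upwards [hreg, hDe] with x hx1 hx2 hx
        refine setLIntegral_mono_ae' hEm ?_
        filter_upwards [hreg, hDe] with y hy1 hy2 hy
        refine hx1.one_le_sum hy1 ?_
        rw [hx2, hy2]
        exact lt_of_le_of_lt hy.2 hx.2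
    _ ≤ ∫⁻ x in I, ∫⁻ y in I, ∑ j, ∑ k, Φ j k x y :=
        lintegral_mono' (Measure.restrict_mono Set.inter_subset_left le_rfl) fun x =>
          lintegral_mono_set Set.inter_subset_left
    _ = ∑ j, ∑ k, ∫⁻ x in I, ∫⁻ y in I, Φ j k x y :=
        lintegral_lintegral_sum_sum I hmeas

/-- The rank cannot oscillate if the generators are smooth and the dual system is not too
concentrated. -/
lemma false_of_smooth {K N : ℕ} (hN : 0 < N) (hNK : ¬ N ∣ K)
    {f h : Fin K → L2R} (hreg : ∀ᵐ ξ : ℝ, FiberRegular N f h ξ)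
    (hsm : ∀ ε : ℝ, 0 < ε → ∃ δ Ω W : ℝ, 0 < δ ∧ δ ≤ 1 ∧ 0 ≤ Ω ∧ 0 ≤ W ∧ Ω * W ≤ ε * δ ∧
      (∀ j t, |t| ≤ δ →
        ‖l2Translate t (fourierL2 (f j)) - fourierL2 (f j)‖ₑ ≤ ENNReal.ofReal Ω) ∧
      ∀ k a, ∫⁻ x in periodicInterval a δ, ‖fourierL2 (h k) x‖ₑ ^ 2 ≤ ENNReal.ofReal W ^ 2) :
    False := by
  set c : ℝ := 1 / (N * (K + 1)) with hc
  have hN' : (0 : ℝ) < N := by exact_mod_cast hN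
  have hc0 : 0 < c := by positivity
  obtain ⟨δ, Ω, W, hδ, hδ1, hΩ0, hW0, hΩW, hΩ, hW⟩ :=
    -- With this value the upper bound becomes `(c δ)²` times `K² / (2 K² + 1)`, a factor below `1`
    -- even for `K = 0`.
    hsm (c ^ 2 / (2 * K ^ 2 + 1) / 2) (by positivity)
  obtain ⟨a, ha⟩ := exists_lower_bound_double_lintegral hN hNK hreg hδ
  have h1 : ENNReal.ofReal (c * δ) ^ 2 ≤ ENNReal.ofReal (K ^ 2 * (2 * δ * (Ω * W))) := by
    refine ha.trans ?_
    calc _ ≤ ∑ _j : Fin K, ∑ _k : Fin K, ENNReal.ofReal (2 * δ * (Ω * W)) := by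
          refine Finset.sum_le_sum fun j _ => Finset.sum_le_sum fun k _ => ?_
          rw [ENNReal.ofReal_mul (by positivity), ENNReal.ofReal_mul hΩ0]
          exact lintegral_lintegral_sub_mul_le hδ1 _ _ (hΩ j) (hW k a)
      _ = _ := by
          simp only [Finset.sum_const, Finset.card_univ, Fintype.card_fin, nsmul_eq_mul]
          rw [ENNReal.ofReal_mul (p := (K : ℝ) ^ 2) (by positivity),
            ENNReal.ofReal_pow (by positivity), ENNReal.ofReal_natCast, sq]
          ring
  rw [← ENNReal.ofReal_pow (by positivity), ENNReal.ofReal_le_ofReal_iff (by positivity)] at h1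
  have h2 : K ^ 2 * (2 * δ * (Ω * W)) ≤ K ^ 2 * (2 * δ * (c ^ 2 / (2 * K ^ 2 + 1) / 2 * δ)) := by
    gcongr
  have h3 : K ^ 2 * (2 * δ * (c ^ 2 / (2 * K ^ 2 + 1) / 2 * δ))
      = (c * δ) ^ 2 * (K ^ 2 / (2 * K ^ 2 + 1)) := by
    field_simp
  have h4 : (K ^ 2 / (2 * K ^ 2 + 1) : ℝ) < 1 := by
    rw [div_lt_one (by positivity)]
    nlinarith [sq_nonneg (K : ℝ)]
  have h5 : (0 : ℝ) < (c * δ) ^ 2 := by positivity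
  nlinarith

/-! ### Concentration of the dual system -/

/-- A normalized trigonometric sum concentrated near `ξ₀ + ℤ`. -/
noncomputable def phaseMean (M : ℕ) (ξ₀ ξ : ℝ) : ℂ :=
  (M : ℂ)⁻¹ * ∑ p ∈ Finset.range M, phase (p * ξ₀) * phase (-(p * ξ))

/-- The point `a + 1 / (6 M)` is the centre of the interval. For `p < M` the angles are therefore at
most `2π M / (6 M) = π / 3`, where the cosine is at least `1 / 2`. -/
lemma half_le_norm_phaseMean {M : ℕ} (hM : 0 < M) {a ξ : ℝ}
    (hξ : ξ ∈ periodicInterval a (1 / (3 * M))) :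
    1 / 2 ≤ ‖phaseMean M (a + 1 / (6 * M)) ξ‖ := by
  have hM' : (0 : ℝ) < M := by exact_mod_cast hM
  obtain ⟨n, hn1, hn2⟩ := Set.mem_iUnion.1 hξ
  have hterm : ∀ p ∈ Finset.range M,
      1 / 2 ≤ (phase (p * (a + 1 / (6 * M))) * phase (-(p * ξ))).re := by
    intro p hp
    have hpM : (p : ℝ) ≤ M := by exact_mod_cast (Finset.mem_range.1 hp).le
    rw [← phase_add]
    have e : (p * (a + 1 / (6 * M)) + -(p * ξ) : ℝ)
        = p * (a + n + 1 / (6 * M) - ξ) + ((-(p * n) : ℤ) : ℝ) := by push_cast; ring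
    rw [e, phase_add, phase_int, mul_one, re_phase]
    set t := a + n + 1 / (6 * M) - ξ with ht
    have h3 : 1 / (3 * M : ℝ) = 2 * (1 / (6 * M)) := by field_simp; norm_num
    have htabs : |t| ≤ 1 / (6 * M) := by
      rw [abs_le]; constructor <;> linarith
    have h4 : |2 * π * (p * t)| ≤ π / 3 := by
      rw [abs_mul, abs_mul, abs_mul, abs_of_pos pi_pos, abs_two, Nat.abs_cast]
      calc 2 * π * (p * |t|) ≤ 2 * π * (M * (1 / (6 * M))) := by gcongr
        _ = π / 3 := by field_simp; norm_num
    rw [← Real.cos_pi_div_three, ← Real.cos_abs (2 * π * (p * t))]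
    exact Real.cos_le_cos_of_nonneg_of_le_pi (abs_nonneg _) (by linarith [pi_pos]) h4
  refine le_trans ?_ ((Complex.re_le_norm _))
  rw [phaseMean, ← Complex.ofReal_natCast, ← Complex.ofReal_inv, Complex.re_ofReal_mul, Complex.re_sum]
  rw [inv_mul_eq_div, le_div_iff₀ hM']
  calc 1 / 2 * (M : ℝ) = ∑ p ∈ Finset.range M, (1 / 2 : ℝ) := by simp; ring
    _ ≤ _ := Finset.sum_le_sum hterm

lemma coeFn_fourierL2_sum_smul_l2Translate (M : ℕ) (c : ℕ → ℂ) (g : L2R) :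
    fourierL2 (∑ p ∈ Finset.range M, c p • l2Translate p g) =ᵐ[volume]
      fun ξ => (∑ p ∈ Finset.range M, c p * phase (-(p * ξ))) * fourierL2 g ξ := by
  induction M with
  | zero =>
    simp only [Finset.range_zero, Finset.sum_empty, map_zero, zero_mul]
    exact Lp.coeFn_zero _ _ _
  | succ M ih =>
    rw [Finset.sum_range_succ, map_add, map_smul]
    filter_upwards [ih, Lp.coeFn_add (fourierL2 (∑ p ∈ Finset.range M, c p • l2Translate p g))
      (c M • fourierL2 (l2Translate M g)), Lp.coeFn_smul (c M) (fourierL2 (l2Translate M g)),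
      fourierL2_l2Translate M g] with ξ h1 h2 h3 h4
    rw [h2, Pi.add_apply, h1, h3, Pi.smul_apply, h4, Finset.sum_range_succ, smul_eq_mul]
    ring

lemma TranslatesBiorthogonal.inner_l2Translate {K : ℕ} {f h : Fin K → L2R}
    (hfh : TranslatesBiorthogonal f h) (j k : Fin K) (n p : ℤ) :
    inner ℂ (l2Translate n (f j)) (l2Translate p (h k)) = if j = k ∧ n = p then 1 else 0 := by
  have e : l2Translate n (f j) = l2Translate p (l2Translate (n - p : ℤ) (f j)) := by
    rw [l2Translate_l2Translate]; congr 1; push_cast; ring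
  rw [e, ← l2TranslateIso_apply, ← l2TranslateIso_apply p (h k), LinearIsometry.inner_map_map,
    ← inner_conj_symm, hfh j k]
  simp only [sub_eq_zero]
  split_ifs <;> simp

/-- A modulated mean `g` of `M` translates of `h k` has just `M` non-zero inner products with the
system, each of size `1 / M`, so `norm_le_of_approx` bounds `‖g‖` by `C M^{1/q' - 1}`. On the
periodic interval `ĝ` is at least half of the transform of `h k` in modulus. -/
lemma setLIntegral_periodicInterval_dual_le {q q' : ℝ≥0∞} (hq : 2 ≤ q)
    (hqq' : ENNReal.HolderConjugate q q') {K : ℕ} {F : Fin K → L2R} {C : ℝ} (hC : 0 < C)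
    (hCq : ∀ f : shiftInvariantSpace (Set.range F), ∀ ε : ℝ, 0 < ε → ∃ a : (Fin K × ℤ) →₀ ℂ,
      lqNorm q a ≤ C * ‖f‖ ∧ ‖f - Finsupp.linearCombination ℂ (integerTranslates F) a‖ < ε)
    {h : Fin K → L2R} (hV : ∀ k, h k ∈ shiftInvariantSpace (Set.range F))
    (hfh : TranslatesBiorthogonal F h) {M : ℕ} (hM : 0 < M) (k : Fin K) (a : ℝ) :
    ∫⁻ x in periodicInterval a (1 / (3 * M)), ‖fourierL2 (h k) x‖ₑ ^ 2 ≤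
      ENNReal.ofReal (2 * (C * (M : ℝ) ^ (1 / q'.toReal) * (1 / M))) ^ 2 := by
  classical
  have hM' : (0 : ℝ) < M := by exact_mod_cast hM
  set ξ₀ := a + 1 / (6 * M) with hξ₀
  set c : ℕ → ℂ := fun p => (M : ℂ)⁻¹ * phase (p * ξ₀) with hc
  have hcn : ∀ p, ‖c p‖ = 1 / M := fun p => by simp [hc, norm_phase]
  set g : L2R := ∑ p ∈ Finset.range M, c p • l2Translate p (h k) with hg
  have hgV : g ∈ shiftInvariantSpace (Set.range F) :=
    Submodule.sum_mem _ fun p _ => Submodule.smul_mem _ _ (by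
      simpa using l2Translate_int_mem (hV k) p)
  have hin : ∀ i : Fin K × ℤ, inner ℂ (integerTranslates F i) (⟨g, hgV⟩ : shiftInvariantSpace _)
      = ∑ p ∈ Finset.range M, c p * if i.1 = k ∧ i.2 = p then 1 else 0 := by
    intro i
    rw [Submodule.coe_inner]
    change inner ℂ (l2Translate (i.2 : ℝ) (F i.1)) g = _
    rw [hg, inner_sum]
    refine Finset.sum_congr rfl fun p _ => ?_
    rw [inner_smul_right]
    congr 1
    have := hfh.inner_l2Translate i.1 k i.2 p
    simpa using this
  have hle := norm_le_of_approx hq hqq' hC hCq ⟨g, hgV⟩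
    ((Finset.range M).image fun p : ℕ => (k, (p : ℤ))) (1 / M) (by positivity) (by
      intro i hi
      rw [hin]
      refine Finset.sum_eq_zero fun p hp => ?_
      rw [if_neg, mul_zero]
      rintro ⟨h1, h2⟩
      exact hi (Finset.mem_image.2 ⟨p, hp, Prod.ext h1.symm h2.symm⟩)) (by
      intro i hi
      obtain ⟨p, hp, rfl⟩ := Finset.mem_image.1 hi
      rw [hin, Finset.sum_eq_single_of_mem p hp]
      · simp [hcn]
      · intro l _ hl
        rw [if_neg, mul_zero]
        rintro ⟨-, h2⟩
        exact hl (Int.natCast_inj.1 h2.symm))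
  rw [Finset.card_image_of_injective _ fun p l hpl => by simpa using hpl, Finset.card_range] at hle
  have hnorm : ‖fourierL2 g‖ₑ ≤ ENNReal.ofReal (C * (M : ℝ) ^ (1 / q'.toReal) * (1 / M)) := by
    rw [← ofReal_norm, fourierL2.norm_map]
    exact ENNReal.ofReal_le_ofReal hle
  have hpt : ∀ᵐ x, x ∈ periodicInterval a (1 / (3 * M)) →
      ‖fourierL2 (h k) x‖ₑ ^ 2 ≤ 4 * ‖fourierL2 g x‖ₑ ^ 2 := by
    filter_upwards [coeFn_fourierL2_sum_smul_l2Translate M c (h k)] with x hx hxA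
    have h1 := half_le_norm_phaseMean hM hxA
    have h2 : ∑ p ∈ Finset.range M, c p * phase (-(p * x)) = phaseMean M ξ₀ x := by
      simp only [phaseMean, hc, Finset.mul_sum, mul_assoc]
    rw [hx, h2, ← ofReal_norm, ← ofReal_norm, ← ENNReal.ofReal_pow (norm_nonneg _),
      ← ENNReal.ofReal_pow (norm_nonneg _), show (4 : ℝ≥0∞) = ENNReal.ofReal 4 by simp,
      ← ENNReal.ofReal_mul (by norm_num)]
    refine ENNReal.ofReal_le_ofReal ?_
    rw [norm_mul, mul_pow, ← mul_assoc]
    refine le_mul_of_one_le_left (by positivity) ?_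
    nlinarith
  calc _ ≤ ∫⁻ x in periodicInterval a (1 / (3 * M)), 4 * ‖fourierL2 g x‖ₑ ^ 2 :=
        setLIntegral_mono_ae' (measurableSet_periodicInterval _ _) hpt
    _ ≤ ∫⁻ x, 4 * ‖fourierL2 g x‖ₑ ^ 2 := setLIntegral_le_lintegral _ _
    _ = 4 * ‖fourierL2 g‖ₑ ^ 2 := by
        rw [lintegral_const_mul' _ _ (by simp), enorm_sq_eq_lintegral]
    _ ≤ 4 * ENNReal.ofReal (C * (M : ℝ) ^ (1 / q'.toReal) * (1 / M)) ^ 2 := by gcongr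
    _ = _ := by
        rw [ENNReal.ofReal_mul (p := 2) (by norm_num), mul_pow]
        norm_num

/-! ### Moments and the modulus of continuity of the Fourier transform -/

lemma moment_eq (t : ℝ) (f : L2R) :
    moment t f = ∫⁻ x, ENNReal.ofReal (|x| ^ t) * ‖f x‖ₑ ^ 2 := by
  refine lintegral_congr fun x => ?_
  rw [ENNReal.ofReal_mul (by positivity), ENNReal.ofReal_pow (norm_nonneg _), ofReal_norm]

/-- Because `|x|^s ≤ 1 + |x|^t` and `f` is square integrable. -/
lemma moment_mono {s t : ℝ} (hs : 0 ≤ s) (hst : s ≤ t) {f : L2R} (h : moment s f = ∞) :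
    moment t f = ∞ := by
  rw [moment_eq] at h ⊢
  by_contra hcon
  have hle : ∫⁻ x, ENNReal.ofReal (|x| ^ s) * ‖f x‖ₑ ^ 2 ≤
      ∫⁻ x, (‖f x‖ₑ ^ 2 + ENNReal.ofReal (|x| ^ t) * ‖f x‖ₑ ^ 2) := by
    refine lintegral_mono fun x => ?_
    rw [← one_add_mul]
    gcongr
    rw [← ENNReal.ofReal_one, ← ENNReal.ofReal_add zero_le_one (by positivity)]
    refine ENNReal.ofReal_le_ofReal ?_
    rcases le_total |x| 1 with hx | hx
    · have := Real.rpow_le_one (abs_nonneg x) hx hs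
      have := Real.rpow_nonneg (abs_nonneg x) t
      linarith
    · have := Real.rpow_le_rpow_of_exponent_le hx hst
      linarith
  rw [h, lintegral_add_left' ((Lp.aestronglyMeasurable f).enorm.pow_const 2),
    ← enorm_sq_eq_lintegral] at hle
  have : ‖f‖ₑ ^ 2 + ∫⁻ x, ENNReal.ofReal (|x| ^ t) * ‖f x‖ₑ ^ 2 < ∞ :=
    ENNReal.add_lt_top.2 ⟨ENNReal.pow_lt_top enorm_lt_top, lt_top_iff_ne_top.2 hcon⟩
  exact absurd (hle.trans_lt this) (lt_irrefl _)

/-- The endpoint `q = ∞`: a second moment gives a Lipschitz bound, but no decay beyond it. -/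
lemma enorm_l2Translate_fourierL2_sub_le_of_moment_two {f : L2R} (hf : moment 2 f ≠ ∞) :
    ∃ C : ℝ, 0 ≤ C ∧ ∀ t : ℝ,
      ‖l2Translate t (fourierL2 f) - fourierL2 f‖ₑ ≤ ENNReal.ofReal (C * |t|) := by
  refine ⟨2 * π * √(moment 2 f).toReal, by positivity, fun t => ?_⟩
  rw [← ENNReal.pow_le_pow_left_iff two_ne_zero, enorm_sq_l2Translate_fourierL2_sub]
  calc _ ≤ ∫⁻ x, ENNReal.ofReal ((2 * π * |t|) ^ 2) * (ENNReal.ofReal (|x| ^ (2 : ℝ)) * ‖f x‖ₑ ^ 2) := by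
        refine lintegral_mono fun x => ?_
        rw [← mul_assoc, ← ENNReal.ofReal_mul (by positivity), ← ofReal_norm (phase _ - 1),
          ← ENNReal.ofReal_pow (norm_nonneg _)]
        gcongr
        rw [Real.rpow_two, ← mul_pow, mul_assoc, ← abs_mul]
        gcongr
        exact norm_phase_sub_one_le _
    _ = ENNReal.ofReal ((2 * π * |t|) ^ 2) * moment 2 f := by
        rw [lintegral_const_mul' _ _ ENNReal.ofReal_ne_top, moment_eq]
    _ = _ := by
        rw [← ENNReal.ofReal_toReal hf, ← ENNReal.ofReal_mul (by positivity),
          ← ENNReal.ofReal_pow (by positivity), ENNReal.toReal_ofReal ENNReal.toReal_nonneg]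
        congr 1
        rw [mul_pow, mul_pow _ |t|, mul_pow _ (√_), Real.sq_sqrt ENNReal.toReal_nonneg]
        ring

lemma norm_phase_sub_one_sq_le_rpow {s : ℝ} (hs0 : 0 ≤ s) (hs1 : s ≤ 1) (y : ℝ) :
    ‖phase y - 1‖ ^ 2 ≤ (2 * π) ^ 2 * |y| ^ (2 * s) := by
  rcases le_total |y| 1 with hy | hy
  · calc ‖phase y - 1‖ ^ 2 ≤ (2 * π * |y|) ^ 2 := by gcongr; exact norm_phase_sub_one_le _
      _ = (2 * π) ^ 2 * |y| ^ (2 : ℝ) := by rw [mul_pow, Real.rpow_two]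
      _ ≤ _ := by
        refine mul_le_mul_of_nonneg_left ?_ (by positivity)
        rcases (abs_nonneg y).eq_or_lt with h0 | h0
        · rw [← h0, Real.zero_rpow (by norm_num)]; positivity
        · exact Real.rpow_le_rpow_of_exponent_ge h0 hy (by linarith)
  · calc ‖phase y - 1‖ ^ 2 ≤ 2 ^ 2 := by gcongr; exact norm_phase_sub_one_le_two _
      _ ≤ (2 * π) ^ 2 * 1 := by nlinarith [pi_gt_three]
      _ ≤ _ := by
        gcongr
        exact Real.one_le_rpow hy (by positivity)

lemma tendsto_norm_phase_sub_one_sq_div_rpow {s : ℝ} (hs1 : s < 1) (x : ℝ) :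
    Tendsto (fun t : ℝ => ‖phase (t * x) - 1‖ ^ 2 / |t| ^ (2 * s)) (𝓝[≠] 0) (𝓝 0) := by
  have hlim : Tendsto (fun t : ℝ => (2 * π * |x|) ^ 2 * |t| ^ (2 - 2 * s)) (𝓝[≠] 0) (𝓝 0) := by
    have h1 : Continuous fun t : ℝ => (2 * π * |x|) ^ 2 * |t| ^ (2 - 2 * s) := by
      refine continuous_const.mul ?_
      exact continuous_abs.rpow_const fun t => Or.inr (by linarith)
    have h2 := h1.tendsto 0
    rw [abs_zero, Real.zero_rpow (by linarith), mul_zero] at h2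
    exact h2.mono_left nhdsWithin_le_nhds
  refine squeeze_zero' (Eventually.of_forall fun t => by positivity) ?_ hlim
  filter_upwards [self_mem_nhdsWithin] with t ht
  have ht0 : 0 < |t| := abs_pos.2 ht
  rw [Real.rpow_sub ht0, Real.rpow_two, ← mul_div_assoc]
  gcongr
  rw [← mul_pow]
  gcongr
  refine (norm_phase_sub_one_le _).trans_eq ?_
  rw [abs_mul]; ring

/-- A finite moment of order `2s < 2` gives a modulus of continuity `o(|t|^s)`. -/
lemma eventually_enorm_l2Translate_fourierL2_sub_le {s : ℝ} (hs0 : 0 ≤ s) (hs1 : s < 1) {f : L2R}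
    (hf : moment (2 * s) f ≠ ∞) {η : ℝ} (hη : 0 < η) : ∀ᶠ t in 𝓝 (0 : ℝ),
      ‖l2Translate t (fourierL2 f) - fourierL2 f‖ₑ ≤ ENNReal.ofReal (η * |t| ^ s) := by
  have hlim : Tendsto (fun t : ℝ => ∫⁻ x,
      ENNReal.ofReal (‖phase (t * x) - 1‖ ^ 2 / |t| ^ (2 * s)) * ‖f x‖ₑ ^ 2) (𝓝[≠] 0)
      (𝓝 (∫⁻ x : ℝ, 0)) := by
    -- Dominated convergence turns `O` into `o`: the quotients are dominated by a multiple of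
    -- `|x|^(2s)`, integrable against `|f|²`, and tend to zero pointwise because `2 - 2s > 0`.
    refine tendsto_lintegral_filter_of_dominated_convergence
      (fun x => ENNReal.ofReal ((2 * π) ^ 2) * (ENNReal.ofReal (|x| ^ (2 * s)) * ‖f x‖ₑ ^ 2))
      (Eventually.of_forall fun t => ?_) ?_ ?_ ?_
    · refine Measurable.mul ?_ ((Lp.stronglyMeasurable f).measurable.enorm.pow_const 2)
      have : Measurable fun x => phase (t * x) :=
        (continuous_phase.comp (continuous_const.mul continuous_id)).measurable
      fun_prop
    · filter_upwards [self_mem_nhdsWithin] with t ht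
      have ht0 : 0 < |t| := abs_pos.2 ht
      refine Eventually.of_forall fun x => ?_
      rw [← mul_assoc, ← ENNReal.ofReal_mul (by positivity)]
      gcongr
      rw [div_le_iff₀ (by positivity), mul_assoc, ← Real.mul_rpow (abs_nonneg _) (abs_nonneg _),
        ← abs_mul, mul_comm x t]
      exact norm_phase_sub_one_sq_le_rpow hs0 hs1.le _
    · rw [lintegral_const_mul' _ _ ENNReal.ofReal_ne_top, ← moment_eq]
      exact ENNReal.mul_ne_top ENNReal.ofReal_ne_top hf
    · refine Eventually.of_forall fun x => ?_
      have h1 := ENNReal.tendsto_ofReal (tendsto_norm_phase_sub_one_sq_div_rpow hs1 x)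
      have h2 := ENNReal.Tendsto.mul_const h1 (b := ‖f x‖ₑ ^ 2)
        (Or.inr (ENNReal.pow_ne_top enorm_ne_top))
      simpa using h2
  rw [lintegral_zero] at hlim
  have hev := (ENNReal.tendsto_nhds_zero.1 hlim) (ENNReal.ofReal (η ^ 2))
    (ENNReal.ofReal_pos.2 (by positivity))
  rw [eventually_nhdsWithin_iff] at hev
  filter_upwards [hev] with t ht
  rcases eq_or_ne t 0 with rfl | ht0
  · simp [l2Translate_zero]
  have ht1 : 0 < |t| := abs_pos.2 ht0
  rw [← ENNReal.pow_le_pow_left_iff two_ne_zero, enorm_sq_l2Translate_fourierL2_sub]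
  have e : ∀ x, ‖phase (t * x) - 1‖ₑ ^ 2 * ‖f x‖ₑ ^ 2 = ENNReal.ofReal (|t| ^ (2 * s)) *
      (ENNReal.ofReal (‖phase (t * x) - 1‖ ^ 2 / |t| ^ (2 * s)) * ‖f x‖ₑ ^ 2) := fun x => by
    rw [← mul_assoc, ← ENNReal.ofReal_mul (by positivity), mul_div_cancel₀ _ (by positivity),
      ENNReal.ofReal_pow (norm_nonneg _), ofReal_norm]
  simp only [e]
  rw [lintegral_const_mul' _ _ ENNReal.ofReal_ne_top, ← ENNReal.ofReal_pow (by positivity), mul_pow,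
    ENNReal.ofReal_mul (by positivity), mul_comm (ENNReal.ofReal (η ^ 2)),
    ← Real.rpow_natCast (|t| ^ s), ← Real.rpow_mul ht1.le]
  rw [show (s * (2 : ℕ) : ℝ) = 2 * s by push_cast; ring]
  gcongr
  exact ht ht0

/-! ### Uniform integrability on periodic intervals -/

lemma add_int_mem_periodicInterval {a δ x : ℝ} (n : ℤ) :
    x + n ∈ periodicInterval a δ ↔ x ∈ periodicInterval a δ := by
  have h : ∀ (y : ℝ) (m : ℤ), y ∈ periodicInterval a δ → y + m ∈ periodicInterval a δ := by
    intro y m hy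
    obtain ⟨k, hk1, hk2⟩ := Set.mem_iUnion.1 hy
    refine Set.mem_iUnion.2 ⟨k + m, ?_, ?_⟩ <;> push_cast <;> linarith
  refine ⟨fun hx => ?_, h x n⟩
  have := h _ (-n) hx
  simpa using this

lemma setLIntegral_periodicInterval (a δ : ℝ) {G : ℝ → ℝ≥0∞} (hG : Measurable G) :
    ∫⁻ x in periodicInterval a δ, G x =
      ∫⁻ x in periodicInterval a δ ∩ Set.Ioc 0 1, ∑' n : ℤ, G (x + n) := by
  have hA := measurableSet_periodicInterval a δ
  rw [← lintegral_indicator hA, lintegral_eq_tsum_int, ← Measure.restrict_restrict hA,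
    ← lintegral_indicator hA, ← lintegral_tsum]
  · refine lintegral_congr fun x => ?_
    by_cases hx : x ∈ periodicInterval a δ
    · simp [Set.indicator, add_int_mem_periodicInterval, hx]
    · simp [Set.indicator, add_int_mem_periodicInterval, hx]
  · intro n
    exact ((hG.indicator hA).comp (measurable_add_const _)).aemeasurable

lemma volume_periodicInterval_inter_le {a δ : ℝ} (hδ1 : δ ≤ 1) :
    volume (periodicInterval a δ ∩ Set.Ioc 0 1) ≤ ENNReal.ofReal δ := by
  have h1 : volume (periodicInterval a δ ∩ Set.Ioc 0 1)
      = ∫⁻ x in periodicInterval a δ, (Set.Ioc (0 : ℝ) 1).indicator (fun _ => 1) x := by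
    rw [lintegral_indicator measurableSet_Ioc, setLIntegral_one, Measure.restrict_apply measurableSet_Ioc,
      Set.inter_comm]
  rw [h1, ← tsum_setLIntegral_Ioc hδ1, ← lintegral_tsum]
  · calc _ ≤ ∫⁻ x in Set.Ioc a (a + δ), 1 := by
          refine lintegral_mono fun x => ?_
          -- Exactly one integer shift brings `x` into `(0, 1]`.
          rw [tsum_eq_single (1 - ⌈x⌉)]
          · exact Set.indicator_le_self' (fun _ _ => zero_le) _
          · intro n hn
            refine Set.indicator_of_notMem (fun hx => hn ?_) _
            have h3 : ⌈x + n⌉ = 1 := Int.ceil_eq_iff.2 ⟨by push_cast; linarith [hx.1], by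
              push_cast; exact hx.2⟩
            rw [Int.ceil_add_intCast] at h3
            omega
      _ = _ := by simp
  · intro n
    exact ((measurable_const.indicator measurableSet_Ioc).comp (measurable_add_const _)).aemeasurable

/-- The periodization of `|w|²` is integrable on `(0, 1]`, and the periodic interval has measure at
most `δ` there. Absolute continuity of the integral is therefore uniform in `a`. -/
lemma exists_setLIntegral_periodicInterval_le (w : L2R) {η : ℝ} (hη : 0 < η) :
    ∃ δ₀ : ℝ, 0 < δ₀ ∧ ∀ δ : ℝ, δ < δ₀ → δ ≤ 1 → ∀ a,
      ∫⁻ x in periodicInterval a δ, ‖w x‖ₑ ^ 2 ≤ ENNReal.ofReal η ^ 2 := by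
  have hG : Measurable fun x => ‖w x‖ₑ ^ 2 :=
    (Lp.stronglyMeasurable w).measurable.enorm.pow_const 2
  have hfin : ∫⁻ x in Set.Ioc (0 : ℝ) 1, ∑' n : ℤ, ‖w (x + n)‖ₑ ^ 2 ≠ ∞ := by
    have hm : ∀ n : ℤ, AEMeasurable (fun x => ‖w (x + n)‖ₑ ^ 2)
        (volume.restrict (Set.Ioc (0 : ℝ) 1)) := fun n =>
      (hG.comp (measurable_add_const (n : ℝ))).aemeasurable
    rw [lintegral_tsum hm, ← lintegral_eq_tsum_int fun x => ‖w x‖ₑ ^ 2, ← enorm_sq_eq_lintegral]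
    exact ENNReal.pow_ne_top enorm_ne_top
  obtain ⟨δ₀, hδ₀, h⟩ := exists_pos_setLIntegral_lt_of_measure_lt hfin
    (ε := ENNReal.ofReal η ^ 2) (pow_ne_zero _ (ENNReal.ofReal_pos.2 hη).ne')
  refine ⟨(min δ₀ 1).toReal, ENNReal.toReal_pos (by simp [hδ₀.ne']) (by simp), fun δ hδ hδ1 a => ?_⟩
  rw [setLIntegral_periodicInterval a δ hG, ← Measure.restrict_restrict
    (measurableSet_periodicInterval a δ)]
  refine (h _ ?_).le
  rw [Measure.restrict_apply (measurableSet_periodicInterval a δ)]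
  refine (volume_periodicInterval_inter_le hδ1).trans_lt ?_
  refine lt_of_lt_of_le ?_ (min_le_left δ₀ 1)
  have hpos : 0 < (min δ₀ 1).toReal := ENNReal.toReal_pos (by simp [hδ₀.ne']) (by simp)
  rw [← ENNReal.ofReal_toReal (show min δ₀ 1 ≠ ∞ by simp)]
  exact (ENNReal.ofReal_lt_ofReal_iff hpos).2 hδ

/-! ### The uncertainty principle -/

lemma exists_nat_one_div_lt_and_one_div_le {δ₀ : ℝ} (hδ₀ : 0 < δ₀) :
    ∃ M : ℕ, 0 < M ∧ 1 / (3 * M : ℝ) < δ₀ := by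
  obtain ⟨M, hM⟩ := exists_nat_one_div_lt hδ₀
  refine ⟨M + 1, M.succ_pos, lt_of_le_of_lt ?_ hM⟩
  push_cast
  gcongr
  linarith [Nat.cast_nonneg (α := ℝ) M]

lemma one_div_three_mul_le_one {M : ℕ} (hM : 0 < M) : 1 / (3 * M : ℝ) ≤ 1 := by
  have : (1 : ℝ) ≤ M := by exact_mod_cast hM
  rw [div_le_one (by positivity)]
  linarith

/-- The uncertainty principle: a shift-invariant space with extra invariance and an exact
`(C_q)`-system of translates has a generator with infinite moment of order `2/q'`. -/
theorem exists_moment_eq_top {q q' : ℝ≥0∞} (hq : 2 ≤ q) (hqq' : ENNReal.HolderConjugate q q')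
    {K : ℕ} {F : Fin K → L2R} (hV : HasNontrivialExtraInvariance (shiftInvariantSpace (Set.range F)))
    (hF : IsExactCqSystem q (integerTranslates F)) :
    ∃ k : Fin K, moment (2 / q'.toReal) (F k) = ∞ := by
  by_contra! hcon
  obtain ⟨γ, -, hγ, hJγ⟩ := hV
  obtain ⟨h', hfh⟩ := exists_translatesBiorthogonal hF.1.2
  set h : Fin K → L2R := fun k => h' k with hh
  rw [hfh.minGenerators_eq] at hJγ
  obtain ⟨N, hN, hNK, hinv⟩ := exists_one_div_mem_translationGroup (S := Set.range F) hγ hJγ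
  have hreg : ∀ᵐ ξ : ℝ, FiberRegular N F h ξ := by
    filter_upwards [hfh.ae_fiber, ae_restrict_fiber_mem_span hN hinv] with ξ h1 h2
    exact ⟨h1, h2⟩
  obtain ⟨C, hC, hCq⟩ := hF.2
  have hdual := fun {M : ℕ} (hM : 0 < M) (k : Fin K) (a : ℝ) =>
    setLIntegral_periodicInterval_dual_le hq hqq' hC hCq (fun k => (h' k).2) hfh hM k a
  have hs := one_div_toReal_of_holderConjugate hq hqq'
  refine false_of_smooth hN hNK hreg fun ε hε => ?_
  -- At `q = ∞` smoothness supplies exactly order `δ` and the smallness must come from the dual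
  -- system; for `q < ∞` the `(C_q)` bound gives the rate and the smallness comes from the modulus
  -- of continuity.
  rcases eq_or_ne q ∞ with hqt | hqt
  · have hs1 : 2 / q'.toReal = 2 := by
      rw [← mul_one_div, hs, hqt]; simp
    rw [hs1] at hcon
    choose c hc0 hc using fun k => enorm_l2Translate_fourierL2_sub_le_of_moment_two (hcon k)
    set B := ∑ k, c k + 1 with hB
    have hcB : ∀ k, c k ≤ B := fun k => by
      have := Finset.single_le_sum (f := c) (fun k _ => hc0 k) (Finset.mem_univ k)
      linarith
    have hB0 : 0 < B := by
      have := Finset.sum_nonneg (s := Finset.univ) fun k _ => hc0 k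
      linarith
    choose δ₀ hδ₀ hW using fun k =>
      exists_setLIntegral_periodicInterval_le (fourierL2 (h k)) (div_pos hε hB0)
    obtain ⟨d, hd0, hd⟩ : ∃ d : ℝ, 0 < d ∧ ∀ k, d ≤ δ₀ k := by
      have hev : ∀ᶠ d in 𝓝[>] (0 : ℝ), ∀ k, d ≤ δ₀ k :=
        eventually_all.2 fun k => mem_nhdsWithin_of_mem_nhds (Iic_mem_nhds (hδ₀ k))
      obtain ⟨d, h1, h2⟩ := (hev.and self_mem_nhdsWithin).exists
      exact ⟨d, h2, h1⟩
    obtain ⟨M, hM, hMd⟩ := exists_nat_one_div_lt_and_one_div_le hd0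
    have hM' : (0 : ℝ) < M := by exact_mod_cast hM
    refine ⟨1 / (3 * M), B * (1 / (3 * M)), ε / B, by positivity, one_div_three_mul_le_one hM,
      by positivity, by positivity, le_of_eq (by field_simp), fun j t ht => ?_, fun k a => ?_⟩
    · refine (hc j t).trans (ENNReal.ofReal_le_ofReal ?_)
      have := hcB j
      gcongr
    · exact hW k _ (hMd.trans_le (hd k)) (one_div_three_mul_le_one hM) a
  · set s := 1 / q'.toReal with hsd
    have hqpos : 0 < q.toReal := ENNReal.toReal_pos (zero_lt_two.trans_le hq).ne' hqt
    have hq2 : 2 ≤ q.toReal := by simpa using ENNReal.toReal_mono hqt hq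
    have hs1 : s < 1 := by
      rw [hs]; linarith [one_div_pos.2 hqpos]
    have hs0 : 0 ≤ s := by
      rw [hs]
      have : 1 / q.toReal ≤ 1 := by
        rw [div_le_one hqpos]; linarith
      linarith
    have hmom : ∀ k, moment (2 * s) (F k) ≠ ∞ := fun k => by
      rw [hsd, mul_one_div]; exact hcon k
    -- Chosen so that `2 η C / M` is `ε` times the interval length `1 / (3 M)`.
    set η := ε / (6 * C) with hη
    have hη0 : 0 < η := by positivity
    obtain ⟨d, hd0, hd⟩ := Metric.eventually_nhds_iff.1 (eventually_all.2 fun k =>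
      eventually_enorm_l2Translate_fourierL2_sub_le hs0 hs1 (hmom k) hη0)
    obtain ⟨M, hM, hMd⟩ := exists_nat_one_div_lt_and_one_div_le hd0
    have hM' : (0 : ℝ) < M := by exact_mod_cast hM
    refine ⟨1 / (3 * M), η * (1 / (3 * M)) ^ s, 2 * (C * (M : ℝ) ^ s * (1 / M)), by positivity,
      one_div_three_mul_le_one hM, by positivity, by positivity, ?_, fun j t ht => ?_, hdual hM⟩
    · have h1 : (1 / (3 * M) : ℝ) ^ s * (M : ℝ) ^ s ≤ 1 := by
        rw [← Real.mul_rpow (by positivity) (by positivity)]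
        refine Real.rpow_le_one (by positivity) ?_ hs0
        rw [one_div_mul_eq_div, div_le_one (by positivity)]
        linarith
      calc η * (1 / (3 * M)) ^ s * (2 * (C * (M : ℝ) ^ s * (1 / M)))
          = 2 * η * C * (1 / M) * ((1 / (3 * M) : ℝ) ^ s * (M : ℝ) ^ s) := by ring
        _ ≤ 2 * η * C * (1 / M) * 1 := by gcongr
        _ = ε * (1 / (3 * M)) := by rw [hη]; field_simp; norm_num
    · refine (hd (y := t) ?_ j).trans (ENNReal.ofReal_le_ofReal (by gcongr))
      rw [dist_zero_right, Real.norm_eq_abs]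
      exact lt_of_le_of_lt ht hMd

/-! ### Norms of finitely supported sequences -/

section LqNorm

variable {ι : Type*}

lemma lqNorm_add_le {q : ℝ≥0∞} (hq : 1 ≤ q) (a b : ι →₀ ℂ) :
    lqNorm q (a + b) ≤ lqNorm q a + lqNorm q b := by
  have : Fact (1 ≤ q) := ⟨hq⟩
  exact norm_add_le
    (⟨fun i => a i, (memℓp_zero a.hasFiniteSupport).of_exponent_ge zero_le⟩ :
      lp (fun _ : ι => ℂ) q)
    (⟨fun i => b i, (memℓp_zero b.hasFiniteSupport).of_exponent_ge zero_le⟩ :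
      lp (fun _ : ι => ℂ) q)

lemma lqNorm_zero (q : ℝ≥0∞) : lqNorm q (0 : ι →₀ ℂ) = 0 :=
  lp.norm_zero (E := fun _ : ι => ℂ) (p := q)

lemma lqNorm_sum_le {q : ℝ≥0∞} (hq : 1 ≤ q) {κ : Type*} (s : Finset κ) (a : κ → ι →₀ ℂ) :
    lqNorm q (∑ i ∈ s, a i) ≤ ∑ i ∈ s, lqNorm q (a i) := by
  classical
  induction s using Finset.induction_on with
  | empty => simp [lqNorm_zero]
  | insert i s hi ih =>
    rw [Finset.sum_insert hi, Finset.sum_insert hi]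
    exact (lqNorm_add_le hq _ _).trans (by gcongr)

/-- Interpolation between the sup norm and the `ℓ²`-norm. -/
lemma lqNorm_le_of_sup_of_sum_sq {q : ℝ≥0∞} (hq : 2 ≤ q) (a : ι →₀ ℂ) {b c : ℝ} (hb : 0 ≤ b)
    (hc : 0 ≤ c) (hab : ∀ i, ‖a i‖ ≤ b) (hac : ∀ s : Finset ι, ∑ i ∈ s, ‖a i‖ ^ 2 ≤ c ^ 2) :
    lqNorm q a ≤ b ^ (1 - 2 * (1 / q.toReal)) * c ^ (2 * (1 / q.toReal)) := by
  rcases eq_or_ne q ∞ with rfl | hqt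
  · simp only [ENNReal.toReal_top, div_zero, mul_zero, sub_zero, Real.rpow_one, Real.rpow_zero,
      mul_one]
    exact lp.norm_le_of_forall_le hb hab
  · have hq2 : 2 ≤ q.toReal := by simpa using ENNReal.toReal_mono hqt hq
    have hq0 : 0 < q.toReal := by linarith
    refine lp.norm_le_of_forall_sum_le hq0 (by positivity) fun s => ?_
    rw [Real.mul_rpow (by positivity) (by positivity), ← Real.rpow_mul hb, ← Real.rpow_mul hc]
    have e1 : (1 - 2 * (1 / q.toReal)) * q.toReal = q.toReal - 2 := by field_simp
    have e2 : 2 * (1 / q.toReal) * q.toReal = (2 : ℕ) := by field_simp; norm_num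
    rw [e1, e2, Real.rpow_natCast]
    calc ∑ i ∈ s, ‖a i‖ ^ q.toReal ≤ ∑ i ∈ s, b ^ (q.toReal - 2) * ‖a i‖ ^ 2 := by
          refine Finset.sum_le_sum fun i _ => ?_
          have h2 : ‖a i‖ ^ q.toReal = ‖a i‖ ^ (q.toReal - 2) * ‖a i‖ ^ 2 := by
            rcases (norm_nonneg (a i)).eq_or_lt with h0 | h0
            · rw [← h0, Real.zero_rpow hq0.ne']; simp
            · rw [← Real.rpow_natCast ‖a i‖ 2, ← Real.rpow_add h0]
              congr 1; push_cast; ring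
          rw [h2]
          have := hab i
          have h3 : 0 ≤ q.toReal - 2 := by linarith
          gcongr
      _ = b ^ (q.toReal - 2) * ∑ i ∈ s, ‖a i‖ ^ 2 := by rw [Finset.mul_sum]
      _ ≤ _ := by gcongr; exact hac s

end LqNorm

/-! ### Trigonometric approximation on the unit interval -/

/-- Lebesgue measure on the unit interval. -/
noncomputable abbrev unitVolume : Measure ℝ := volume.restrict (Set.Ioc (0 : ℝ) 1)

instance : IsProbabilityMeasure unitVolume := ⟨by simp [unitVolume]⟩

/-- The Fourier coefficients on the unit interval. -/
noncomputable def unitCoeff (m : ℝ → ℂ) (n : ℤ) : ℂ := ∫ x, phase (n * x) * m x ∂unitVolume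

/-- Cauchy–Schwarz on the support: small support makes all coefficients uniformly small. -/
lemma norm_unitCoeff_le {m : ℝ → ℂ} (hm : MemLp m 2 unitVolume) {B : Set ℝ}
    (hmB : ∀ x ∉ B, m x = 0) (n : ℤ) :
    ‖unitCoeff m n‖ ≤ (unitVolume.real B) ^ (1 / 2 : ℝ) * (eLpNorm m 2 unitVolume).toReal := by
  have h1 : ‖unitCoeff m n‖ₑ ≤ eLpNorm m 1 unitVolume := by
    refine (enorm_integral_le_lintegral_enorm _).trans ?_
    rw [eLpNorm_one_eq_lintegral_enorm]
    simp only [enorm_mul, enorm_phase, one_mul, le_refl]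
  have h2 : eLpNorm m 1 unitVolume = eLpNorm m 1 (unitVolume.restrict B) :=
    (eLpNorm_restrict_eq_of_support_subset fun x hx => by_contra fun hxB => hx (hmB x hxB)).symm
  have h3 := eLpNorm_le_eLpNorm_mul_rpow_measure_univ (μ := unitVolume.restrict B) (p := 1) (q := 2)
    (by norm_num) hm.1.restrict
  have h4 : eLpNorm m 2 (unitVolume.restrict B) ≤ eLpNorm m 2 unitVolume :=
    eLpNorm_mono_measure _ Measure.restrict_le_self
  have h5 : ‖unitCoeff m n‖ₑ ≤ eLpNorm m 2 unitVolume * unitVolume B ^ (1 / 2 : ℝ) := by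
    refine h1.trans (h2.le.trans (h3.trans ?_))
    rw [Measure.restrict_apply_univ]
    norm_num
    gcongr
  have h6 := ENNReal.toReal_mono (ENNReal.mul_ne_top hm.2.ne (by finiteness)) h5
  rw [toReal_enorm, ENNReal.toReal_mul, ← ENNReal.toReal_rpow, mul_comm] at h6
  exact h6

/-- Transfer to the circle, where the Fourier basis lives. The sign of `n` flips because `unitCoeff`
integrates against `phase (n * x)`, to match the modulation by `phase (-(n * ξ))` that translation
by `n` produces. -/
lemma exists_ae_eq_fourierCoeff_eq_unitCoeff {m : ℝ → ℂ} (hm : MemLp m 2 unitVolume) :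
    ∃ U : Lp ℂ 2 (AddCircle.haarAddCircle (T := (1 : ℝ))),
      (∀ᵐ x : ℝ ∂unitVolume, U (x : AddCircle (1 : ℝ)) = m x) ∧
      ∀ n : ℤ, fourierCoeff U (-n) = unitCoeff m n := by
  have hvol : (AddCircle.haarAddCircle : Measure (AddCircle (1 : ℝ))) = volume := by
    rw [AddCircle.volume_eq_smul_haarAddCircle]; simp
  have hmp := AddCircle.measurePreserving_mk 1 0
  rw [zero_add] at hmp
  have hL : MemLp (AddCircle.liftIoc 1 0 m) 2 (AddCircle.haarAddCircle (T := (1 : ℝ))) := by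
    rw [hvol]
    refine MemLp.memLp_liftIoc ?_
    rwa [zero_add]
  obtain ⟨U, hU⟩ : ∃ U : Lp ℂ 2 (AddCircle.haarAddCircle (T := (1 : ℝ))),
      U =ᵐ[AddCircle.haarAddCircle (T := (1 : ℝ))] AddCircle.liftIoc 1 0 m :=
    ⟨hL.toLp _, hL.coeFn_toLp⟩
  have hU' : ∀ᵐ x : ℝ ∂unitVolume, U (x : AddCircle (1 : ℝ)) = m x := by
    have hmp' : MeasurePreserving ((↑) : ℝ → AddCircle (1 : ℝ)) unitVolume
        AddCircle.haarAddCircle := by rw [hvol]; exact hmp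
    filter_upwards [hmp'.quasiMeasurePreserving.ae hU, ae_restrict_mem measurableSet_Ioc]
      with x hx hx2
    rw [hx, AddCircle.liftIoc_coe_apply (by simpa using hx2)]
  have hint : ∀ V : AddCircle (1 : ℝ) → ℂ,
      ∫ y, V y ∂AddCircle.haarAddCircle = ∫ x, V (x : ℝ) ∂unitVolume := fun V => by
    rw [hvol, ← AddCircle.integral_preimage 1 0, zero_add]
  refine ⟨U, hU', fun n => ?_⟩
  rw [fourierCoeff, unitCoeff, neg_neg, hint]
  refine integral_congr_ae ?_
  filter_upwards [hU'] with x hx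
  rw [hx, fourier_coe_eq_phase, smul_eq_mul]

lemma lintegral_unit_eq (U : AddCircle (1 : ℝ) → ℝ≥0∞) :
    ∫⁻ x, U (x : AddCircle (1 : ℝ)) ∂unitVolume = ∫⁻ y, U y ∂AddCircle.haarAddCircle := by
  have hvol : (AddCircle.haarAddCircle : Measure (AddCircle (1 : ℝ))) = volume := by
    rw [AddCircle.volume_eq_smul_haarAddCircle]; simp
  rw [hvol, ← AddCircle.lintegral_preimage 1 0, zero_add]

lemma eLpNorm_two_sq {X : Type*} [MeasurableSpace X] {μ : Measure X} (f : X → ℂ) :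
    eLpNorm f 2 μ ^ 2 = ∫⁻ x, ‖f x‖ₑ ^ 2 ∂μ := by
  rw [eLpNorm_eq_lintegral_rpow_enorm_toReal (by simp) (by simp)]
  rw [← ENNReal.rpow_natCast, ← ENNReal.rpow_mul]
  simp

/-- Bessel's inequality. -/
lemma sum_sq_unitCoeff_le {m : ℝ → ℂ} (hm : MemLp m 2 unitVolume) (s : Finset ℤ) :
    ∑ n ∈ s, ‖unitCoeff m n‖ ^ 2 ≤ (eLpNorm m 2 unitVolume).toReal ^ 2 := by
  obtain ⟨U, hU, hc⟩ := exists_ae_eq_fourierCoeff_eq_unitCoeff hm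
  have hnorm : ‖U‖ = (eLpNorm m 2 unitVolume).toReal := by
    rw [← toReal_enorm]
    congr 1
    refine (ENNReal.pow_right_strictMono two_ne_zero).injective ?_
    rw [enorm_sq_eq_lintegral, ← lintegral_unit_eq fun y => ‖U y‖ₑ ^ 2, eLpNorm_two_sq]
    refine lintegral_congr_ae ?_
    filter_upwards [hU] with x hx
    rw [hx]
  have h := (orthonormal_fourier (T := 1)).sum_inner_products_le U (s := s.map (Equiv.neg ℤ).toEmbedding)
  rw [Finset.sum_map, hnorm] at h
  refine le_trans (le_of_eq (Finset.sum_congr rfl fun n _ => ?_)) h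
  rw [← hc, ← fourierBasis_repr, HilbertBasis.repr_apply_apply, coe_fourierBasis]
  rfl

/-- Density of the trigonometric polynomials, with the Fourier coefficients as coefficients. -/
lemma exists_finset_unit_fourier {m : ℝ → ℂ} (hm : MemLp m 2 unitVolume) {ε : ℝ} (hε : 0 < ε) :
    ∃ s : Finset ℤ, eLpNorm (fun x => m x - ∑ n ∈ s, unitCoeff m n * phase (-(n * x))) 2 unitVolume
      < ENNReal.ofReal ε := by
  obtain ⟨U, hU, hc⟩ := exists_ae_eq_fourierCoeff_eq_unitCoeff hm
  have h := hasSum_fourier_series_L2 U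
  rw [← (Equiv.neg ℤ).hasSum_iff] at h
  obtain ⟨s, hs⟩ := (Metric.tendsto_atTop.1 h) ε hε
  refine ⟨s, ?_⟩
  have h1 := hs s le_rfl
  rw [dist_comm, dist_eq_norm, ← ENNReal.ofReal_lt_ofReal_iff hε, ofReal_norm] at h1
  refine lt_of_eq_of_lt ?_ h1
  refine (ENNReal.pow_right_strictMono two_ne_zero).injective ?_
  rw [enorm_sq_eq_lintegral, eLpNorm_two_sq]
  set P : Lp ℂ 2 (AddCircle.haarAddCircle (T := (1 : ℝ))) := ∑ n ∈ s,
    ((fun i => fourierCoeff (U : AddCircle (1 : ℝ) → ℂ) i • fourierLp (T := (1 : ℝ)) 2 i) ∘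
    (Equiv.neg ℤ)) n with hP
  have hPc : P =ᵐ[AddCircle.haarAddCircle (T := (1 : ℝ))]
      fun y => ∑ n ∈ s, unitCoeff m n * fourier (-n) y := by
    have h2 : ∀ t : Finset ℤ, (∑ n ∈ t, ((fun i => fourierCoeff (U : AddCircle (1 : ℝ) → ℂ) i •
        fourierLp (T := (1 : ℝ)) 2 i) ∘ (Equiv.neg ℤ)) n : Lp ℂ 2 (AddCircle.haarAddCircle (T := (1 : ℝ))))
        =ᵐ[AddCircle.haarAddCircle] fun y => ∑ n ∈ t, unitCoeff m n * fourier (-n) y := by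
      intro t
      induction t using Finset.induction_on with
      | empty => simp only [Finset.sum_empty]; exact Lp.coeFn_zero _ _ _
      | insert n t hn ih =>
        rw [Finset.sum_insert hn]
        filter_upwards [ih, Lp.coeFn_add (((fun i => fourierCoeff (U : AddCircle (1 : ℝ) → ℂ) i •
          fourierLp (T := (1 : ℝ)) 2 i) ∘ (Equiv.neg ℤ)) n) (∑ n ∈ t, ((fun i =>
          fourierCoeff (U : AddCircle (1 : ℝ) → ℂ) i • fourierLp (T := (1 : ℝ)) 2 i) ∘ (Equiv.neg ℤ)) n),
          Lp.coeFn_smul (fourierCoeff (U : AddCircle (1 : ℝ) → ℂ) (-n)) (fourierLp (T := (1 : ℝ)) 2 (-n)),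
          coeFn_fourierLp 2 (T := 1) (-n)] with y h1 h2 h3 h4
        rw [h2, Pi.add_apply, h1, Finset.sum_insert hn]
        congr 1
        change ((fourierCoeff (U : AddCircle (1 : ℝ) → ℂ) (-n)) • fourierLp (T := (1 : ℝ)) 2 (-n) :
          Lp ℂ 2 (AddCircle.haarAddCircle (T := (1 : ℝ)))) y = _
        rw [h3, Pi.smul_apply, h4, hc, smul_eq_mul]
    exact h2 s
  have h3 : ∫⁻ y, ‖(U - P : Lp ℂ 2 (AddCircle.haarAddCircle (T := (1 : ℝ)))) y‖ₑ ^ 2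
      ∂AddCircle.haarAddCircle = ∫⁻ y, ‖U y - ∑ n ∈ s, unitCoeff m n * fourier (-n) y‖ₑ ^ 2
        ∂AddCircle.haarAddCircle := by
    refine lintegral_congr_ae ?_
    filter_upwards [Lp.coeFn_sub U P, hPc] with y h1 h2
    rw [h1, Pi.sub_apply, h2]
  rw [h3, ← lintegral_unit_eq fun y => ‖U y - ∑ n ∈ s, unitCoeff m n * fourier (-n) y‖ₑ ^ 2]
  refine lintegral_congr_ae ?_
  filter_upwards [hU] with x hx
  rw [hx]
  simp only [fourier_coe_eq_phase, Int.cast_neg, neg_mul]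

/-! ### Generators with a Fourier transform supported on the unit interval -/

/-- `∑ₙ c(n) δ_(0, n)`, as a coefficient sequence for the translates of a single function. -/
noncomputable def singleCoeff (s : Finset ℤ) (c : ℤ → ℂ) : Fin 1 × ℤ →₀ ℂ :=
  ∑ n ∈ s, Finsupp.single (0, n) (c n)

lemma singleCoeff_apply (s : Finset ℤ) (c : ℤ → ℂ) (i : Fin 1 × ℤ) :
    singleCoeff s c i = if i.2 ∈ s then c i.2 else 0 := by
  obtain ⟨k, n⟩ := i
  obtain rfl : k = 0 := Subsingleton.elim _ _
  simp only [singleCoeff, Finsupp.finsetSum_apply, Finsupp.single_apply, Prod.mk.injEq, true_and,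
    Finset.sum_ite_eq']

/-- Interpolates between the sup bound, which gains `|B|^{1/2}`, and Bessel's inequality, which
gains nothing; the exponent is `(1/2)(1 - 2/q)`. The bound does not depend on `s`. -/
lemma lqNorm_singleCoeff_le {q : ℝ≥0∞} (hq : 2 ≤ q) (s : Finset ℤ) {m : ℝ → ℂ}
    (hm : MemLp m 2 unitVolume) {B : Set ℝ} (hmB : ∀ x ∉ B, m x = 0) :
    lqNorm q (singleCoeff s (unitCoeff m)) ≤
      (unitVolume.real B) ^ (1 / 2 - 1 / q.toReal) * (eLpNorm m 2 unitVolume).toReal := by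
  set N := (eLpNorm m 2 unitVolume).toReal with hN
  have hN0 : 0 ≤ N := ENNReal.toReal_nonneg
  have hV0 : 0 ≤ unitVolume.real B := measureReal_nonneg
  refine (lqNorm_le_of_sup_of_sum_sq hq _ (b := (unitVolume.real B) ^ (1 / 2 : ℝ) * N) (c := N)
    (by positivity) hN0 (fun i => ?_) fun t => ?_).trans (le_of_eq ?_)
  · rw [singleCoeff_apply]
    split_ifs
    · exact norm_unitCoeff_le hm hmB _
    · rw [norm_zero]; positivity
  · calc ∑ i ∈ t, ‖singleCoeff s (unitCoeff m) i‖ ^ 2 ≤ ∑ i ∈ t, ‖unitCoeff m i.2‖ ^ 2 := by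
          refine Finset.sum_le_sum fun i _ => ?_
          rw [singleCoeff_apply]
          split_ifs
          · exact le_rfl
          · rw [norm_zero, zero_pow two_ne_zero]; positivity
      _ = ∑ n ∈ t.image Prod.snd, ‖unitCoeff m n‖ ^ 2 := by
          rw [Finset.sum_image fun i _ j _ hij => Prod.ext (Subsingleton.elim _ _) hij]
      _ ≤ _ := sum_sq_unitCoeff_le hm _
  · rw [Real.mul_rpow (by positivity) hN0, ← Real.rpow_mul hV0, mul_assoc]
    congr 1
    · congr 1; ring
    · rcases hN0.eq_or_lt with h0 | h0
      · rw [← h0]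
        rcases eq_or_ne (2 * (1 / q.toReal)) 0 with h1 | h1
        · rw [h1]; simp
        · rw [Real.zero_rpow h1, mul_zero]
      · rw [← Real.rpow_add h0]; simp

lemma coeFn_fourierL2_linearCombination (f : L2R) (s : Finset ℤ) (c : ℤ → ℂ) :
    fourierL2 (Finsupp.linearCombination ℂ (fun i : Fin 1 × ℤ => l2Translate i.2 f)
      (singleCoeff s c)) =ᵐ[volume]
      fun ξ => (∑ n ∈ s, c n * phase (-(n * ξ))) * fourierL2 f ξ := by
  simp only [singleCoeff, map_sum, Finsupp.linearCombination_single, map_smul]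
  induction s using Finset.induction_on with
  | empty =>
    simp only [Finset.sum_empty, zero_mul]
    exact Lp.coeFn_zero _ _ _
  | insert n s hn ih =>
    rw [Finset.sum_insert hn]
    filter_upwards [ih, Lp.coeFn_add (c n • fourierL2 (l2Translate n f))
      (∑ n ∈ s, c n • fourierL2 (l2Translate n f)), Lp.coeFn_smul (c n) (fourierL2 (l2Translate n f)),
      fourierL2_l2Translate n f] with ξ h1 h2 h3 h4
    rw [h2, Pi.add_apply, h1, h3, Pi.smul_apply, h4, Finset.sum_insert hn, smul_eq_mul]
    ring

/-- Multiples `m g` of a bounded function `g` on the unit interval are approximated by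
trigonometric multiples, whose coefficients are controlled by the size of the support of `m`. -/
lemma exists_linearCombination_approx {q : ℝ≥0∞} (hq : 2 ≤ q) {f : L2R}
    (hf0 : ∀ᵐ x, x ∉ Set.Ioc (0 : ℝ) 1 → fourierL2 f x = 0) (hf1 : ∀ᵐ x, ‖fourierL2 f x‖ ≤ 1)
    {m : ℝ → ℂ} (hm : MemLp m 2 unitVolume) {B : Set ℝ} (hmB : ∀ x ∉ B, m x = 0) {H : L2R}
    (hH : fourierL2 H =ᵐ[volume] fun x => m x * fourierL2 f x) {ε : ℝ} (hε : 0 < ε) :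
    ∃ a : Fin 1 × ℤ →₀ ℂ,
      lqNorm q a ≤ (unitVolume.real B) ^ (1 / 2 - 1 / q.toReal) *
        (eLpNorm m 2 unitVolume).toReal ∧
      ‖H - Finsupp.linearCombination ℂ (fun i : Fin 1 × ℤ => l2Translate i.2 f) a‖ < ε := by
  obtain ⟨s, hs⟩ := exists_finset_unit_fourier hm hε
  refine ⟨singleCoeff s (unitCoeff m), lqNorm_singleCoeff_le hq s hm hmB, ?_⟩
  rw [← fourierL2.norm_map, ← ENNReal.ofReal_lt_ofReal_iff hε, ofReal_norm]
  refine lt_of_le_of_lt ?_ hs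
  -- Since `|f̂| ≤ 1` and `f̂` vanishes off `(0, 1]`, the error in approximating `m` on the unit
  -- interval dominates the error in `L²(ℝ)`.
  refine (ENNReal.pow_right_strictMono two_ne_zero).le_iff_le.1 ?_
  rw [enorm_sq_eq_lintegral, eLpNorm_two_sq, ← lintegral_indicator measurableSet_Ioc]
  refine lintegral_mono_ae ?_
  rw [map_sub]
  filter_upwards [hf0, hf1, hH, coeFn_fourierL2_linearCombination f s (unitCoeff m),
    Lp.coeFn_sub (fourierL2 H) (fourierL2 (Finsupp.linearCombination ℂ
      (fun i : Fin 1 × ℤ => l2Translate i.2 f) (singleCoeff s (unitCoeff m))))]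
    with x h0 h1 h2 h3 h4
  rw [h4, Pi.sub_apply, h2, h3, ← sub_mul, enorm_mul, mul_pow]
  by_cases hx : x ∈ Set.Ioc (0 : ℝ) 1
  · rw [Set.indicator_of_mem hx]
    refine mul_le_of_le_one_right' (pow_le_one' ?_ 2)
    rw [← ofReal_norm]
    exact ENNReal.ofReal_le_one.2 h1
  · rw [Set.indicator_of_notMem hx, h0 hx]
    simp

/-- With one generator, the fiber of `H` is a.e. a scalar multiple of the fiber of `f`. -/
lemma ae_eq_zero_of_mem_shiftInvariantSpace {f H : L2R}
    (hH : H ∈ shiftInvariantSpace (Set.range fun _ : Fin 1 => f)) :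
    ∀ᵐ x, fourierL2 f x = 0 → fourierL2 H x = 0 := by
  filter_upwards [ae_fiber_mem_span (fun _ : Fin 1 => f) hH] with x hx h0
  rw [Set.range_const, Submodule.mem_span_singleton] at hx
  obtain ⟨c, hc⟩ := hx
  have := congrFun hc 0
  simp only [fiber, Pi.smul_apply, Int.cast_zero, add_zero, smul_eq_mul, h0, mul_zero] at this
  exact this.symm

lemma coe_linearCombination_integerTranslates {K : ℕ} (F : Fin K → L2R) (a : Fin K × ℤ →₀ ℂ) :
    (Finsupp.linearCombination ℂ (integerTranslates F) a : L2R)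
      = Finsupp.linearCombination ℂ (fun i : Fin K × ℤ => l2Translate i.2 (F i.1)) a :=
  Finsupp.apply_linearCombination ℂ (shiftInvariantSpace (Set.range F)).subtype
    (integerTranslates F) a

lemma linearCombination_mem_shiftInvariantSpace {K : ℕ} (F : Fin K → L2R) (a : Fin K × ℤ →₀ ℂ) :
    Finsupp.linearCombination ℂ (fun i : Fin K × ℤ => l2Translate i.2 (F i.1)) a
      ∈ shiftInvariantSpace (Set.range F) := by
  rw [← coe_linearCombination_integerTranslates]
  exact Subtype.coe_prop _

lemma coeFn_finset_sum {κ : Type*} (s : Finset κ) (u : κ → L2R) :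
    (↑(∑ i ∈ s, u i) : ℝ → ℂ) =ᵐ[volume] fun x => ∑ i ∈ s, u i x := by
  classical
  induction s using Finset.induction_on with
  | empty =>
    simp only [Finset.sum_empty]
    exact Lp.coeFn_zero _ _ _
  | insert i s hi ih =>
    rw [Finset.sum_insert hi]
    filter_upwards [ih, Lp.coeFn_add (u i) (∑ j ∈ s, u j)] with x h1 h2
    rw [h2, Pi.add_apply, h1, Finset.sum_insert hi]

lemma tendsto_norm_sub_sum_indicator {h : ℝ → ℂ} (hh : MemLp h 2 volume) {B : ℕ → Set ℝ}
    (hB : ∀ i, MeasurableSet (B i)) (hd : Pairwise (Function.onFun Disjoint B))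
    (hcov : ∀ᵐ x, h x ≠ 0 → ∃ i, x ∈ B i) :
    Tendsto (fun n => ∫⁻ x, ‖h x - ∑ i ∈ Finset.range n, (B i).indicator h x‖ₑ ^ 2) atTop (𝓝 0) := by
  have hsum : ∀ n x, ∑ i ∈ Finset.range n, (B i).indicator h x = h x ∨
      (∑ i ∈ Finset.range n, (B i).indicator h x = 0 ∧ ∀ i < n, x ∉ B i) := by
    intro n x
    by_cases hx : ∃ i < n, x ∈ B i
    · obtain ⟨i, hi, hxi⟩ := hx
      left
      rw [Finset.sum_eq_single_of_mem i (Finset.mem_range.2 hi), Set.indicator_of_mem hxi]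
      intro j _ hji
      exact Set.indicator_of_notMem (fun hxj => Set.disjoint_left.1 (hd hji) hxj hxi) _
    · push Not at hx
      exact Or.inr ⟨Finset.sum_eq_zero fun i hi =>
        Set.indicator_of_notMem (hx i (Finset.mem_range.1 hi)) _, hx⟩
  have hfin : ∫⁻ x, ‖h x‖ₑ ^ 2 ≠ ∞ := by
    rw [← eLpNorm_two_sq]; exact ENNReal.pow_ne_top hh.2.ne
  have := tendsto_lintegral_of_dominated_convergence' (μ := volume)
    (F := fun n x => ‖h x - ∑ i ∈ Finset.range n, (B i).indicator h x‖ₑ ^ 2) (f := fun _ => 0)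
    (fun x => ‖h x‖ₑ ^ 2) (fun n => ?_) (fun n => Eventually.of_forall fun x => ?_) hfin ?_
  · simpa using this
  · exact (hh.1.sub (Finset.aestronglyMeasurable_fun_sum _ fun i _ =>
      hh.1.indicator (hB i))).enorm.pow_const 2
  · rcases hsum n x with h1 | ⟨h1, -⟩ <;> simp [h1]
  · filter_upwards [hcov] with x hx
    refine tendsto_const_nhds.congr' ?_
    by_cases h0 : h x = 0
    · refine Eventually.of_forall fun n => ?_
      rcases hsum n x with h1 | ⟨h1, -⟩ <;> simp [h1, h0]
    · obtain ⟨i, hi⟩ := hx h0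
      filter_upwards [eventually_gt_atTop i] with n hn
      rcases hsum n x with h1 | ⟨-, h1⟩
      · simp [h1]
      · exact absurd hi (h1 i hn)

/-- A criterion for the integer translates of `f` to be a `(C_q)`-system: the unit interval is
covered by pieces on which `f̂` is bounded below, with summable weights. -/
lemma isCqSystem_of_pieces {q : ℝ≥0∞} (hq : 2 ≤ q) {f : L2R}
    (hf0 : ∀ᵐ x, x ∉ Set.Ioc (0 : ℝ) 1 → fourierL2 f x = 0) (hf1 : ∀ᵐ x, ‖fourierL2 f x‖ ≤ 1)
    {B : ℕ → Set ℝ} (hB : ∀ i, MeasurableSet (B i)) (hd : Pairwise (Function.onFun Disjoint B))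
    (hcov : ∀ᵐ x, fourierL2 f x ≠ 0 → ∃ i, x ∈ B i) {c : ℕ → ℝ} (hc0 : ∀ i, 0 ≤ c i)
    (hc : ∀ i, ∀ᵐ x, x ∈ B i → 1 ≤ c i * ‖fourierL2 f x‖)
    (hsum : Summable fun i => (unitVolume.real (B i)) ^ (1 / 2 - 1 / q.toReal) * c i) :
    IsCqSystem q (integerTranslates fun _ : Fin 1 => f) := by
  set w : ℕ → ℝ := fun i => (unitVolume.real (B i)) ^ (1 / 2 - 1 / q.toReal) * c i with hw
  have hw0 : ∀ i, 0 ≤ w i := fun i =>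
    mul_nonneg (Real.rpow_nonneg measureReal_nonneg _) (hc0 i)
  refine ⟨∑' i, w i + 1, add_pos_of_nonneg_of_pos (tsum_nonneg hw0) one_pos, fun H ε hε => ?_⟩
  set h := fourierL2 (H : L2R) with hh
  have hsupp := ae_eq_zero_of_mem_shiftInvariantSpace H.2
  have hhL : MemLp h 2 volume := Lp.memLp _
  have hlim := tendsto_norm_sub_sum_indicator hhL hB hd (by
    filter_upwards [hsupp, hcov] with x h1 h2 h3
    exact h2 fun h4 => h3 (h1 h4))
  have hε2 : 0 < ENNReal.ofReal (ε / 2) ^ 2 := by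
    have : 0 < ε / 2 := by positivity
    exact ENNReal.pow_pos (ENNReal.ofReal_pos.2 this) 2
  obtain ⟨N, hN⟩ := (hlim.eventually (gt_mem_nhds hε2)).exists
  -- The target is cut in frequency along the sets `B i`. On each piece division by `f̂` costs at
  -- most `c i`, and the weights `w i` sum the resulting coefficient bounds.
  set P : ℕ → L2R := fun i => fourierL2.symm ((hhL.indicator (hB i)).toLp _) with hP
  have hPc : ∀ i, fourierL2 (P i) =ᵐ[volume] (B i).indicator h := fun i => by
    rw [hP, LinearIsometryEquiv.apply_symm_apply]
    exact (hhL.indicator (hB i)).coeFn_toLp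
  have htail : ‖(H : L2R) - ∑ i ∈ Finset.range N, P i‖ < ε / 2 := by
    rw [← fourierL2.norm_map, ← ENNReal.ofReal_lt_ofReal_iff (by positivity), ofReal_norm]
    refine (ENNReal.pow_right_strictMono two_ne_zero).lt_iff_lt.1 (lt_of_eq_of_lt ?_ hN)
    rw [enorm_sq_eq_lintegral, map_sub, map_sum]
    have hs : (↑(∑ i ∈ Finset.range N, fourierL2 (P i)) : ℝ → ℂ) =ᵐ[volume]
        fun x => ∑ i ∈ Finset.range N, (B i).indicator h x := by
      filter_upwards [coeFn_finset_sum (Finset.range N) fun i => fourierL2 (P i),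
        ae_all_iff.2 hPc] with x h1 h2
      rw [h1]
      exact Finset.sum_congr rfl fun i _ => h2 i
    refine lintegral_congr_ae ?_
    filter_upwards [hs, Lp.coeFn_sub (fourierL2 (H : L2R))
      (∑ i ∈ Finset.range N, fourierL2 (P i))] with x h1 h2
    rw [h2, Pi.sub_apply, h1]
  have hpiece : ∀ i, ∃ a : Fin 1 × ℤ →₀ ℂ, lqNorm q a ≤ w i * ‖H‖ ∧
      ‖P i - Finsupp.linearCombination ℂ (fun i : Fin 1 × ℤ => l2Translate i.2 f) a‖
        -- The `N` pieces together contribute at most `ε / 2`, matching the tail; the `+ 1` covers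
        -- `N = 0`.
        < ε / (2 * (N + 1)) := by
    intro i
    set m : ℝ → ℂ := (B i).indicator fun x => h x * (fourierL2 f x)⁻¹ with hm
    have hmeas : AEStronglyMeasurable m volume :=
      ((Lp.aestronglyMeasurable h).mul
        (Lp.aestronglyMeasurable (fourierL2 f)).inv₀).indicator (hB i)
    have hle : ∀ᵐ x, ‖m x‖ ≤ c i * ‖h x‖ := by
      filter_upwards [hc i] with x hx
      by_cases hxB : x ∈ B i
      · rw [hm, Set.indicator_of_mem hxB, norm_mul, norm_inv, mul_comm (c i)]
        have h1 := hx hxB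
        gcongr
        have h2 : 0 < ‖fourierL2 f x‖ := by
          by_contra h3
          have : ‖fourierL2 f x‖ = 0 := le_antisymm (not_lt.1 h3) (norm_nonneg _)
          rw [this, mul_zero] at h1
          linarith
        rw [inv_le_iff_one_le_mul₀ h2]
        exact h1
      · rw [hm, Set.indicator_of_notMem hxB, norm_zero]
        exact mul_nonneg (hc0 i) (norm_nonneg _)
    have hmL : MemLp m 2 volume := hhL.of_le_mul hmeas hle
    have hnorm : (eLpNorm m 2 unitVolume).toReal ≤ c i * ‖H‖ := by
      have h1 : eLpNorm m 2 unitVolume ≤ ENNReal.ofReal (c i) * eLpNorm h 2 volume :=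
        (eLpNorm_mono_measure _ Measure.restrict_le_self).trans
          (eLpNorm_le_mul_eLpNorm_of_ae_le_mul hle 2)
      have h2 := ENNReal.toReal_mono (ENNReal.mul_ne_top (by simp) hhL.2.ne) h1
      rwa [ENNReal.toReal_mul, ENNReal.toReal_ofReal (hc0 i), ← Lp.norm_def, hh,
        fourierL2.norm_map] at h2
    have hPm : fourierL2 (P i) =ᵐ[volume] fun x => m x * fourierL2 f x := by
      filter_upwards [hPc i, hsupp] with x h1 h2
      rw [h1]
      by_cases hxB : x ∈ B i
      · rw [hm, Set.indicator_of_mem hxB, Set.indicator_of_mem hxB]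
        by_cases h0 : fourierL2 f x = 0
        · rw [h0, mul_zero]; exact h2 h0
        · rw [inv_mul_cancel_right₀ h0]
      · rw [hm, Set.indicator_of_notMem hxB, Set.indicator_of_notMem hxB, zero_mul]
    obtain ⟨a, ha, ha2⟩ := exists_linearCombination_approx hq hf0 hf1 (hmL.restrict _)
      (fun x hx => Set.indicator_of_notMem hx _) hPm (ε := ε / (2 * (N + 1))) (by positivity)
    refine ⟨a, ha.trans ?_, ha2⟩
    rw [hw, mul_assoc]
    exact mul_le_mul_of_nonneg_left hnorm (Real.rpow_nonneg measureReal_nonneg _)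
  choose a ha ha2 using hpiece
  refine ⟨∑ i ∈ Finset.range N, a i, ?_, ?_⟩
  · refine (lqNorm_sum_le (one_le_two.trans hq) _ _).trans ?_
    refine (Finset.sum_le_sum fun i _ => ha i).trans ?_
    rw [← Finset.sum_mul]
    refine mul_le_mul_of_nonneg_right ?_ (norm_nonneg _)
    linarith [hsum.sum_le_tsum (Finset.range N) fun i _ => hw0 i]
  · rw [Submodule.coe_norm, Submodule.coe_sub, coe_linearCombination_integerTranslates, map_sum]
    have e : (H : L2R) - ∑ i ∈ Finset.range N, Finsupp.linearCombination ℂ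
          (fun i : Fin 1 × ℤ => l2Translate i.2 f) (a i)
        = ((H : L2R) - ∑ i ∈ Finset.range N, P i) + ∑ i ∈ Finset.range N,
          (P i - Finsupp.linearCombination ℂ (fun i : Fin 1 × ℤ => l2Translate i.2 f) (a i)) := by
      rw [Finset.sum_sub_distrib]; abel
    rw [e]
    have h1 : ‖∑ i ∈ Finset.range N, (P i - Finsupp.linearCombination ℂ
        (fun i : Fin 1 × ℤ => l2Translate i.2 f) (a i))‖ ≤ ε / 2 := by
      refine (norm_sum_le _ _).trans ((Finset.sum_le_sum fun i _ => (ha2 i).le).trans ?_)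
      rw [Finset.sum_const, Finset.card_range, nsmul_eq_mul, mul_div_assoc', div_le_div_iff₀
        (by positivity) (by positivity)]
      nlinarith
    linarith [norm_add_le ((H : L2R) - ∑ i ∈ Finset.range N, P i) (∑ i ∈ Finset.range N,
      (P i - Finsupp.linearCombination ℂ (fun i : Fin 1 × ℤ => l2Translate i.2 f) (a i)))]

lemma IsCqSystem.isCompleteSystem {ι H : Type*} [NormedAddCommGroup H] [InnerProductSpace ℂ H]
    {q : ℝ≥0∞} {g : ι → H} (hg : IsCqSystem q g) : IsCompleteSystem g := by
  obtain ⟨C, -, h⟩ := hg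
  refine eq_top_iff.2 fun f _ => Metric.mem_closure_iff.2 fun ε hε => ?_
  obtain ⟨a, -, ha⟩ := h f ε hε
  refine ⟨_, ?_, by rwa [dist_eq_norm]⟩
  rw [← Finsupp.range_linearCombination]
  exact LinearMap.mem_range_self _ a

/-- Invariance under all translations, for `f` with a bounded Fourier transform supported on the
unit interval. -/
lemma l2Translate_mem_of_support {f : L2R}
    (hf0 : ∀ᵐ x, x ∉ Set.Ioc (0 : ℝ) 1 → fourierL2 f x = 0) (hf1 : ∀ᵐ x, ‖fourierL2 f x‖ ≤ 1)
    (γ : ℝ) {H : L2R} (hH : H ∈ shiftInvariantSpace (Set.range fun _ : Fin 1 => f)) :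
    l2Translate γ H ∈ shiftInvariantSpace (Set.range fun _ : Fin 1 => f) := by
  refine l2Translate_mem_of_forall ?_ hH
  rintro _ ⟨-, rfl⟩ n
  rw [l2Translate_comm]
  refine l2Translate_int_mem ?_ n
  have hcl := isClosed_shiftInvariantSpace (Set.range fun _ : Fin 1 => f)
  refine SetLike.mem_coe.1 (hcl.closure_eq ▸ Metric.mem_closure_iff.2 fun ε hε => ?_)
  have hm : MemLp (fun x => phase (-(γ * x))) 2 unitVolume :=
    MemLp.of_bound (continuous_phase.comp (by fun_prop)).aestronglyMeasurable 1
      (Eventually.of_forall fun x => (norm_phase _).le)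
  -- On the unit interval the modulation by `γ` is itself a bounded multiplier, hence approximable
  -- by trigonometric polynomials. Only the approximation matters, so the exponent is `2` and the
  -- coefficient bound is dropped.
  obtain ⟨a, -, ha⟩ := exists_linearCombination_approx le_rfl hf0 hf1 hm (B := Set.univ) (by simp)
    (fourierL2_l2Translate γ f) hε
  exact ⟨_, linearCombination_mem_shiftInvariantSpace (fun _ : Fin 1 => f) a,
    by rwa [dist_eq_norm]⟩

lemma TranslatesBiorthogonal.isMinimalSystem {K : ℕ} {F h : Fin K → L2R}
    (hFh : TranslatesBiorthogonal F h) : IsMinimalSystem (integerTranslates F) := by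
  rintro ⟨k, n⟩ hmem
  set φ : shiftInvariantSpace (Set.range F) →L[ℂ] ℂ :=
    (innerSL ℂ (l2Translate n (h k))).comp (shiftInvariantSpace (Set.range F)).subtypeL with hφ
  have hφv : ∀ i : Fin K × ℤ, φ (integerTranslates F i) = if i.1 = k ∧ i.2 = n then 1 else 0 := by
    intro i
    change inner ℂ (l2Translate n (h k)) (l2Translate (i.2 : ℝ) (F i.1)) = _
    rw [← inner_conj_symm, hFh.inner_l2Translate i.1 k i.2 n]
    split_ifs <;> simp
  have hle : (Submodule.span ℂ (integerTranslates F '' {(k, n)}ᶜ)).topologicalClosure ≤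
      LinearMap.ker φ.toLinearMap := by
    refine Submodule.topologicalClosure_minimal _ (Submodule.span_le.2 ?_) φ.isClosed_ker
    rintro _ ⟨i, hi, rfl⟩
    change φ _ = 0
    rw [hφv, if_neg]
    rintro ⟨h1, h2⟩
    exact hi (Prod.ext h1 h2)
  have h0 : φ (integerTranslates F (k, n)) = 0 := hle hmem
  rw [hφv] at h0
  simp at h0

/-! ### Powers of the distance to the boundary of the unit interval -/

/-- The distance to the boundary for points of `(0, 1)`; non-positive elsewhere. -/
noncomputable def edgeDist (x : ℝ) : ℝ := min x (1 - x)

/-- The power `d(x)^r` on `(0, 1)`, extended by zero. -/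
noncomputable def edgePow (r x : ℝ) : ℝ := if 0 < edgeDist x then edgeDist x ^ r else 0

lemma edgeDist_pos_iff {x : ℝ} : 0 < edgeDist x ↔ x ∈ Set.Ioo (0 : ℝ) 1 := by
  rw [edgeDist, lt_min_iff, sub_pos, Set.mem_Ioo]

lemma edgeDist_le_one (x : ℝ) : edgeDist x ≤ 1 := by
  rcases le_total x 1 with h | h
  · exact (min_le_left _ _).trans h
  · exact (min_le_right _ _).trans (by linarith)

lemma continuous_edgeDist : Continuous edgeDist := by unfold edgeDist; fun_prop

lemma edgeDist_sub_le (x y : ℝ) : edgeDist x - edgeDist y ≤ |x - y| := by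
  have h1 : x - y ≤ |x - y| := le_abs_self _
  have h2 : -(x - y) ≤ |x - y| := neg_le_abs _
  rw [sub_le_iff_le_add, edgeDist, edgeDist, ← min_add_add_left]
  exact min_le_min (by linarith) (by linarith)

lemma edgePow_nonneg (r x : ℝ) : 0 ≤ edgePow r x := by
  unfold edgePow
  split_ifs with h
  · positivity
  · exact le_rfl

lemma edgePow_of_notMem {r x : ℝ} (hx : x ∉ Set.Ioo (0 : ℝ) 1) : edgePow r x = 0 :=
  if_neg fun h => hx (edgeDist_pos_iff.1 h)

lemma edgePow_le_one {r : ℝ} (hr : 0 ≤ r) (x : ℝ) : edgePow r x ≤ 1 := by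
  unfold edgePow
  split_ifs with h
  · exact Real.rpow_le_one h.le (edgeDist_le_one x) hr
  · exact zero_le_one

lemma edgePow_mul_edgePow_neg {r x : ℝ} (hx : x ∈ Set.Ioo (0 : ℝ) 1) :
    edgePow r x * edgePow (-r) x = 1 := by
  have h := edgeDist_pos_iff.2 hx
  rw [edgePow, edgePow, if_pos h, if_pos h, ← Real.rpow_add h, add_neg_cancel, Real.rpow_zero]

lemma edgePow_sq (r x : ℝ) : edgePow r x ^ 2 = edgePow (2 * r) x := by
  unfold edgePow
  split_ifs with h
  · rw [← Real.rpow_natCast, ← Real.rpow_mul h.le, mul_comm]; norm_num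
  · simp

lemma measurable_edgePow (r : ℝ) : Measurable (edgePow r) :=
  Measurable.ite (measurableSet_lt measurable_const continuous_edgeDist.measurable)
    (continuous_edgeDist.measurable.pow_const r) measurable_const

lemma integrable_edgePow {r : ℝ} (hr : -1 < r) : Integrable (edgePow r) := by
  have h1 : IntegrableOn (fun x : ℝ => x ^ r) (Set.Ioo 0 1) :=
    ((intervalIntegrable_iff_integrableOn_Ioo_of_le zero_le_one).1
      (intervalIntegral.intervalIntegrable_rpow' hr))
  have h2 : IntegrableOn (fun x : ℝ => (1 - x) ^ r) (Set.Ioo 0 1) := by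
    have := (intervalIntegral.intervalIntegrable_rpow' (a := 0) (b := 1) hr).comp_sub_left 1
    rw [sub_zero, sub_self] at this
    exact (intervalIntegrable_iff_integrableOn_Ioo_of_le zero_le_one).1 this.symm
  have h3 : Integrable ((Set.Ioo (0 : ℝ) 1).indicator fun x => x ^ r + (1 - x) ^ r) :=
    (integrable_indicator_iff measurableSet_Ioo).2 (h1.add h2)
  refine h3.mono' (measurable_edgePow r).aestronglyMeasurable (Eventually.of_forall fun x => ?_)
  rw [Real.norm_of_nonneg (edgePow_nonneg r x)]
  by_cases hx : x ∈ Set.Ioo (0 : ℝ) 1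
  · rw [Set.indicator_of_mem hx, edgePow, if_pos (edgeDist_pos_iff.2 hx)]
    have a1 : 0 ≤ x ^ r := Real.rpow_nonneg hx.1.le r
    have a2 : 0 ≤ (1 - x) ^ r := Real.rpow_nonneg (by linarith [hx.2]) r
    rcases min_choice x (1 - x) with h | h <;> rw [edgeDist, h] <;> linarith
  · rw [Set.indicator_of_notMem hx, edgePow_of_notMem hx]

lemma lintegral_edgePow_sq_lt_top {r : ℝ} (hr : -1 < 2 * r) :
    ∫⁻ x, ENNReal.ofReal (edgePow r x) ^ 2 < ∞ := by
  have h := (integrable_edgePow hr).lintegral_lt_top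
  refine lt_of_eq_of_lt (lintegral_congr fun x => ?_) h
  rw [← ENNReal.ofReal_pow (edgePow_nonneg r x), edgePow_sq]

lemma memLp_edgePow {r : ℝ} (hr : -1 < 2 * r) : MemLp (fun x => (edgePow r x : ℂ)) 2 volume := by
  refine ⟨(Complex.measurable_ofReal.comp (measurable_edgePow r)).aestronglyMeasurable, ?_⟩
  have h : eLpNorm (fun x => (edgePow r x : ℂ)) 2 volume ^ 2 < ∞ := by
    rw [eLpNorm_two_sq]
    refine lt_of_eq_of_lt (lintegral_congr fun x => ?_) (lintegral_edgePow_sq_lt_top hr)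
    rw [← ofReal_norm, Complex.norm_of_nonneg (edgePow_nonneg r x)]
  exact (ENNReal.pow_lt_top_iff.1 h).resolve_right two_ne_zero

/-- Smoothness of order `β` beyond `α` is bought with the singular weight `d^(α - β)`. For `a ≥ b >
0` one has `a^α - b^α ≤ (a^β - b^β) b^(α - β)`, and subadditivity of the power `β ≤ 1` bounds `a^β -
b^β` by `(a - b)^β`. -/
lemma edgePow_sub_le {α β : ℝ} (hα : 0 ≤ α) (hαβ : α ≤ β) (hβ : β ≤ 1) (x y : ℝ)
    (hxy : edgeDist y ≤ edgeDist x) : |edgePow α x - edgePow α y| ≤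
      |x - y| ^ β * (edgePow (α - β) x + edgePow (α - β) y) := by
  have hβ0 : 0 ≤ β := hα.trans hαβ
  have hp : 0 ≤ |x - y| ^ β := by positivity
  have hle := edgeDist_sub_le x y
  by_cases hx : 0 < edgeDist x
  · by_cases hy : 0 < edgeDist y
    · simp only [edgePow, if_pos hx, if_pos hy]
      set a := edgeDist x
      set b := edgeDist y
      have hba : b ^ α ≤ a ^ α := Real.rpow_le_rpow hy.le hxy hα
      rw [abs_of_nonneg (by linarith)]
      have e1 : a ^ α = a ^ β * a ^ (α - β) := by rw [← Real.rpow_add hx]; congr 1; ring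
      have e2 : b ^ α = b ^ β * b ^ (α - β) := by rw [← Real.rpow_add hy]; congr 1; ring
      have h1 : a ^ (α - β) ≤ b ^ (α - β) :=
        Real.rpow_le_rpow_of_nonpos hy hxy (by linarith)
      have h2 : a ^ β ≤ (a - b) ^ β + b ^ β := by
        have := Real.rpow_add_le_add_rpow (sub_nonneg.2 hxy) hy.le hβ0 hβ
        rwa [sub_add_cancel] at this
      have h3 : (a - b) ^ β ≤ |x - y| ^ β := Real.rpow_le_rpow (sub_nonneg.2 hxy) hle hβ0
      have p1 : 0 < a ^ (α - β) := Real.rpow_pos_of_pos hx _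
      have p2 : 0 < b ^ (α - β) := Real.rpow_pos_of_pos hy _
      have p3 : 0 < a ^ β := Real.rpow_pos_of_pos hx _
      rw [e1, e2]
      calc a ^ β * a ^ (α - β) - b ^ β * b ^ (α - β)
          ≤ a ^ β * b ^ (α - β) - b ^ β * b ^ (α - β) := by gcongr
        _ = (a ^ β - b ^ β) * b ^ (α - β) := by ring
        _ ≤ |x - y| ^ β * b ^ (α - β) := by gcongr; linarith
        _ ≤ _ := by gcongr; linarith
    -- Here `y` is outside `(0, 1)`, so the distance from `x` to the boundary is at most `|x - y|`.
    · simp only [edgePow, if_pos hx, if_neg hy, sub_zero, add_zero]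
      rw [abs_of_nonneg (by positivity)]
      have e1 : edgeDist x ^ α = edgeDist x ^ β * edgeDist x ^ (α - β) := by
        rw [← Real.rpow_add hx]; congr 1; ring
      rw [e1]
      gcongr
      linarith
  · have hy : ¬ 0 < edgeDist y := by linarith
    simp only [edgePow, if_neg hx, if_neg hy]
    simp

lemma abs_edgePow_sub_le {α β : ℝ} (hα : 0 ≤ α) (hαβ : α ≤ β) (hβ : β ≤ 1) (x y : ℝ) :
    |edgePow α x - edgePow α y| ≤ |x - y| ^ β * (edgePow (α - β) x + edgePow (α - β) y) := by
  rcases le_total (edgeDist y) (edgeDist x) with h | h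
  · exact edgePow_sub_le hα hαβ hβ x y h
  · rw [abs_sub_comm, abs_sub_comm x, add_comm]
    exact edgePow_sub_le hα hαβ hβ y x h

/-! ### Moments and the modulus of continuity of the Fourier transform -/

lemma one_le_norm_phase_sub_one_sq {u : ℝ} (h1 : 1 / 4 ≤ |u|) (h2 : |u| ≤ 1 / 2) :
    1 ≤ ‖phase u - 1‖ ^ 2 := by
  rw [norm_phase_sub_one_sq, ← sq_abs (Real.sin _)]
  have h4 : 1 / 2 ≤ |Real.sin (π * u)| := by
    have e : |Real.sin (π * u)| = Real.sin (π * |u|) := by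
      rcases abs_cases u with ⟨e, h⟩ | ⟨e, h⟩
      · rw [e, abs_of_nonneg]
        exact Real.sin_nonneg_of_nonneg_of_le_pi (by positivity) (by nlinarith [pi_pos])
      · rw [e, mul_neg, Real.sin_neg, abs_of_nonpos]
        exact Real.sin_nonpos_of_nonpos_of_neg_pi_le (by nlinarith [pi_pos])
          (by nlinarith [pi_pos])
    rw [e]
    have := Real.mul_le_sin (x := π * |u|) (by positivity) (by nlinarith [pi_pos])
    have e2 : 2 / π * (π * |u|) = 2 * |u| := by field_simp
    rw [e2] at this
    linarith
  nlinarith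

/-- If `2^n ≤ |x| < 2^(n+1)`, the step `2^(-(n+2))` puts the argument in `[1/4, 1/2]`, where the
character is at distance at least `1` from `1`. A single term of the series thus dominates; the
summand `1` handles `|x| ≤ 1`. -/
lemma ofReal_rpow_abs_le_tsum {t : ℝ} (ht : 0 ≤ t) (x : ℝ) :
    ENNReal.ofReal (|x| ^ t) ≤ 1 + ∑' n : ℕ, ENNReal.ofReal ((2 ^ (n + 1) : ℝ) ^ t) *
      ‖phase ((2 ^ (n + 2) : ℝ)⁻¹ * x) - 1‖ₑ ^ 2 := by
  rcases le_total |x| 1 with hx | hx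
  · exact (ENNReal.ofReal_le_one.2 (Real.rpow_le_one (abs_nonneg _) hx ht)).trans le_self_add
  · obtain ⟨n, hn1, hn2⟩ := exists_nat_pow_near hx (one_lt_two (α := ℝ))
    refine le_trans ?_ (le_trans (ENNReal.le_tsum n) le_add_self)
    have h1 : 1 ≤ ‖phase ((2 ^ (n + 2) : ℝ)⁻¹ * x) - 1‖ ^ 2 := by
      refine one_le_norm_phase_sub_one_sq ?_ ?_ <;>
        rw [abs_mul, abs_inv, abs_of_pos (by positivity : (0 : ℝ) < 2 ^ (n + 2)), inv_mul_eq_div]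
      · rw [le_div_iff₀ (by positivity)]
        calc 1 / 4 * (2 : ℝ) ^ (n + 2) = 2 ^ n := by ring
          _ ≤ |x| := hn1
      · rw [div_le_iff₀ (by positivity)]
        calc |x| ≤ (2 : ℝ) ^ (n + 1) := hn2.le
          _ = _ := by ring
    have h2 : (1 : ℝ≥0∞) ≤ ‖phase ((2 ^ (n + 2) : ℝ)⁻¹ * x) - 1‖ₑ ^ 2 := by
      rw [← ofReal_norm, ← ENNReal.ofReal_pow (norm_nonneg _)]
      exact ENNReal.one_le_ofReal.2 h1
    calc ENNReal.ofReal (|x| ^ t) ≤ ENNReal.ofReal ((2 ^ (n + 1) : ℝ) ^ t) * 1 := by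
          rw [mul_one]
          exact ENNReal.ofReal_le_ofReal (Real.rpow_le_rpow (abs_nonneg _) hn2.le ht)
      _ ≤ _ := by gcongr

/-- A function whose Fourier transform is `L²`-Hölder continuous of order `β` has finite moments
of all orders below `2 β`. -/
lemma moment_lt_top_of_modulus {t β : ℝ} (ht : 0 ≤ t) (htβ : t < 2 * β) {f : L2R} {C : ℝ≥0∞}
    (hC : C ≠ ∞) (h : ∀ a : ℝ, 0 < a →
      ‖l2Translate a (fourierL2 f) - fourierL2 f‖ₑ ^ 2 ≤ C * ENNReal.ofReal (a ^ (2 * β))) :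
    moment t f < ∞ := by
  have hmeas : AEMeasurable (fun x => ‖f x‖ₑ ^ 2) volume :=
    (Lp.aestronglyMeasurable f).enorm.pow_const 2
  have hph : ∀ n : ℕ, Measurable fun x => ‖phase ((2 ^ (n + 2) : ℝ)⁻¹ * x) - 1‖ₑ ^ 2 := fun n =>
    (((continuous_phase.comp (by fun_prop)).sub continuous_const).measurable.enorm).pow_const 2
  rw [moment_eq]
  have hle : ∫⁻ x, ENNReal.ofReal (|x| ^ t) * ‖f x‖ₑ ^ 2 ≤
      ‖f‖ₑ ^ 2 + ∑' n : ℕ, ENNReal.ofReal ((2 ^ (n + 1) : ℝ) ^ t) *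
        ‖l2Translate (2 ^ (n + 2) : ℝ)⁻¹ (fourierL2 f) - fourierL2 f‖ₑ ^ 2 := by
    calc ∫⁻ x, ENNReal.ofReal (|x| ^ t) * ‖f x‖ₑ ^ 2
        ≤ ∫⁻ x, (‖f x‖ₑ ^ 2 + ∑' n : ℕ, ENNReal.ofReal ((2 ^ (n + 1) : ℝ) ^ t) *
          (‖phase ((2 ^ (n + 2) : ℝ)⁻¹ * x) - 1‖ₑ ^ 2 * ‖f x‖ₑ ^ 2)) := by
          refine lintegral_mono fun x => ?_
          refine (mul_le_mul_left (ofReal_rpow_abs_le_tsum ht x) _).trans (le_of_eq ?_)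
          rw [add_mul, one_mul, ← ENNReal.tsum_mul_right]
          simp only [mul_assoc]
      _ = _ := by
          rw [lintegral_add_left' hmeas, enorm_sq_eq_lintegral]
          congr 1
          refine (lintegral_tsum fun n => ((hph n).aemeasurable.mul hmeas).const_mul _).trans
            (tsum_congr fun n => ?_)
          rw [enorm_sq_l2Translate_fourierL2_sub, ← lintegral_const_mul' _ _ (by simp)]
          rfl
  refine lt_of_le_of_lt hle (ENNReal.add_lt_top.2 ⟨by finiteness, ?_⟩)
  -- Each dyadic scale gains `2^t` from the weight and loses `2^(2β)` from the modulus of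
  -- continuity, so the series is geometric with ratio below `1`.
  set r : ℝ := 2 ^ (t - 2 * β) with hr
  have hr0 : 0 < r := by positivity
  have hr1 : r < 1 := Real.rpow_lt_one_of_one_lt_of_neg one_lt_two (by linarith)
  have hterm : ∀ n : ℕ, ENNReal.ofReal ((2 ^ (n + 1) : ℝ) ^ t) *
      ‖l2Translate (2 ^ (n + 2) : ℝ)⁻¹ (fourierL2 f) - fourierL2 f‖ₑ ^ 2 ≤
      C * ENNReal.ofReal (2 ^ (t - 4 * β) * r ^ n) := by
    intro n
    have e : (2 ^ (n + 1) : ℝ) ^ t * ((2 ^ (n + 2) : ℝ)⁻¹) ^ (2 * β) = 2 ^ (t - 4 * β) * r ^ n := by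
      rw [hr, ← Real.rpow_natCast, ← Real.rpow_natCast, ← Real.rpow_natCast, ← Real.rpow_neg (by norm_num),
        ← Real.rpow_mul (by norm_num), ← Real.rpow_mul (by norm_num), ← Real.rpow_mul (by norm_num),
        ← Real.rpow_add (by norm_num), ← Real.rpow_add (by norm_num)]
      congr 1
      push_cast
      ring
    calc _ ≤ ENNReal.ofReal ((2 ^ (n + 1) : ℝ) ^ t) *
          (C * ENNReal.ofReal (((2 ^ (n + 2) : ℝ)⁻¹) ^ (2 * β))) := by
          gcongr
          exact h _ (by positivity)
      _ = _ := by
          rw [mul_left_comm, ← ENNReal.ofReal_mul (by positivity), e]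
  refine lt_of_le_of_lt (ENNReal.tsum_le_tsum hterm) ?_
  rw [ENNReal.tsum_mul_left]
  refine ENNReal.mul_lt_top hC.lt_top (lt_of_eq_of_lt
    (ENNReal.ofReal_tsum_of_nonneg (fun n => by positivity) ?_).symm ENNReal.ofReal_lt_top)
  exact (summable_geometric_of_lt_one hr0.le hr1).mul_left _

/-- Squares and integrates the pointwise Hölder bound. The factor `4` is `2` from the square of a
sum, times two terms with equal integrals by translation invariance. -/
lemma enorm_sq_l2Translate_sub_le_of_edgePow {α β : ℝ} (hα : 0 ≤ α) (hαβ : α ≤ β) (hβ : β ≤ 1)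
    {G : L2R} (hG : G =ᵐ[volume] fun x => (edgePow α x : ℂ)) {a : ℝ} (ha : 0 < a) :
    ‖l2Translate a G - G‖ₑ ^ 2 ≤ 4 * (∫⁻ x, ENNReal.ofReal (edgePow (α - β) x) ^ 2) *
      ENNReal.ofReal (a ^ (2 * β)) := by
  set k : ℝ → ℝ≥0∞ := fun x => ENNReal.ofReal (edgePow (α - β) x) ^ 2 with hk
  have hkm : Measurable k := (measurable_edgePow _).ennreal_ofReal.pow_const 2
  have hpt : ∀ x, ‖((edgePow α (x - a) : ℂ) - edgePow α x)‖ₑ ^ 2 ≤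
      ENNReal.ofReal (a ^ (2 * β)) * (2 * (k (x - a) + k x)) := by
    intro x
    have n1 := edgePow_nonneg (α - β) (x - a)
    have n2 := edgePow_nonneg (α - β) x
    simp only [hk]
    rw [← ENNReal.ofReal_pow n1, ← ENNReal.ofReal_pow n2,
      ← ENNReal.ofReal_add (by positivity) (by positivity),
      show (2 : ℝ≥0∞) = ENNReal.ofReal 2 by simp, ← ENNReal.ofReal_mul (by norm_num),
      ← ENNReal.ofReal_mul (by positivity), ← ofReal_norm, ← ENNReal.ofReal_pow (norm_nonneg _)]
    refine ENNReal.ofReal_le_ofReal ?_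
    rw [← Complex.ofReal_sub, Complex.norm_real, Real.norm_eq_abs]
    have h1 := abs_edgePow_sub_le hα hαβ hβ (x - a) x
    have e : |x - a - x| = a := by rw [sub_sub_cancel_left, abs_neg, abs_of_pos ha]
    rw [e] at h1
    have e2 : a ^ (2 * β) = (a ^ β) ^ 2 := by
      rw [← Real.rpow_natCast, ← Real.rpow_mul ha.le, mul_comm]; norm_num
    calc _ ≤ (a ^ β * (edgePow (α - β) (x - a) + edgePow (α - β) x)) ^ 2 := by gcongr
      _ = (a ^ β) ^ 2 * (edgePow (α - β) (x - a) + edgePow (α - β) x) ^ 2 := mul_pow _ _ _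
      _ ≤ _ := by
          rw [e2]
          gcongr
          nlinarith [sq_nonneg (edgePow (α - β) (x - a) - edgePow (α - β) x)]
  rw [enorm_sq_eq_lintegral]
  calc _ = ∫⁻ x, ‖((edgePow α (x - a) : ℂ) - edgePow α x)‖ₑ ^ 2 := by
        refine lintegral_congr_ae ?_
        filter_upwards [Lp.coeFn_sub (l2Translate a G) G, l2Translate_coeFn a G, hG,
          ae_comp_sub hG a] with x h1 h2 h3 h4
        rw [h1, Pi.sub_apply, h2, h3, h4]
    _ ≤ ∫⁻ x, ENNReal.ofReal (a ^ (2 * β)) * (2 * (k (x - a) + k x)) := lintegral_mono hpt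
    _ = ENNReal.ofReal (a ^ (2 * β)) * (2 * ((∫⁻ x, k x) + ∫⁻ x, k x)) := by
        rw [lintegral_const_mul' _ _ (by simp), lintegral_const_mul' _ _ (by simp),
          lintegral_add_right _ hkm, lintegral_sub_right_eq_self k a]
    _ = _ := by ring

/-- The function whose Fourier transform is `d(x)^α` on `(0, 1)`, for `-1 < 2 α`. -/
noncomputable def edgeGenerator {α : ℝ} (hα : -1 < 2 * α) : L2R :=
  fourierL2.symm ((memLp_edgePow hα).toLp _)

lemma coeFn_fourierL2_edgeGenerator {α : ℝ} (hα : -1 < 2 * α) :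
    fourierL2 (edgeGenerator hα) =ᵐ[volume] fun x => (edgePow α x : ℂ) := by
  rw [edgeGenerator, LinearIsometryEquiv.apply_symm_apply]
  exact (memLp_edgePow hα).coeFn_toLp

/-- The product `d^α d^(-α)` is the indicator of `(0, 1)`, so the inner products are integrals of
characters over one period. -/
lemma translatesBiorthogonal_edgeGenerator {α : ℝ} (hα : -1 < 2 * α) (hα' : -1 < 2 * -α) :
    TranslatesBiorthogonal (fun _ : Fin 1 => edgeGenerator hα)
      fun _ : Fin 1 => edgeGenerator hα' := by
  intro j k n
  have h := inner_eq_integral_fourierL2 (edgeGenerator hα) (edgeGenerator hα') (-n)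
  rw [neg_neg] at h
  rw [← h, Subsingleton.elim j k]
  have e : ∫ ξ, phase ((-n : ℤ) * ξ) * (fourierL2 (edgeGenerator hα) ξ *
      conj (fourierL2 (edgeGenerator hα') ξ)) = ∫ x in Set.Ioc (0 : ℝ) 1, phase ((-n : ℤ) * x) := by
    rw [← integral_indicator measurableSet_Ioc]
    refine integral_congr_ae ?_
    have h1 : ∀ᵐ x : ℝ, x ≠ 1 := by simp [ae_iff]
    filter_upwards [coeFn_fourierL2_edgeGenerator hα, coeFn_fourierL2_edgeGenerator hα', h1]
      with x hx hx' hx1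
    rw [hx, hx', Complex.conj_ofReal, ← Complex.ofReal_mul]
    by_cases hx2 : x ∈ Set.Ioc (0 : ℝ) 1
    · rw [edgePow_mul_edgePow_neg ⟨hx2.1, lt_of_le_of_ne hx2.2 hx1⟩, Set.indicator_of_mem hx2]
      simp
    · rw [edgePow_of_notMem fun h => hx2 (Set.Ioo_subset_Ioc_self h), Set.indicator_of_notMem hx2]
      simp
  rw [e, setIntegral_phase_int_mul]
  simp

lemma fourierL2_edgeGenerator_eq_zero {α : ℝ} (hα : -1 < 2 * α) :
    ∀ᵐ x, x ∉ Set.Ioc (0 : ℝ) 1 → fourierL2 (edgeGenerator hα) x = 0 := by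
  filter_upwards [coeFn_fourierL2_edgeGenerator hα] with x hx hx2
  rw [hx, edgePow_of_notMem fun h => hx2 (Set.Ioo_subset_Ioc_self h), Complex.ofReal_zero]

lemma norm_fourierL2_edgeGenerator_le {α : ℝ} (hα : -1 < 2 * α) (hα0 : 0 ≤ α) :
    ∀ᵐ x, ‖fourierL2 (edgeGenerator hα) x‖ ≤ 1 := by
  filter_upwards [coeFn_fourierL2_edgeGenerator hα] with x hx
  rw [hx, Complex.norm_of_nonneg (edgePow_nonneg α x)]
  exact edgePow_le_one hα0 x

/-- The points of `(0, 1)` at distance between `2^(-i-1)` and `2^(-i)` from the boundary. -/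
def dyadicEdge (i : ℕ) : Set ℝ := {x | (1 / 2) ^ (i + 1) < edgeDist x ∧ edgeDist x ≤ (1 / 2) ^ i}

lemma measurableSet_dyadicEdge (i : ℕ) : MeasurableSet (dyadicEdge i) :=
  (measurableSet_lt measurable_const continuous_edgeDist.measurable).inter
    (measurableSet_le continuous_edgeDist.measurable measurable_const)

lemma pairwise_disjoint_dyadicEdge : Pairwise (Function.onFun Disjoint dyadicEdge) := by
  refine (pairwise_disjoint_on _).2 fun i j hij => Set.disjoint_left.2 fun x hi hj => ?_
  have : (1 / 2 : ℝ) ^ j ≤ (1 / 2) ^ (i + 1) :=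
    pow_le_pow_of_le_one (by norm_num) (by norm_num) hij
  linarith [hi.1, hj.2]

lemma exists_mem_dyadicEdge {x : ℝ} (hx : 0 < edgeDist x) : ∃ i, x ∈ dyadicEdge i := by
  obtain ⟨n, h1, h2⟩ := exists_nat_pow_near_of_lt_one hx (edgeDist_le_one x)
    (by norm_num : (0 : ℝ) < 1 / 2) (by norm_num)
  exact ⟨n, h1, h2⟩

lemma unitVolume_dyadicEdge_le (i : ℕ) : unitVolume.real (dyadicEdge i) ≤ 2 * (1 / 2) ^ i := by
  have hs : dyadicEdge i ⊆ Set.Icc 0 ((1 / 2) ^ i) ∪ Set.Icc (1 - (1 / 2) ^ i) 1 := by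
    rintro x ⟨h1, h2⟩
    have h3 : 0 < edgeDist x := lt_trans (by positivity) h1
    have h4 := edgeDist_pos_iff.1 h3
    rcases min_le_iff.1 h2 with h5 | h5
    · exact Or.inl ⟨h4.1.le, h5⟩
    · exact Or.inr ⟨by linarith, h4.2.le⟩
  have h1 : unitVolume.real (dyadicEdge i) ≤ volume.real
      (Set.Icc 0 ((1 / 2) ^ i) ∪ Set.Icc (1 - (1 / 2) ^ i) (1 : ℝ)) :=
    ENNReal.toReal_mono (isCompact_Icc.union isCompact_Icc).measure_lt_top.ne
      ((Measure.restrict_le_self _).trans (measure_mono hs))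
  refine h1.trans ((measureReal_union_le _ _).trans (le_of_eq ?_))
  rw [Real.volume_real_Icc_of_le (by positivity), Real.volume_real_Icc_of_le]
  · ring
  · have : (0 : ℝ) ≤ (1 / 2) ^ i := by positivity
    linarith

/-- Layer `i` has measure at most `2 · 2^(-i)` and division by `d^α` costs at most `2^((i+1)α)`.
With `s = 1/2 - 1/q` the weights are dominated by a geometric series of ratio `2^(α - s) < 1`. -/
lemma isCqSystem_edgeGenerator {q : ℝ≥0∞} (hq : 2 ≤ q) {α : ℝ} (hα : -1 < 2 * α) (hα0 : 0 ≤ α)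
    (hαq : α < 1 / 2 - 1 / q.toReal) :
    IsCqSystem q (integerTranslates fun _ : Fin 1 => edgeGenerator hα) := by
  set s := 1 / 2 - 1 / q.toReal with hs
  have hs0 : 0 ≤ s := hα0.trans hαq.le
  refine isCqSystem_of_pieces hq (fourierL2_edgeGenerator_eq_zero hα)
    (norm_fourierL2_edgeGenerator_le hα hα0) measurableSet_dyadicEdge pairwise_disjoint_dyadicEdge
    ?_ (c := fun i => (2 ^ (i + 1) : ℝ) ^ α) (fun i => by positivity) (fun i => ?_) ?_
  · filter_upwards [coeFn_fourierL2_edgeGenerator hα] with x hx h0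
    refine exists_mem_dyadicEdge (edgeDist_pos_iff.2 ?_)
    by_contra h1
    rw [hx, edgePow_of_notMem h1] at h0
    exact h0 Complex.ofReal_zero
  · filter_upwards [coeFn_fourierL2_edgeGenerator hα] with x hx hxB
    have h1 : 0 < edgeDist x := lt_trans (by positivity) hxB.1
    rw [hx, Complex.norm_of_nonneg (edgePow_nonneg α x), edgePow, if_pos h1,
      ← Real.mul_rpow (by positivity) h1.le]
    refine Real.one_le_rpow ?_ hα0
    have h2 := hxB.1
    rw [one_div, inv_pow, inv_lt_iff_one_lt_mul₀ (by positivity)] at h2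
    linarith
  · have hr1 : (2 : ℝ) ^ (α - s) < 1 := Real.rpow_lt_one_of_one_lt_of_neg one_lt_two (by linarith)
    refine Summable.of_nonneg_of_le (fun i => by positivity) (fun i => ?_)
      ((summable_geometric_of_lt_one (by positivity) hr1).mul_left (2 ^ (s + α)))
    calc _ ≤ (2 * (1 / 2) ^ i) ^ s * (2 ^ (i + 1) : ℝ) ^ α := by
          gcongr
          exact unitVolume_dyadicEdge_le i
      _ = 2 ^ (s + α) * ((2 : ℝ) ^ (α - s)) ^ i := by
          have e : (2 * (1 / 2) ^ i : ℝ) = 2 ^ (1 - i : ℝ) := by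
            rw [Real.rpow_sub two_pos, Real.rpow_one, Real.rpow_natCast]; field_simp; simp
          rw [e, ← Real.rpow_natCast, ← Real.rpow_natCast, ← Real.rpow_mul two_pos.le,
            ← Real.rpow_mul two_pos.le, ← Real.rpow_mul two_pos.le, ← Real.rpow_add two_pos,
            ← Real.rpow_add two_pos]
          congr 1
          push_cast
          ring

/-- At `q = 2` the dyadic argument leaves no room even for `α = 0`. But then `f̂` is the indicator
of `(0, 1)`, and one piece with constant `1` is enough. -/
lemma isCqSystem_edgeGenerator_zero {q : ℝ≥0∞} (hq : 2 ≤ q) (h0 : (-1 : ℝ) < 2 * 0) :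
    IsCqSystem q (integerTranslates fun _ : Fin 1 => edgeGenerator h0) := by
  refine isCqSystem_of_pieces hq (fourierL2_edgeGenerator_eq_zero h0)
    (norm_fourierL2_edgeGenerator_le h0 le_rfl)
    (B := fun i => if i = 0 then Set.Ioo 0 1 else ∅) (fun i => ?_) (fun i j hij => ?_)
    ?_ (c := fun i => if i = 0 then 1 else 0) (fun i => ?_) (fun i => ?_) ?_
  · split_ifs <;> measurability
  · rcases eq_or_ne i 0 with rfl | hi
    · simp [Function.onFun, hij.symm]
    · simp [Function.onFun, hi]
  · filter_upwards [coeFn_fourierL2_edgeGenerator h0] with x hx hx0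
    refine ⟨0, ?_⟩
    rw [if_pos rfl]
    by_contra h1
    rw [hx, edgePow_of_notMem h1] at hx0
    exact hx0 Complex.ofReal_zero
  · split_ifs <;> norm_num
  · filter_upwards [coeFn_fourierL2_edgeGenerator h0] with x hx hxB
    rcases eq_or_ne i 0 with rfl | hi
    · rw [if_pos rfl] at hxB
      rw [hx, edgePow, if_pos (edgeDist_pos_iff.2 hxB)]
      simp
    · rw [if_neg hi] at hxB
      exact hxB.elim
  · refine summable_of_ne_finset_zero (s := {0}) fun i hi => ?_
    rw [if_neg (c := i = 0) (t := (1 : ℝ)) (by simpa using hi), mul_zero]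

lemma hasNontrivialExtraInvariance_edgeGenerator {α : ℝ} (hα : -1 < 2 * α) (hα' : -1 < 2 * -α)
    (hα0 : 0 ≤ α) : HasNontrivialExtraInvariance
      (shiftInvariantSpace (Set.range fun _ : Fin 1 => edgeGenerator hα)) := by
  have hhalf : (1 / 2 : ℝ) ∉ Set.range ((↑) : ℤ → ℝ) := by
    rintro ⟨n, hn⟩
    have : (2 * n : ℝ) = 1 := by rw [hn]; norm_num
    have h2 : 2 * n = 1 := by exact_mod_cast this
    omega
  refine ⟨1 / 2, hhalf, fun h hh => l2Translate_mem_of_support (fourierL2_edgeGenerator_eq_zero hα)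
    (norm_fourierL2_edgeGenerator_le hα hα0) _ hh, ?_⟩
  rw [(translatesBiorthogonal_edgeGenerator hα hα').minGenerators_eq, Nat.cast_one, one_mul]
  exact hhalf

/-- The condition `2β < 2α + 1` says that the weight `d^(α - β)` from the Hölder bound is square
integrable; `t < 2β` then makes the dyadic series for the moment converge. -/
lemma moment_edgeGenerator_lt_top {t α β : ℝ} (ht : 0 ≤ t) (hα : -1 < 2 * α) (hα0 : 0 ≤ α)
    (hαβ : α ≤ β) (hβ : β ≤ 1) (hβα : 2 * β < 2 * α + 1) (htβ : t < 2 * β) :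
    moment t (edgeGenerator hα) < ∞ := by
  have hfin := lintegral_edgePow_sq_lt_top (r := α - β) (by linarith)
  exact moment_lt_top_of_modulus ht htβ (ENNReal.mul_ne_top (by simp) hfin.ne) fun a ha =>
    enorm_sq_l2Translate_sub_le_of_edgePow hα0 hαβ hβ (coeFn_fourierL2_edgeGenerator hα) ha

/-- For `0 ≤ t < 2 / q'`, one of the generators `d^α` has a finite moment of order `t`. -/
lemma exists_edgeGenerator {q q' : ℝ≥0∞} (hq : 2 ≤ q) (hqq' : ENNReal.HolderConjugate q q') {t : ℝ}
    (ht : 0 ≤ t) (htq : t < 2 / q'.toReal) :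
    ∃ (α : ℝ) (hα : -1 < 2 * α), -1 < 2 * -α ∧ 0 ≤ α ∧
      IsCqSystem q (integerTranslates fun _ : Fin 1 => edgeGenerator hα) ∧
      moment t (edgeGenerator hα) < ∞ := by
  have e := one_div_toReal_of_holderConjugate hq hqq'
  have e2 : 2 / q'.toReal = 2 * (1 / q'.toReal) := by ring
  have hq0 : 0 ≤ 1 / q.toReal := by positivity
  rw [e2, e] at htq
  rcases lt_or_ge t 1 with h1 | h1
  · have h0 : (-1 : ℝ) < 2 * 0 := by norm_num
    exact ⟨0, h0, by norm_num, le_rfl, isCqSystem_edgeGenerator_zero hq h0,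
      moment_edgeGenerator_lt_top (β := (t + 1) / 4) ht h0 le_rfl (by linarith) (by linarith)
        (by linarith) (by linarith)⟩
  -- The midpoint of `(t - 1)/2`, above which the moment of order `t` is finite, and `1/2 - 1/q`,
  -- below which the `(C_q)` property holds. Likewise `β` is the midpoint of `t/2` and `α + 1/2`.
  · set α := (t - 1 + (1 - 2 * (1 / q.toReal))) / 4 with hα
    have hα1 : -1 < 2 * α := by linarith
    exact ⟨α, hα1, by linarith, by linarith,
      isCqSystem_edgeGenerator hq hα1 (by linarith) (by linarith),
      moment_edgeGenerator_lt_top (β := (t + (1 + 2 * α)) / 4) ht hα1 (by linarith) (by linarith)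
        (by linarith) (by linarith) (by linarith)⟩

theorem theorem1p7 (q q' : ℝ≥0∞) (hq : 2 ≤ q) (hqq' : ENNReal.HolderConjugate q q') :
    (∀ (K : ℕ) (F : Fin K → L2R),
      HasNontrivialExtraInvariance (shiftInvariantSpace (Set.range F)) →
      IsExactCqSystem q (integerTranslates F) →
      ∃ k : Fin K, ∀ t : ℝ, 2 / q'.toReal ≤ t → moment t (F k) = ∞) ∧
    (∀ t : ℝ, 0 ≤ t → t < 2 / q'.toReal →
      ∃ F : Fin 1 → L2R,
        HasNontrivialExtraInvariance (shiftInvariantSpace (Set.range F)) ∧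
        IsExactCqSystem q (integerTranslates F) ∧
        ∀ k : Fin 1, moment t (F k) < ∞) := by
  refine ⟨fun K F hV hF => ?_, fun t ht htq => ?_⟩
  · obtain ⟨k, hk⟩ := exists_moment_eq_top hq hqq' hV hF
    -- The index `k` found at the critical order serves every larger `t`.
    exact ⟨k, fun t ht => moment_mono (by positivity) ht hk⟩
  · obtain ⟨α, hα, hα', hα0, hC, hm⟩ := exists_edgeGenerator hq hqq' ht htq
    exact ⟨fun _ => edgeGenerator hα, hasNontrivialExtraInvariance_edgeGenerator hα hα' hα0,
      ⟨⟨hC.isCompleteSystem, (translatesBiorthogonal_edgeGenerator hα hα').isMinimalSystem⟩, hC⟩,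
      fun _ => hm⟩
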